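/- Let $D\subset\mathbb R^2$ be a non-empty connected open set and let $W_d$ ($d\ge 3$) be a planar $d$-web on $D$, given by smooth $1$-forms $\omega_1,\dots,\omega_d$ which are pairwise linearly independent at every point of $D$. Let $\pi\colon E\to D$ be the bundle whose smooth sections are the smooth $(\lambda_1,\dots,\lambda_d)\colon D\to\mathbb R^d$ with $\sum_i\lambda_i\omega_i=0$. The abelian equation is the system $d(\lambda_1\omega_1)=\dots=d(\lambda_d\omega_d)=0$ for sections of $\pi$. The rank of $W_d$ is the dimension of its space of smooth solutions on $D$. Let $\mathfrak A_0=E$ and, for $k\ge1$, let $\mathfrak A_k\subset J^k(\pi)$ be the $(k-1)$-st prolongation of the abelian equation: its fibre at $x$ consists of the $k$-jets at $x$ of sections $\lambda$ for which all the functions $d(\lambda_i\omega_i)$ vanish at $x$ together with their derivatives of order $\le k-1$. Let $\pi_{k,k-1}$ be the projection of $k$-jets to $(k-1)$-jets. **Theorem.** 1. For $0\le k\le d-2$, $\mathfrak A_k$ is a smooth vector bundle over $D$ of rank $(d-2)+(d-3)+\dots+(d-2-k)$. For $1\le k\le d-2$ the map $\pi_{k,k-1}\colon\mathfrak A_k\to\mathfrak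 A_{k-1}$ is surjective on fibres, with kernel of dimension $d-k-2$. 2. The bundle $\mathfrak A_{d-3}$ has rank $(d-1)(d-2)/2$, the projection $\pi_{d-2,d-3}\colon\mathfrak A_{d-2}\to\mathfrak A_{d-3}$ is an isomorphism, and it defines a linear connection $\nabla$ on $\mathfrak A_{d-3}$: for a smooth section $s$ of $\mathfrak A_{d-3}$ and $v\in\mathbb R^2$, $\nabla_v s(x)=D_v s(x)-T_v\big(\pi_{d-2,d-3}^{-1}(s(x))\big)$, where $T_v\colon J^{d-2}_x\to J^{d-3}_x$ is the total derivative along $v$ (it sends the $(d-2)$-jet of $\lambda$ at $x$ to the derivative along $v$ at $x$ of $y\mapsto j^{d-3}_y\lambda$). 3. The solution space is finite-dimensional, and the rank of $W_d$ is at most $(d-1)(d-2)/2$. 4. The foliations of $W_d$ can be defined by smooth $1$-forms on $D$, again denoted $\omega_i$, normalized so that $a_i\omega_1+\omega_2+\omega_{i+2}=0$ for $i=1,\dots,d-2$, with functions $a_i$ and $a_1=1$. For any such normalized forms let $\langle\partial_1,\partial_2\rangle$ be the frame dual to $\langle\omega_1,\omega_2\rangle$, let $\gamma=g_1\omega_1+g_2\omega_2$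 be the $1$-form with $d\omega_i=\omega_i\wedge\gamma$ ($i=1,2,3$), let $\delta_i u=\partial_i u-w\,g_i u$ for $u$ of weight $w$ (the result having weight $w+1$), and let $\Delta_i=\delta_1-\delta_2\circ a_i$, where $a_i$ has weight $0$. For a section $\lambda$ of the bundle $E$ of the normalized forms put $u_i=\lambda_{i+2}$, of weight $1$. Let $\varkappa$ be the multi-bracket of the system $\Delta_1u_1=\dots=\Delta_{d-2}u_{d-2}=0$, $\delta_1u_1+\dots+\delta_1u_{d-2}=0$ (the abelian equation, written in terms of the $u_i$), applied to $u_1,\dots,u_{d-2}$. Here the multi-bracket of the rows $A_1,\dots,A_{n+1}$ of an $(n+1)\times n$ matrix $A$ of linear differential operators is $\sum_{i=1}^{n+1}(-1)^{i-1}\operatorname{Ndet}(A^{(i)})\,A_i$, where $A^{(i)}$ is $A$ without its $i$-th row and $\operatorname{Ndet}$ is the non-commutative determinant obtained by expansion along the first column. Then, with $\mathfrak A_{d-2}$ formed from the normalized forms, $\varkappa$ is a well-defined function on $\mathfrak A_{d-2}$, linear on fibres, and: * every point of $D$ has a connected open neighbourhood $U\subset D$ such that the web restricted to $U$ has the maximum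 rank $(d-1)(d-2)/2$ if and only if $\varkappa=0$ on $\mathfrak A_{d-2}$; * if $D$ is simply connected, then $W_d$ has the maximum rank $(d-1)(d-2)/2$ on $D$ if and only if $\varkappa=0$ on $\mathfrak A_{d-2}$. -/

import Mathlib

open scoped ContDiff

noncomputable section

namespace WebGeometry

/-! ## Calculus in the plane `ℝ × ℝ` -/

/-- `∂f/∂x`. -/
def partialX {F : Type*} [NormedAddCommGroup F] [NormedSpace ℝ F] (f : ℝ × ℝ → F) : ℝ × ℝ → F :=
  fun x => fderiv ℝ f x (1, 0)

/-- `∂f/∂y`. -/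
def partialY {F : Type*} [NormedAddCommGroup F] [NormedSpace ℝ F] (f : ℝ × ℝ → F) : ℝ × ℝ → F :=
  fun x => fderiv ℝ f x (0, 1)

/-- `∂^{p+q} f / ∂x^p ∂y^q`. -/
def partialXY {F : Type*} [NormedAddCommGroup F] [NormedSpace ℝ F] (p q : ℕ)
    (f : ℝ × ℝ → F) : ℝ × ℝ → F :=
  partialX^[p] (partialY^[q] f)

/-- The exterior derivative of a 1-form on the plane: `dα(v, w) = (D_v α)(w) - (D_w α)(v)`. -/
def extD (α : ℝ × ℝ → (ℝ × ℝ →L[ℝ] ℝ)) (x v w : ℝ × ℝ) : ℝ :=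
  fderiv ℝ α x v w - fderiv ℝ α x w v

section Smooth

variable {F G : Type*} [NormedAddCommGroup F] [NormedSpace ℝ F]
  [NormedAddCommGroup G] [NormedSpace ℝ G] {D : Set (ℝ × ℝ)}

theorem contDiffOn_fderiv_apply (hD : IsOpen D) {f : ℝ × ℝ → F} (hf : ContDiffOn ℝ ∞ f D)
    (v : ℝ × ℝ) : ContDiffOn ℝ ∞ (fun x => fderiv ℝ f x v) D :=
  (hf.fderiv_of_isOpen hD (by simp)).clm_apply contDiffOn_const

theorem differentiableAt_of_smooth (hD : IsOpen D) {f : ℝ × ℝ → F} (hf : ContDiffOn ℝ ∞ f D)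
    {x : ℝ × ℝ} (hx : x ∈ D) : DifferentiableAt ℝ f x :=
  (hf.contDiffAt (hD.mem_nhds hx)).differentiableAt (by simp)

theorem fderiv_congr_on (hD : IsOpen D) {f g : ℝ × ℝ → F} (h : Set.EqOn f g D)
    {x : ℝ × ℝ} (hx : x ∈ D) : fderiv ℝ f x = fderiv ℝ g x :=
  Filter.EventuallyEq.fderiv_eq (Filter.eventuallyEq_of_mem (hD.mem_nhds hx) h)

theorem iterate_smooth (hD : IsOpen D) (v : ℝ × ℝ) (n : ℕ) :
    ∀ f : ℝ × ℝ → F, ContDiffOn ℝ ∞ f D →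
      ContDiffOn ℝ ∞ ((fun (g : ℝ × ℝ → F) x => fderiv ℝ g x v)^[n] f) D := by
  induction n with
  | zero => exact fun f hf => hf
  | succ n ih => exact fun f hf => ih _ (contDiffOn_fderiv_apply hD hf v)

theorem iterate_congr (hD : IsOpen D) (v : ℝ × ℝ) (n : ℕ) :
    ∀ f g : ℝ × ℝ → F, Set.EqOn f g D →
      Set.EqOn ((fun (g : ℝ × ℝ → F) x => fderiv ℝ g x v)^[n] f)
        ((fun (g : ℝ × ℝ → F) x => fderiv ℝ g x v)^[n] g) D := by
  induction n with
  | zero => exact fun f g h => h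
  | succ n ih =>
    exact fun f g h => ih _ _ (fun x hx => by simp only [fderiv_congr_on hD h hx])

theorem iterate_comb (hD : IsOpen D) (v : ℝ × ℝ) (a b : ℝ) (n : ℕ) :
    ∀ f g : ℝ × ℝ → F, ContDiffOn ℝ ∞ f D → ContDiffOn ℝ ∞ g D →
      Set.EqOn ((fun (g : ℝ × ℝ → F) x => fderiv ℝ g x v)^[n] (fun y => a • f y + b • g y))
        (fun y => a • (fun (g : ℝ × ℝ → F) x => fderiv ℝ g x v)^[n] f y
          + b • (fun (g : ℝ × ℝ → F) x => fderiv ℝ g x v)^[n] g y) D := by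
  induction n with
  | zero => exact fun f g _ _ x _ => rfl
  | succ n ih =>
    intro f g hf hg
    have h1 : Set.EqOn (fun x => fderiv ℝ (fun y => a • f y + b • g y) x v)
        (fun x => a • fderiv ℝ f x v + b • fderiv ℝ g x v) D := by
      intro x hx
      have hf' := differentiableAt_of_smooth hD hf hx
      have hg' := differentiableAt_of_smooth hD hg hx
      simp only
      have h := (hf'.hasFDerivAt.const_smul a).add (hg'.hasFDerivAt.const_smul b)
      have h' : fderiv ℝ (fun y => a • f y + b • g y) x = _ := h.fderiv
      simp [h']
    simp only [Function.iterate_succ_apply]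
    exact (iterate_congr hD v n _ _ h1).trans
      (ih _ _ (contDiffOn_fderiv_apply hD hf v) (contDiffOn_fderiv_apply hD hg v))

theorem partialXY_congr (hD : IsOpen D) (p q : ℕ) {f g : ℝ × ℝ → F} (h : Set.EqOn f g D) :
    Set.EqOn (partialXY p q f) (partialXY p q g) D :=
  iterate_congr hD (1, 0) p _ _ (iterate_congr hD (0, 1) q _ _ h)

theorem partialXY_comb (hD : IsOpen D) (p q : ℕ) (a b : ℝ) {f g : ℝ × ℝ → F}
    (hf : ContDiffOn ℝ ∞ f D) (hg : ContDiffOn ℝ ∞ g D) :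
    Set.EqOn (partialXY p q (fun y => a • f y + b • g y))
      (fun y => a • partialXY p q f y + b • partialXY p q g y) D :=
  (iterate_congr hD (1, 0) p _ _ (iterate_comb hD (0, 1) a b q f g hf hg)).trans
    (iterate_comb hD (1, 0) a b p _ _ (iterate_smooth hD (0, 1) q f hf)
      (iterate_smooth hD (0, 1) q g hg))

end Smooth

/-! ## Jets -/

/-- Index set of the derivatives `∂x^p ∂y^q` with `p + q ≤ k`. -/
abbrev JetIndex (k : ℕ) : Type := {p : ℕ × ℕ // p.1 + p.2 ≤ k}

instance instFintypeJetIndex (k : ℕ) : Fintype (JetIndex k) :=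
  Fintype.subtype ((Finset.range (k + 1) ×ˢ Finset.range (k + 1)).filter fun p => p.1 + p.2 ≤ k)
    (by rintro ⟨p, q⟩; simp only [Finset.mem_filter, Finset.mem_product, Finset.mem_range]; omega)

/-- The fibre of the bundle of `k`-jets of maps `ℝ² → ℝ^d`, in the standard jet coordinates. -/
abbrev JetFibre (d k : ℕ) : Type := JetIndex k → Fin d → ℝ

/-- The `k`-jet of `f` at `x`. -/
def jet {d : ℕ} (k : ℕ) (x : ℝ × ℝ) (f : ℝ × ℝ → Fin d → ℝ) : JetFibre d k :=
  fun p => partialXY p.1.1 p.1.2 f x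

/-- The natural projection `J^l → J^k`, `k ≤ l`. -/
def jetProj (d : ℕ) {k l : ℕ} (h : k ≤ l) : JetFibre d l →ₗ[ℝ] JetFibre d k where
  toFun j p := j ⟨p.1, p.2.trans h⟩
  map_add' _ _ := rfl
  map_smul' _ _ := rfl

/-- The total derivative in the direction `v`: it sends the `l`-jet at `x` of a map `f` to the
derivative at `x` in the direction `v` of the field `y ↦ j^k_y f` of its `k`-jets, `k + 1 ≤ l`. -/
def totalDeriv (d : ℕ) {k l : ℕ} (h : k + 1 ≤ l) (v : ℝ × ℝ) :
    JetFibre d l →ₗ[ℝ] JetFibre d k where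
  toFun j p := v.1 • j ⟨(p.1.1 + 1, p.1.2), by have := p.2; simp only; omega⟩
    + v.2 • j ⟨(p.1.1, p.1.2 + 1), by have := p.2; simp only; omega⟩
  map_add' _ _ := by ext p i; simp; ring
  map_smul' _ _ := by ext p i; simp; ring

/-! ## Subbundles of a trivial bundle and linear connections -/

/-- The fibres `A x`, `x ∈ D`, form a smooth vector subbundle of rank `r` of the trivial bundle
`V × D`: locally they have a smooth frame of `r` sections. -/
def IsVectorSubbundle {V : Type*} [NormedAddCommGroup V] [NormedSpace ℝ V]
    (D : Set (ℝ × ℝ)) (A : D → Submodule ℝ V) (r : ℕ) : Prop :=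
  ∀ x : D, ∃ U : Set (ℝ × ℝ), IsOpen U ∧ (x : ℝ × ℝ) ∈ U ∧ ∃ e : Fin r → ℝ × ℝ → V,
    (∀ i, ContDiffOn ℝ ∞ (e i) (U ∩ D)) ∧
    ∀ y : D, (y : ℝ × ℝ) ∈ U →
      LinearIndependent ℝ (fun i => e i y) ∧ Submodule.span ℝ (Set.range fun i => e i y) = A y

/-- `s` is a smooth section over `D` of the bundle with fibres `A x`. -/
def IsSmoothSection {V : Type*} [NormedAddCommGroup V] [NormedSpace ℝ V]
    (D : Set (ℝ × ℝ)) (A : D → Submodule ℝ V) (s : ℝ × ℝ → V) : Prop :=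
  ContDiffOn ℝ ∞ s D ∧ ∀ x : D, s x ∈ A x

/-- `nabla` is a linear connection (covariant derivative) on the subbundle of `V × D` with
fibres `A x`; `nabla v s x` is the covariant derivative at `x` of the section `s` along `v`,
where `v` is a tangent vector of the plane (identified with a constant vector field). -/
structure IsLinearConnection {V : Type*} [NormedAddCommGroup V] [NormedSpace ℝ V]
    (D : Set (ℝ × ℝ)) (A : D → Submodule ℝ V)
    (nabla : ℝ × ℝ → (ℝ × ℝ → V) → ℝ × ℝ → V) : Prop where
  isSection : ∀ v s, IsSmoothSection D A s → IsSmoothSection D A (nabla v s)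
  add_dir : ∀ v w s, IsSmoothSection D A s → ∀ x ∈ D,
    nabla (v + w) s x = nabla v s x + nabla w s x
  smul_dir : ∀ (c : ℝ) v s, IsSmoothSection D A s → ∀ x ∈ D, nabla (c • v) s x = c • nabla v s x
  add : ∀ v s t, IsSmoothSection D A s → IsSmoothSection D A t → ∀ x ∈ D,
    nabla v (fun y => s y + t y) x = nabla v s x + nabla v t x
  leibniz : ∀ v (f : ℝ × ℝ → ℝ) s, ContDiffOn ℝ ∞ f D → IsSmoothSection D A s → ∀ x ∈ D,
    nabla v (fun y => f y • s y) x = fderiv ℝ f x v • s x + f x • nabla v s x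

/-! ## The multi-bracket of a system of `n + 1` linear equations for `n` unknown functions -/

/-- The non-commutative determinant of a matrix of operators: expansion along the first column,
products being compositions. -/
def ndet {V : Type*} [AddCommGroup V] : (n : ℕ) → (Fin n → Fin n → V → V) → V → V
  | 0, _ => id
  | n + 1, A => fun φ =>
      ∑ i : Fin (n + 1), (-1 : ℤ) ^ (i : ℕ) •
        A i 0 (ndet n (fun r c => A (i.succAbove r) c.succ) φ)

/-- The multi-bracket `∑ᵢ (-1)^{i-1} Ndet(Aᵢ) aᵢ` of the rows `aᵢ` of an `(n+1) × n` matrix of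
operators, applied to the unknowns `u`; `Aᵢ` is the matrix with its `i`-th row deleted. -/
def multiBracket {V : Type*} [AddCommGroup V] (n : ℕ) (A : Fin (n + 1) → Fin n → V → V)
    (u : Fin n → V) : V :=
  ∑ i : Fin (n + 1), (-1 : ℤ) ^ (i : ℕ) •
    ndet n (fun r => A (i.succAbove r)) (∑ j, A i j (u j))

/-! ## Planar webs -/

/-- A planar `d`-web, `d ≥ 3`, on an open set `D` of the plane: `d` foliations, given by smooth
1-forms `form i` (the leaves of the `i`-th foliation are the integral curves of `ker (form i)`), any two
of which are transversal. -/
structure PlanarWeb (d : ℕ) (D : Set (ℝ × ℝ)) where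
  three_le : 3 ≤ d
  isOpen : IsOpen D
  form : Fin d → ℝ × ℝ → (ℝ × ℝ →L[ℝ] ℝ)
  smooth : ∀ i, ContDiffOn ℝ ∞ (form i) D
  transversal : ∀ i j, i ≠ j → ∀ x ∈ D, LinearIndependent ℝ ![form i x, form j x]

namespace PlanarWeb

variable {d : ℕ} {D : Set (ℝ × ℝ)}

/-- The restriction of a web to a smaller open set. -/
def restrict (W : PlanarWeb d D) (U : Set (ℝ × ℝ)) (hU : IsOpen U) (h : U ⊆ D) :
    PlanarWeb d U where
  three_le := W.three_le
  isOpen := hU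
  form := W.form
  smooth i := (W.smooth i).mono h
  transversal i j hij x hx := W.transversal i j hij x (h hx)

/-- The 1-forms of `W` and `W'` define the same foliations. -/
def SameFoliations (W W' : PlanarWeb d D) : Prop :=
  ∀ i, ∀ x ∈ D, ∀ v : ℝ × ℝ, W.form i x v = 0 ↔ W'.form i x v = 0

/-- Sections `(λ_1, …, λ_d)` over `D` of the bundle `π : E → D`, i.e. `∑ λ_i ω_i = 0`. -/
def IsSection (W : PlanarWeb d D) (lam : ℝ × ℝ → Fin d → ℝ) : Prop :=
  ContDiffOn ℝ ∞ lam D ∧ ∀ x ∈ D, ∑ i, lam x i • W.form i x = 0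

/-- The coefficient of `dx ∧ dy` in `d(λ_i ω_i)`. -/
def dForm (W : PlanarWeb d D) (i : Fin d) (lam : ℝ × ℝ → Fin d → ℝ) : ℝ × ℝ → ℝ :=
  fun x => extD (fun y => lam y i • W.form i y) x (1, 0) (0, 1)

theorem smooth_smul (W : PlanarWeb d D) (i : Fin d) {lam : ℝ × ℝ → Fin d → ℝ}
    (h : ContDiffOn ℝ ∞ lam D) : ContDiffOn ℝ ∞ (fun y => lam y i • W.form i y) D :=
  (contDiffOn_pi.1 h i).smul (W.smooth i)

theorem smooth_dForm (W : PlanarWeb d D) (i : Fin d) {lam : ℝ × ℝ → Fin d → ℝ}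
    (h : ContDiffOn ℝ ∞ lam D) : ContDiffOn ℝ ∞ (W.dForm i lam) D :=
  ((contDiffOn_fderiv_apply W.isOpen (W.smooth_smul i h) (1, 0)).clm_apply contDiffOn_const).sub
    ((contDiffOn_fderiv_apply W.isOpen (W.smooth_smul i h) (0, 1)).clm_apply contDiffOn_const)

theorem dForm_comb (W : PlanarWeb d D) (i : Fin d) (a b : ℝ) {f g : ℝ × ℝ → Fin d → ℝ}
    (hf : ContDiffOn ℝ ∞ f D) (hg : ContDiffOn ℝ ∞ g D) :
    Set.EqOn (W.dForm i (fun y => a • f y + b • g y))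
      (fun y => a • W.dForm i f y + b • W.dForm i g y) D := by
  intro x hx
  have hf' := differentiableAt_of_smooth W.isOpen (W.smooth_smul i hf) hx
  have hg' := differentiableAt_of_smooth W.isOpen (W.smooth_smul i hg) hx
  have e : (fun y => (a • f y + b • g y) i • W.form i y)
      = fun y => a • (f y i • W.form i y) + b • (g y i • W.form i y) := by
    funext y; simp [add_smul, mul_smul]
  simp only [dForm, extD]
  have h := (hf'.hasFDerivAt.const_smul a).add (hg'.hasFDerivAt.const_smul b)
  have h' : fderiv ℝ (fun y => a • (f y i • W.form i y) + b • (g y i • W.form i y)) x = _ :=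
    h.fderiv
  rw [e, h']
  simp
  ring

theorem IsSection.comb {W : PlanarWeb d D} (a b : ℝ) {f g : ℝ × ℝ → Fin d → ℝ}
    (hf : W.IsSection f) (hg : W.IsSection g) : W.IsSection (fun y => a • f y + b • g y) := by
  refine ⟨(hf.1.const_smul a).add (hg.1.const_smul b), fun x hx => ?_⟩
  have := hf.2 x hx
  have := hg.2 x hx
  simp only [Pi.add_apply, Pi.smul_apply, smul_eq_mul, add_smul, mul_smul,
    Finset.sum_add_distrib, ← Finset.smul_sum, *]
  simp

/-- Solutions over `D` of the abelian equation: `∑ λ_i ω_i = 0` and `d(λ_i ω_i) = 0`, all `i`. -/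
def IsSolution (W : PlanarWeb d D) (lam : ℝ × ℝ → Fin d → ℝ) : Prop :=
  W.IsSection lam ∧ ∀ i, ∀ x ∈ D, W.dForm i lam x = 0

theorem IsSolution.comb {W : PlanarWeb d D} (a b : ℝ) {f g : ℝ × ℝ → Fin d → ℝ}
    (hf : W.IsSolution f) (hg : W.IsSolution g) : W.IsSolution (fun y => a • f y + b • g y) := by
  refine ⟨hf.1.comb a b hg.1, fun i x hx => ?_⟩
  rw [W.dForm_comb i a b hf.1.1 hg.1.1 hx]
  simp [hf.2 i x hx, hg.2 i x hx]

/-- The space of solutions over `D` of the abelian equation. A function on `D` is represented by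
its extension by zero to the plane. -/
def Sol (W : PlanarWeb d D) : Submodule ℝ (ℝ × ℝ → Fin d → ℝ) where
  carrier := {lam | W.IsSolution lam ∧ ∀ x, x ∉ D → lam x = 0}
  add_mem' {f g} hf hg := by
    have := hf.1.comb 1 1 hg.1
    simp only [one_smul] at this
    exact ⟨this, fun x hx => by simp [hf.2 x hx, hg.2 x hx]⟩
  zero_mem' := by
    refine ⟨⟨⟨contDiffOn_const, fun x _ => by simp⟩, fun i x _ => ?_⟩, fun x _ => rfl⟩
    simp [dForm, extD]
  smul_mem' c f hf := by
    have := hf.1.comb c 0 hf.1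
    simp only [zero_smul, add_zero] at this
    exact ⟨this, fun x hx => by simp [hf.2 x hx]⟩

/-- The rank of a web: the dimension of the solution space of its abelian equation. -/
def rank (W : PlanarWeb d D) : ℕ := Module.finrank ℝ W.Sol

/-- The fibre at `x` of `𝔄_k ⊂ J^k(π)`: the `k`-jets at `x` of sections of `π` for which the
`(k-1)`-jets at `x` of the left-hand sides `d(λ_i ω_i)` of the abelian equation vanish.
So `𝔄_0 = E`, `𝔄_1` is the abelian equation, and `𝔄_k` is its `(k-1)`-st prolongation. -/
def prolongation (W : PlanarWeb d D) (k : ℕ) (x : D) : Submodule ℝ (JetFibre d k) where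
  carrier := {j | ∃ lam, W.IsSection lam ∧
    (∀ i p q, p + q < k → partialXY p q (W.dForm i lam) x = 0) ∧ jet k x lam = j}
  add_mem' := by
    rintro _ _ ⟨f, hf, hf', rfl⟩ ⟨g, hg, hg', rfl⟩
    refine ⟨fun y => (1 : ℝ) • f y + (1 : ℝ) • g y, hf.comb 1 1 hg, fun i p q hpq => ?_, ?_⟩
    · rw [partialXY_congr W.isOpen p q (W.dForm_comb i 1 1 hf.1 hg.1) x.2,
        partialXY_comb W.isOpen p q 1 1 (W.smooth_dForm i hf.1) (W.smooth_dForm i hg.1) x.2]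
      simp [hf' i p q hpq, hg' i p q hpq]
    · funext p
      have := partialXY_comb W.isOpen p.1.1 p.1.2 1 1 hf.1 hg.1 x.2
      simpa [jet] using this
  zero_mem' := by
    have h0 : ∀ (v : ℝ × ℝ) (n : ℕ) (F : Type) [NormedAddCommGroup F] [NormedSpace ℝ F],
        (fun (g : ℝ × ℝ → F) x => fderiv ℝ g x v)^[n] (fun _ => 0) = fun _ => 0 := by
      intro v n F _ _
      induction n with
      | zero => rfl
      | succ n ih => simpa [Function.iterate_succ_apply] using ih
    have h1 : ∀ (p q : ℕ) (F : Type) [NormedAddCommGroup F] [NormedSpace ℝ F],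
        partialXY p q (fun _ => (0 : F)) = fun _ => 0 := by
      intro p q F _ _
      exact (congrArg _ (h0 (0, 1) q F)).trans (h0 (1, 0) p F)
    have h2 : ∀ i, W.dForm i (fun _ => 0) = fun _ => 0 := by
      intro i; funext x; simp [dForm, extD]
    exact ⟨fun _ => 0, ⟨contDiffOn_const, fun x _ => by simp⟩,
      fun i p q _ => by rw [h2, h1], by funext p; simp [jet, h1]⟩
  smul_mem' := by
    rintro c _ ⟨f, hf, hf', rfl⟩
    refine ⟨fun y => c • f y + (0 : ℝ) • f y, hf.comb c 0 hf, fun i p q hpq => ?_, ?_⟩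
    · rw [partialXY_congr W.isOpen p q (W.dForm_comb i c 0 hf.1 hf.1) x.2,
        partialXY_comb W.isOpen p q c 0 (W.smooth_dForm i hf.1) (W.smooth_dForm i hf.1) x.2]
      simp [hf' i p q hpq]
    · funext p
      have := partialXY_comb W.isOpen p.1.1 p.1.2 c 0 hf.1 hf.1 x.2
      simpa [jet] using this

/-! ### Normalized webs, the Chern connection and the obstruction -/

/-- The 1-form `ω_1`. -/
def form₁ (W : PlanarWeb d D) : ℝ × ℝ → (ℝ × ℝ →L[ℝ] ℝ) := W.form ⟨0, by have := W.three_le; omega⟩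

/-- The 1-form `ω_2`. -/
def form₂ (W : PlanarWeb d D) : ℝ × ℝ → (ℝ × ℝ →L[ℝ] ℝ) := W.form ⟨1, by have := W.three_le; omega⟩

/-- The index of `ω_{i+2}`, `i = 1, …, d-2` (here `i` is counted from zero). -/
def shift (i : Fin (d - 2)) : Fin d := ⟨i + 2, by have := i.2; omega⟩

/-- The frame `∂_1, ∂_2` dual to the coframe `ω_1, ω_2`. -/
def frame (W : PlanarWeb d D) (r : Fin 2) (x : ℝ × ℝ) : ℝ × ℝ :=
  (W.form₁ x (1, 0) * W.form₂ x (0, 1) - W.form₁ x (0, 1) * W.form₂ x (1, 0))⁻¹ •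
    ![(W.form₂ x (0, 1), -W.form₂ x (1, 0)), (-W.form₁ x (0, 1), W.form₁ x (1, 0))] r

/-- The basic invariants `a_1, …, a_{d-2}`: `a_i = -ω_{i+2}(∂_1)`, see `IsNormalized`. -/
def basicInvariant (W : PlanarWeb d D) (i : Fin (d - 2)) (x : ℝ × ℝ) : ℝ :=
  -W.form (shift i) x (W.frame 0 x)

/-- The 1-forms of the web are normalized:
`a_i ω_1 + ω_2 + ω_{i+2} = 0` for `i = 1, …, d-2`, and `a_1 = 1`. -/
def IsNormalized (W : PlanarWeb d D) : Prop :=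
  ∀ x ∈ D, (∀ i : Fin (d - 2), W.basicInvariant i x • W.form₁ x + W.form₂ x + W.form (shift i) x = 0) ∧
    W.basicInvariant ⟨0, by have := W.three_le; omega⟩ x = 1

/-- The coefficients of the connection form `γ = g_1 ω_1 + g_2 ω_2` of the Chern connection of
the 3-subweb `ω_1, ω_2, ω_3`. They are found from `dω_1 = ω_1 ∧ γ = g_2 ω_1 ∧ ω_2` and
`dω_2 = ω_2 ∧ γ = -g_1 ω_1 ∧ ω_2`. -/
def chern (W : PlanarWeb d D) (r : Fin 2) (x : ℝ × ℝ) : ℝ :=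
  ![-extD W.form₂ x (W.frame 0 x) (W.frame 1 x), extD W.form₁ x (W.frame 0 x) (W.frame 1 x)] r

/-- Functions graded by weight: `φ w` is the component of weight `w`. -/
abbrev Weighted : Type := ℕ → ℝ × ℝ → ℝ

/-- The covariant derivatives `δ_1` (`r = 0`), `δ_2` (`r = 1`) of the Chern connection:
`δ_i u = ∂_i u - w g_i u` for `u` of weight `w`; the result has weight `w + 1`. -/
def δ (W : PlanarWeb d D) (r : Fin 2) (φ : Weighted) : Weighted
  | 0 => 0
  | w + 1 => fun x => fderiv ℝ (φ w) x (W.frame r x) - w * W.chern r x * φ w x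

/-- `Δ_i = δ_1 - δ_2 ∘ a_i`, where the basic invariants `a_i` have weight 0. -/
def Δ (W : PlanarWeb d D) (i : Fin (d - 2)) (φ : Weighted) : Weighted :=
  W.δ 0 φ - W.δ 1 (fun w x => W.basicInvariant i x * φ w x)

/-- The matrix of the abelian system `Δ_1 u_1 = ⋯ = Δ_{d-2} u_{d-2} = 0`,
`δ_1 u_1 + ⋯ + δ_1 u_{d-2} = 0`: the diagonal matrix of the `Δ_i` with a last row of `δ_1`. -/
def abelianMatrix (W : PlanarWeb d D) :
    Fin (d - 2 + 1) → Fin (d - 2) → Weighted → Weighted :=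
  Fin.snoc (α := fun _ => Fin (d - 2) → Weighted → Weighted)
    (fun r c => if r = c then W.Δ r else 0) (fun _ => W.δ 0)

/-- The obstruction `ϰ` on a section `(λ_1, …, λ_d)` of `π`: the multi-bracket of the abelian
system, applied to the functions `u_i = λ_{i+2}` of weight 1; the result has weight `d`. -/
def obstruction (W : PlanarWeb d D) (lam : ℝ × ℝ → Fin d → ℝ) : ℝ × ℝ → ℝ :=
  multiBracket (d - 2) W.abelianMatrix (fun i => Pi.single 1 (fun y => lam y (shift i))) d

end PlanarWeb

end WebGeometry

end

open scoped ContDiff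

noncomputable section

namespace WebGeometry

/-! ## Iterated partial derivatives -/

section Calculus

variable {F : Type*} [NormedAddCommGroup F] [NormedSpace ℝ F] {D : Set (ℝ × ℝ)} {f g : ℝ × ℝ → F}

/-! At a point write `ω_i = a_i dx + b_i dy`. The equation `d(λ_i ω_i) = 0` has as symbol the vector
field `ξ_i = b_i ∂x - a_i ∂y`, and a binary form killed by `ξ_i` is a multiple of a power of `ℓ_i =
a_i x + b_i y`. Together with `∑ λ_i ω_i = 0` this identifies the kernel of `𝔄_k → 𝔄_{k-1}` with the
relations `∑ c_i ℓ_i^{k+1} = 0` (`map_powerJet_ker`). The `ℓ_i` are pairwise independent, so for `k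
+ 2 ≤ d` their powers span all forms of degree `k + 1`, and the relations have dimension `d - k - 2`
(`finrank_ker_powerMap`).

Lifting a `k`-jet by one order requires solving `ξ_i μ_i = -r_i` with `∑ μ_i ω_i = 0`, where `r_i`
is the leading part of `d(λ_i ω_i)` and `∑ r_i = 0`. Solving without the side condition leaves a
form `T` of degree `k + 2` that has to be a combination of the `ℓ_i^{k+2}`
(`exists_symbol_solution`). This is automatic for `k + 3 ≤ d`, so the ranks follow by rank-nullity,
and kernels of constant rank are smooth bundles. For `k = d - 2` one scalar condition remains, `ξ_1
⋯ ξ_d T = 0`.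

The last projection is an isomorphism, so the `(d-3)`-jet of a solution satisfies a closed linear
first order system: it is parallel for the connection. Gronwall's inequality and connectedness of
`D` make the jet at one point determine the solution (`jetMap_injective`), which bounds the rank.

The multi-bracket expands to compositions of first order operators (`multiBracket_bordered`). On
each unknown the words occur in pairs that differ by a permutation, so the order drops from `d - 1`
to `d - 2` and `ϰ` is a function of the `(d-2)`-jet (`isDiffOp_obstruction`). If the `d(λ_i ω_i)`
vanish to order `d - 2`, only symbols contribute, and `ϰ` is, up to a nonzero factor, the remaining
lifting condition (`sum_seqAct_eq`).

If `ϰ = 0`, all of `𝔄_{d-2}` lifts to `𝔄_{d-1}`. This forces the curvature to vanish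
(`frameConnection_flat`), so parallel sections, hence solutions, exist locally with any initial jet
(`exists_flat_section`, `exists_local_solution`), and globally if there is no monodromy
(`exists_global_solution`). Conversely, maximum rank makes every element of `𝔄_{d-2}` the jet of a
local solution, and `ϰ` vanishes on solutions. Rescaling the forms does not change the rank
(`SameFoliations.rank_eq`), so all of this applies to a normalization. -/

theorem contDiffOn_partialX (hD : IsOpen D) (hf : ContDiffOn ℝ ∞ f D) :
    ContDiffOn ℝ ∞ (partialX f) D :=
  contDiffOn_fderiv_apply hD hf _

theorem contDiffOn_partialY (hD : IsOpen D) (hf : ContDiffOn ℝ ∞ f D) :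
    ContDiffOn ℝ ∞ (partialY f) D :=
  contDiffOn_fderiv_apply hD hf _

theorem contDiffOn_partialXY (hD : IsOpen D) (p q : ℕ) (hf : ContDiffOn ℝ ∞ f D) :
    ContDiffOn ℝ ∞ (partialXY p q f) D :=
  iterate_smooth hD (1, 0) p _ (iterate_smooth hD (0, 1) q f hf)

theorem partialXY_succ_left (p q : ℕ) (f : ℝ × ℝ → F) :
    partialXY (p + 1) q f = partialX (partialXY p q f) :=
  Function.iterate_succ_apply' _ _ _

theorem partialXY_succ_right (p q : ℕ) (f : ℝ × ℝ → F) :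
    partialXY p (q + 1) f = partialXY p q (partialY f) :=
  congrArg (partialX^[p]) (Function.iterate_succ_apply _ _ _)

theorem partialXY_zero_succ (q : ℕ) (f : ℝ × ℝ → F) :
    partialXY 0 (q + 1) f = partialY (partialXY 0 q f) :=
  Function.iterate_succ_apply' _ _ _

theorem fderiv_fderiv_apply (hD : IsOpen D) (hf : ContDiffOn ℝ ∞ f D) {x : ℝ × ℝ} (hx : x ∈ D)
    (v w : ℝ × ℝ) :
    fderiv ℝ (fun y => fderiv ℝ f y v) x w = fderiv ℝ (fderiv ℝ f) x w v := by
  have h := differentiableAt_of_smooth hD (hf.fderiv_of_isOpen hD (m := ∞) (by simp)) hx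
  have := h.hasFDerivAt.clm_apply (hasFDerivAt_const v x)
  rw [this.fderiv]
  simp

theorem fderiv_fderiv_comm (hD : IsOpen D) (hf : ContDiffOn ℝ ∞ f D) {x : ℝ × ℝ} (hx : x ∈ D)
    (v w : ℝ × ℝ) :
    fderiv ℝ (fderiv ℝ f) x w v = fderiv ℝ (fderiv ℝ f) x v w :=
  ((hf.contDiffAt (hD.mem_nhds hx)).isSymmSndFDerivAt
    (by simpa using WithTop.coe_le_coe.2 (le_top : (2 : ℕ∞) ≤ ⊤))).eq w v

theorem partialX_partialY (hD : IsOpen D) (hf : ContDiffOn ℝ ∞ f D) :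
    Set.EqOn (partialX (partialY f)) (partialY (partialX f)) D := fun x hx => by
  change fderiv ℝ (fun y => fderiv ℝ f y (0, 1)) x (1, 0) =
    fderiv ℝ (fun y => fderiv ℝ f y (1, 0)) x (0, 1)
  rw [fderiv_fderiv_apply hD hf hx, fderiv_fderiv_apply hD hf hx, fderiv_fderiv_comm hD hf hx]

theorem partialX_congr (hD : IsOpen D) (h : Set.EqOn f g D) :
    Set.EqOn (partialX f) (partialX g) D := fun x hx => by
  simp only [partialX, fderiv_congr_on hD h hx]

theorem partialY_congr (hD : IsOpen D) (h : Set.EqOn f g D) :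
    Set.EqOn (partialY f) (partialY g) D := fun x hx => by
  simp only [partialY, fderiv_congr_on hD h hx]

theorem partialX_partialXY_zero (hD : IsOpen D) (q : ℕ) (hf : ContDiffOn ℝ ∞ f D) :
    Set.EqOn (partialX (partialXY 0 q f)) (partialXY 0 q (partialX f)) D := by
  induction q with
  | zero => exact fun x _ => rfl
  | succ q ih =>
    rw [partialXY_zero_succ, partialXY_zero_succ]
    exact (partialX_partialY hD (contDiffOn_partialXY hD 0 q hf)).trans (partialY_congr hD ih)

/-- By definition the `∂y` act first, so a further `∂x` is free only on the outside; moving it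
inside rests on the symmetry of second derivatives. -/
theorem partialXY_succ_left' (hD : IsOpen D) (p q : ℕ) (hf : ContDiffOn ℝ ∞ f D) :
    Set.EqOn (partialXY (p + 1) q f) (partialXY p q (partialX f)) D := by
  have h : partialXY (p + 1) q f = partialX^[p] (partialX (partialXY 0 q f)) :=
    Function.iterate_succ_apply _ _ _
  rw [h]
  exact iterate_congr hD (1, 0) p _ _ (partialX_partialXY_zero hD q hf)

theorem partialY_partialXY (hD : IsOpen D) (p q : ℕ) (hf : ContDiffOn ℝ ∞ f D) :
    Set.EqOn (partialY (partialXY p q f)) (partialXY p (q + 1) f) D := by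
  induction p with
  | zero => rw [partialXY_zero_succ]; exact fun x _ => rfl
  | succ p ih =>
    rw [partialXY_succ_left, partialXY_succ_left]
    exact (partialX_partialY hD (contDiffOn_partialXY hD p q hf)).symm.trans (partialX_congr hD ih)

theorem partialXY_add (hD : IsOpen D) (p q : ℕ) (hf : ContDiffOn ℝ ∞ f D)
    (hg : ContDiffOn ℝ ∞ g D) {x : ℝ × ℝ} (hx : x ∈ D) :
    partialXY p q (fun y => f y + g y) x = partialXY p q f x + partialXY p q g x := by
  simpa using partialXY_comb hD p q 1 1 hf hg hx

theorem partialXY_sub (hD : IsOpen D) (p q : ℕ) (hf : ContDiffOn ℝ ∞ f D)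
    (hg : ContDiffOn ℝ ∞ g D) {x : ℝ × ℝ} (hx : x ∈ D) :
    partialXY p q (fun y => f y - g y) x = partialXY p q f x - partialXY p q g x := by
  simpa [sub_eq_add_neg] using partialXY_comb hD p q 1 (-1) hf hg hx

theorem partialXY_const_smul (hD : IsOpen D) (p q : ℕ) (c : ℝ) (hf : ContDiffOn ℝ ∞ f D)
    {x : ℝ × ℝ} (hx : x ∈ D) :
    partialXY p q (fun y => c • f y) x = c • partialXY p q f x := by
  simpa using partialXY_comb hD p q c 0 hf hf hx

theorem partialXY_const_zero (p q : ℕ) : partialXY p q (fun _ => (0 : F)) = fun _ => 0 := by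
  have h0 : ∀ (v : ℝ × ℝ) (n : ℕ),
      (fun (g : ℝ × ℝ → F) x => fderiv ℝ g x v)^[n] (fun _ => 0) = fun _ => 0 := by
    intro v n
    induction n with
    | zero => rfl
    | succ n ih => simpa [Function.iterate_succ_apply] using ih
  exact (congrArg _ (h0 (0, 1) q)).trans (h0 (1, 0) p)

theorem partialXY_eq_zero (hD : IsOpen D) (p q : ℕ) (h : ∀ x ∈ D, f x = 0) {x : ℝ × ℝ}
    (hx : x ∈ D) : partialXY p q f x = 0 := by
  rw [partialXY_congr hD p q (g := fun _ => 0) h hx, partialXY_const_zero]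

theorem partialXY_sum {ι : Type*} (s : Finset ι) (hD : IsOpen D) (p q : ℕ) {h : ι → ℝ × ℝ → F}
    (hh : ∀ i ∈ s, ContDiffOn ℝ ∞ (h i) D) {x : ℝ × ℝ} (hx : x ∈ D) :
    partialXY p q (fun y => ∑ i ∈ s, h i y) x = ∑ i ∈ s, partialXY p q (h i) x := by
  classical
  induction s using Finset.induction_on with
  | empty => simp [partialXY_const_zero]
  | insert a s ha ih =>
    simp only [Finset.sum_insert ha]
    rw [partialXY_add hD p q (hh a (by simp)) (ContDiffOn.sum fun i hi => hh i (by simp [hi])) hx,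
      ih fun i hi => hh i (by simp [hi])]

theorem partialXY_apply {ι : Type*} [Fintype ι] {E : ι → Type*} [∀ i, NormedAddCommGroup (E i)]
    [∀ i, NormedSpace ℝ (E i)] {h : ℝ × ℝ → ∀ i, E i} (hD : IsOpen D)
    (hh : ContDiffOn ℝ ∞ h D) (p q : ℕ) (i : ι) {x : ℝ × ℝ} (hx : x ∈ D) :
    partialXY p q h x i = partialXY p q (fun y => h y i) x := by
  have key : ∀ {k : ℝ × ℝ → ∀ i, E i}, ContDiffOn ℝ ∞ k D → ∀ v y, y ∈ D →
      fderiv ℝ k y v i = fderiv ℝ (fun z => k z i) y v := by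
    intro k hk v y hy
    have := (hasFDerivAt_pi'.1 (differentiableAt_of_smooth hD hk hy).hasFDerivAt i).fderiv
    rw [this]; rfl
  induction q generalizing h with
  | zero =>
    induction p generalizing x with
    | zero => rfl
    | succ p ih =>
      rw [partialXY_succ_left, partialXY_succ_left, partialX,
        key (contDiffOn_partialXY hD p 0 hh) _ _ hx]
      exact partialX_congr hD (fun y hy => ih hy) hx
  | succ q ih =>
    rw [partialXY_succ_right, partialXY_succ_right, ih (contDiffOn_partialY hD hh)]
    exact partialXY_congr hD p q (fun y hy => key hh _ y hy) hx

theorem fderiv_eq_partial (f : ℝ × ℝ → F) (x v : ℝ × ℝ) :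
    fderiv ℝ f x v = v.1 • partialX f x + v.2 • partialY f x := by
  rw [partialX, partialY, ← map_smul, ← map_smul, ← map_add]
  simp

end Calculus

/-! ## Jets of smooth maps -/

section Jets

variable {d k l : ℕ} {D : Set (ℝ × ℝ)} {f : ℝ × ℝ → Fin d → ℝ}

@[simp] theorem jet_apply (k : ℕ) (x : ℝ × ℝ) (f : ℝ × ℝ → Fin d → ℝ) (p : JetIndex k) :
    jet k x f p = partialXY p.1.1 p.1.2 f x := rfl

@[simp] theorem jetProj_jet (h : k ≤ l) (x : ℝ × ℝ) (f : ℝ × ℝ → Fin d → ℝ) :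
    jetProj d h (jet l x f) = jet k x f := rfl

theorem contDiffOn_jet (hD : IsOpen D) (k : ℕ) (hf : ContDiffOn ℝ ∞ f D) :
    ContDiffOn ℝ ∞ (fun x => jet k x f) D :=
  contDiffOn_pi.2 fun p => contDiffOn_partialXY hD p.1.1 p.1.2 hf

/-- This justifies the coordinate formula that defines `totalDeriv`. -/
theorem fderiv_jet (hD : IsOpen D) (h : k + 1 ≤ l) (hf : ContDiffOn ℝ ∞ f D) {x : ℝ × ℝ}
    (hx : x ∈ D) (v : ℝ × ℝ) :
    fderiv ℝ (fun y => jet k y f) x v = totalDeriv d h v (jet l x f) := by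
  funext p
  have h1 := (hasFDerivAt_pi'.1
    (differentiableAt_of_smooth hD (contDiffOn_jet hD k hf) hx).hasFDerivAt p).fderiv
  have h2 : fderiv ℝ (fun y => jet k y f) x v p = fderiv ℝ (fun y => jet k y f p) x v := by
    rw [h1]; rfl
  rw [h2]
  change fderiv ℝ (partialXY p.1.1 p.1.2 f) x v = _
  rw [fderiv_eq_partial, ← partialXY_succ_left, partialY_partialXY hD _ _ hf hx]
  rfl

theorem jet_congr (hD : IsOpen D) {g : ℝ × ℝ → Fin d → ℝ} (h : Set.EqOn f g D) {x : ℝ × ℝ}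
    (hx : x ∈ D) : jet k x f = jet k x g :=
  funext fun p => partialXY_congr hD p.1.1 p.1.2 h hx

theorem jet_comb (hD : IsOpen D) (a b : ℝ) {g : ℝ × ℝ → Fin d → ℝ}
    (hf : ContDiffOn ℝ ∞ f D) (hg : ContDiffOn ℝ ∞ g D) {x : ℝ × ℝ} (hx : x ∈ D) :
    jet k x (fun y => a • f y + b • g y) = a • jet k x f + b • jet k x g :=
  funext fun p => partialXY_comb hD p.1.1 p.1.2 a b hf hg hx

/-- The divided power `(t - a)^n / n!` as a function of `t`. -/
def dividedPower (a : ℝ) (n : ℕ) (t : ℝ) : ℝ := (t - a) ^ n / n.factorial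

theorem hasDerivAt_dividedPower_succ (a : ℝ) (n : ℕ) (t : ℝ) :
    HasDerivAt (dividedPower a (n + 1)) (dividedPower a n t) t := by
  have := (((hasDerivAt_id t).sub_const a).pow (n + 1)).div_const ((n + 1).factorial : ℝ)
  convert! this using 1
  simp only [dividedPower, Nat.factorial_succ, Nat.add_sub_cancel, id]
  push_cast
  field_simp

theorem contDiff_dividedPower (a : ℝ) (n : ℕ) : ContDiff ℝ ∞ (dividedPower a n) := by
  unfold dividedPower; fun_prop

/-- Products of divided powers form the basis dual to the partial derivatives at `x`, so Taylor
polynomials can be written without factorials. -/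
theorem partialXY_dividedPower (x : ℝ × ℝ) (p q a b : ℕ) :
    partialXY a b (fun y : ℝ × ℝ => dividedPower x.1 p y.1 * dividedPower x.2 q y.2) x =
      if a = p ∧ b = q then 1 else 0 := by
  have hX : ∀ (p : ℕ) (g : ℝ → ℝ), ContDiff ℝ ∞ g →
      partialX (fun y : ℝ × ℝ => dividedPower x.1 (p + 1) y.1 * g y.2) =
        fun y => dividedPower x.1 p y.1 * g y.2 := by
    intro p g hg
    funext y
    have h1 := (hasDerivAt_dividedPower_succ x.1 p y.1).hasFDerivAt.comp y
      (hasFDerivAt_fst (𝕜 := ℝ) (E := ℝ) (F := ℝ) (p := y))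
    have h2 := ((hg.differentiable (by simp)) y.2).hasFDerivAt.comp y
      (hasFDerivAt_snd (𝕜 := ℝ) (E := ℝ) (F := ℝ) (p := y))
    have h3 := (h1.mul h2).fderiv
    simp only [Function.comp_def] at h3
    rw [partialX, show (fun y : ℝ × ℝ => dividedPower x.1 (p + 1) y.1 * g y.2) =
      (fun y : ℝ × ℝ => dividedPower x.1 (p + 1) y.1) * (fun y : ℝ × ℝ => g y.2) from rfl, h3]
    simp [mul_comm]
  have hX0 : ∀ (g : ℝ → ℝ), ContDiff ℝ ∞ g →
      partialX (fun y : ℝ × ℝ => dividedPower x.1 0 y.1 * g y.2) = fun y => 0 := by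
    intro g hg
    funext y
    have h2 := (((hg.differentiable (by simp)) y.2).hasFDerivAt.comp y
      (hasFDerivAt_snd (𝕜 := ℝ) (E := ℝ) (F := ℝ) (p := y))).fderiv
    simp only [Function.comp_def] at h2
    simp [partialX, dividedPower, h2]
  have hY : ∀ (q : ℕ) (g : ℝ → ℝ), ContDiff ℝ ∞ g →
      partialY (fun y : ℝ × ℝ => g y.1 * dividedPower x.2 (q + 1) y.2) =
        fun y => g y.1 * dividedPower x.2 q y.2 := by
    intro p g hg
    funext y
    have h1 := (hasDerivAt_dividedPower_succ x.2 p y.2).hasFDerivAt.comp y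
      (hasFDerivAt_snd (𝕜 := ℝ) (E := ℝ) (F := ℝ) (p := y))
    have h2 := ((hg.differentiable (by simp)) y.1).hasFDerivAt.comp y
      (hasFDerivAt_fst (𝕜 := ℝ) (E := ℝ) (F := ℝ) (p := y))
    have h3 := (h2.mul h1).fderiv
    simp only [Function.comp_def] at h3
    rw [partialY, show (fun y : ℝ × ℝ => g y.1 * dividedPower x.2 (p + 1) y.2) =
      (fun y : ℝ × ℝ => g y.1) * (fun y : ℝ × ℝ => dividedPower x.2 (p + 1) y.2) from rfl, h3]
    simp [mul_comm]
  have hY0 : ∀ (g : ℝ → ℝ), ContDiff ℝ ∞ g →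
      partialY (fun y : ℝ × ℝ => g y.1 * dividedPower x.2 0 y.2) = fun y => 0 := by
    intro g hg
    funext y
    have h2 := (((hg.differentiable (by simp)) y.1).hasFDerivAt.comp y
      (hasFDerivAt_fst (𝕜 := ℝ) (E := ℝ) (F := ℝ) (p := y))).fderiv
    simp only [Function.comp_def] at h2
    simp [partialY, dividedPower, h2]
  induction b generalizing q with
  | zero =>
    induction a generalizing p with
    | zero =>
      change dividedPower x.1 p x.1 * dividedPower x.2 q x.2 = _
      rcases p with _ | p <;> rcases q with _ | q <;> simp [dividedPower]
    | succ a ih =>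
      change partialX^[a + 1] _ x = _
      rw [Function.iterate_succ_apply]
      rcases p with _ | p
      · have h := hX0 _ (contDiff_dividedPower x.2 q)
        refine (congrArg (fun g => partialXY a 0 g x) h).trans ?_
        simp [partialXY_const_zero]
      · have h := hX p _ (contDiff_dividedPower x.2 q)
        refine (congrArg (fun g => partialXY a 0 g x) h).trans ?_
        simp only [ih, add_left_inj]
  | succ b ih =>
    rw [partialXY_succ_right]
    rcases q with _ | q
    · rw [hY0 _ (contDiff_dividedPower x.1 p), partialXY_const_zero]; simp
    · rw [hY q _ (contDiff_dividedPower x.1 p), ih]; simp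

/-- The Taylor polynomial does it. Abstract jets can therefore always be replaced by functions
smooth on the whole plane. -/
theorem exists_jet_eq (x : ℝ × ℝ) (j : JetFibre d k) :
    ∃ f : ℝ × ℝ → Fin d → ℝ, ContDiff ℝ ∞ f ∧ jet k x f = j := by
  have hm : ∀ p : JetIndex k, ContDiff ℝ ∞
      (fun y : ℝ × ℝ => dividedPower x.1 p.1.1 y.1 * dividedPower x.2 p.1.2 y.2) := fun p =>
    ((contDiff_dividedPower _ _).comp contDiff_fst).mul
      ((contDiff_dividedPower _ _).comp contDiff_snd)
  have hf : ContDiff ℝ ∞ fun y : ℝ × ℝ => fun i => ∑ p : JetIndex k,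
      j p i • (dividedPower x.1 p.1.1 y.1 * dividedPower x.2 p.1.2 y.2) :=
    contDiff_pi.2 fun i => ContDiff.sum fun p _ => (hm p).const_smul (j p i)
  refine ⟨_, hf, ?_⟩
  funext p i
  have hx := Set.mem_univ x
  rw [jet_apply, partialXY_apply isOpen_univ hf.contDiffOn _ _ _ hx,
    partialXY_sum _ isOpen_univ _ _ (fun p _ => ((hm p).const_smul (j p i)).contDiffOn) hx]
  have : ∀ p' : JetIndex k, partialXY p.1.1 p.1.2 (fun y : ℝ × ℝ => j p' i •
      (dividedPower x.1 p'.1.1 y.1 * dividedPower x.2 p'.1.2 y.2)) x =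
      if p = p' then j p' i else 0 := by
    intro p'
    rw [partialXY_const_smul isOpen_univ _ _ _ (hm p').contDiffOn hx, partialXY_dividedPower]
    have : (p = p') ↔ (p.1.1 = p'.1.1 ∧ p.1.2 = p'.1.2) := by
      rw [Subtype.ext_iff, Prod.ext_iff]
    simp [this]
  rw [Finset.sum_congr rfl fun p' _ => this p']
  simp

end Jets

end WebGeometry

end

open scoped ContDiff

noncomputable section

namespace WebGeometry

/-! ## Functions vanishing to a given order at a point -/

/-- All derivatives of `f` of order `< m` vanish at `x`. -/
def VanishesTo {F : Type*} [NormedAddCommGroup F] [NormedSpace ℝ F] (m : ℕ) (f : ℝ × ℝ → F)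
    (x : ℝ × ℝ) : Prop :=
  ∀ p q, p + q < m → partialXY p q f x = 0

section Vanishing

variable {D : Set (ℝ × ℝ)} {f g : ℝ × ℝ → ℝ} {x : ℝ × ℝ} {m : ℕ}

theorem VanishesTo.mono {n : ℕ} (h : VanishesTo m f x) (hn : n ≤ m) : VanishesTo n f x :=
  fun p q hpq => h p q (hpq.trans_le hn)

theorem VanishesTo.partialX (hD : IsOpen D) (hx : x ∈ D) (hf : ContDiffOn ℝ ∞ f D)
    (h : VanishesTo (m + 1) f x) : VanishesTo m (partialX f) x := fun p q hpq => by
  rw [← partialXY_succ_left' hD p q hf hx]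
  exact h _ _ (by omega)

theorem VanishesTo.partialY (h : VanishesTo (m + 1) f x) : VanishesTo m (partialY f) x :=
  fun p q hpq => by
    rw [← partialXY_succ_right]
    exact h _ _ (by omega)

theorem partialX_mul (hD : IsOpen D) (hf : ContDiffOn ℝ ∞ f D) (hg : ContDiffOn ℝ ∞ g D) :
    Set.EqOn (partialX fun y => g y * f y) (fun y => partialX g y * f y + g y * partialX f y) D := by
  intro y hy
  have := ((differentiableAt_of_smooth hD hg hy).hasFDerivAt.mul
    (differentiableAt_of_smooth hD hf hy).hasFDerivAt).fderiv
  change fderiv ℝ (g * f) y _ = _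
  rw [this]
  simp [WebGeometry.partialX]
  ring

theorem partialY_mul (hD : IsOpen D) (hf : ContDiffOn ℝ ∞ f D) (hg : ContDiffOn ℝ ∞ g D) :
    Set.EqOn (partialY fun y => g y * f y) (fun y => partialY g y * f y + g y * partialY f y) D := by
  intro y hy
  have := ((differentiableAt_of_smooth hD hg hy).hasFDerivAt.mul
    (differentiableAt_of_smooth hD hf hy).hasFDerivAt).fderiv
  change fderiv ℝ (g * f) y _ = _
  rw [this]
  simp [WebGeometry.partialY]
  ring

/-- The leading derivatives of a product with a function vanishing to order `m`. -/
theorem VanishesTo.partialXY_mul (hD : IsOpen D) (hx : x ∈ D) {f g : ℝ × ℝ → ℝ}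
    (hf : ContDiffOn ℝ ∞ f D) (hg : ContDiffOn ℝ ∞ g D) (h : VanishesTo m f x) {p q : ℕ}
    (hpq : p + q ≤ m) :
    partialXY p q (fun y => g y * f y) x = g x * partialXY p q f x := by
  induction m generalizing f g p q with
  | zero =>
    obtain ⟨rfl, rfl⟩ : p = 0 ∧ q = 0 := by omega
    rfl
  | succ m ih =>
    have hm : VanishesTo m f x := h.mono (by omega)
    rcases p with _ | p
    · rcases q with _ | q
      · rfl
      · rw [partialXY_succ_right, partialXY_congr hD _ _ (partialY_mul hD hf hg) hx,
          partialXY_add hD _ _ ((contDiffOn_partialY hD hg).mul hf)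
            (hg.mul (contDiffOn_partialY hD hf)) hx,
          ih hf (contDiffOn_partialY hD hg) hm (by omega),
          ih (contDiffOn_partialY hD hf) hg h.partialY (by omega), h 0 q (by omega),
          partialXY_succ_right]
        ring
    · rw [partialXY_succ_left' hD _ _ (hg.mul hf) hx,
        partialXY_congr hD _ _ (partialX_mul hD hf hg) hx,
        partialXY_add hD _ _ ((contDiffOn_partialX hD hg).mul hf)
          (hg.mul (contDiffOn_partialX hD hf)) hx,
        ih hf (contDiffOn_partialX hD hg) hm (by omega),
        ih (contDiffOn_partialX hD hf) hg (h.partialX hD hx hf) (by omega), h p q (by omega),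
        partialXY_succ_left' hD _ _ hf hx]
      ring

theorem VanishesTo.mul (hD : IsOpen D) (hx : x ∈ D) (hf : ContDiffOn ℝ ∞ f D)
    (hg : ContDiffOn ℝ ∞ g D) (h : VanishesTo m f x) : VanishesTo m (fun y => g y * f y) x :=
  fun p q hpq => by rw [h.partialXY_mul hD hx hf hg hpq.le, h p q hpq, mul_zero]

theorem VanishesTo.add (hD : IsOpen D) (hx : x ∈ D) (hf : ContDiffOn ℝ ∞ f D)
    (hg : ContDiffOn ℝ ∞ g D) (h : VanishesTo m f x) (h' : VanishesTo m g x) :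
    VanishesTo m (fun y => f y + g y) x :=
  fun p q hpq => by rw [partialXY_add hD p q hf hg hx, h p q hpq, h' p q hpq, add_zero]

theorem VanishesTo.congr (hD : IsOpen D) (hx : x ∈ D) (hfg : Set.EqOn f g D)
    (h : VanishesTo m g x) : VanishesTo m f x :=
  fun p q hpq => by rw [partialXY_congr hD p q hfg hx, h p q hpq]

end Vanishing

/-! ## Linear differential operators -/

/-- `L` is a linear differential operator of order `≤ m` over `D` with smooth coefficients. -/
def IsDiffOp {d : ℕ} {Z : Type*} [NormedAddCommGroup Z] [NormedSpace ℝ Z] (D : Set (ℝ × ℝ))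
    (m : ℕ) (L : (ℝ × ℝ → Fin d → ℝ) → ℝ × ℝ → Z) : Prop :=
  ∃ Φ : ℝ × ℝ → JetFibre d m →L[ℝ] Z, ContDiffOn ℝ ∞ Φ D ∧
    ∀ U, IsOpen U → U ⊆ D → ∀ f, ContDiffOn ℝ ∞ f U → ∀ x ∈ U, L f x = Φ x (jet m x f)

section DiffOp

variable {d m n : ℕ} {Z : Type*} [NormedAddCommGroup Z] [NormedSpace ℝ Z] {D : Set (ℝ × ℝ)}
  {L M : (ℝ × ℝ → Fin d → ℝ) → ℝ × ℝ → Z}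

theorem IsDiffOp.congr (hL : IsDiffOp D m L)
    (h : ∀ U, IsOpen U → U ⊆ D → ∀ f, ContDiffOn ℝ ∞ f U → ∀ x ∈ U, M f x = L f x) :
    IsDiffOp D m M := by
  obtain ⟨Φ, hΦ, H⟩ := hL
  exact ⟨Φ, hΦ, fun U hU hUD f hf x hx => (h U hU hUD f hf x hx).trans (H U hU hUD f hf x hx)⟩

theorem IsDiffOp.contDiffOn (hL : IsDiffOp D m L) {U : Set (ℝ × ℝ)} (hU : IsOpen U) (hUD : U ⊆ D)
    {f : ℝ × ℝ → Fin d → ℝ} (hf : ContDiffOn ℝ ∞ f U) : ContDiffOn ℝ ∞ (L f) U := by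
  obtain ⟨Φ, hΦ, H⟩ := hL
  exact ((hΦ.mono hUD).clm_apply (contDiffOn_jet hU m hf)).congr fun x hx => H U hU hUD f hf x hx

theorem IsDiffOp.mono_order (hL : IsDiffOp D m L) (h : m ≤ n) : IsDiffOp D n L := by
  obtain ⟨Φ, hΦ, H⟩ := hL
  refine ⟨fun x => (Φ x).comp (jetProj d h).toContinuousLinearMap,
    hΦ.clm_comp contDiffOn_const, fun U hU hUD f hf x hx => ?_⟩
  rw [H U hU hUD f hf x hx]
  rfl

theorem isDiffOp_zero : IsDiffOp D m (fun (_ : ℝ × ℝ → Fin d → ℝ) _ => (0 : Z)) :=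
  ⟨fun _ => 0, contDiffOn_const, fun _ _ _ _ _ _ _ => rfl⟩

theorem IsDiffOp.add (hL : IsDiffOp D m L) (hM : IsDiffOp D m M) :
    IsDiffOp D m (fun f x => L f x + M f x) := by
  obtain ⟨Φ, hΦ, H⟩ := hL
  obtain ⟨Ψ, hΨ, K⟩ := hM
  refine ⟨fun x => Φ x + Ψ x, hΦ.add hΨ, fun U hU hUD f hf x hx => ?_⟩
  beta_reduce
  rw [H U hU hUD f hf x hx, K U hU hUD f hf x hx]
  rfl

theorem IsDiffOp.smul (hL : IsDiffOp D m L) {g : ℝ × ℝ → ℝ} (hg : ContDiffOn ℝ ∞ g D) :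
    IsDiffOp D m (fun f x => g x • L f x) := by
  obtain ⟨Φ, hΦ, H⟩ := hL
  refine ⟨fun x => g x • Φ x, hg.smul hΦ, fun U hU hUD f hf x hx => ?_⟩
  beta_reduce
  rw [H U hU hUD f hf x hx]
  rfl

theorem IsDiffOp.sum {ι : Type*} (s : Finset ι) {L : ι → (ℝ × ℝ → Fin d → ℝ) → ℝ × ℝ → Z}
    (hL : ∀ i ∈ s, IsDiffOp D m (L i)) : IsDiffOp D m (fun f x => ∑ i ∈ s, L i f x) := by
  classical
  induction s using Finset.induction_on with
  | empty => simpa using isDiffOp_zero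
  | insert a s ha ih =>
    simp only [Finset.sum_insert ha]
    exact (hL a (by simp)).add (ih fun i hi => hL i (by simp [hi]))

theorem isDiffOp_coord (i : Fin d) : IsDiffOp D 0 (fun (f : ℝ × ℝ → Fin d → ℝ) x => f x i) :=
  ⟨fun _ => (ContinuousLinearMap.proj i).comp (ContinuousLinearMap.proj (R := ℝ)
    (φ := fun _ : JetIndex 0 => Fin d → ℝ) ⟨(0, 0), le_rfl⟩), contDiffOn_const,
    fun _ _ _ _ _ _ _ => rfl⟩

theorem totalDeriv_eq {k l : ℕ} (h : k + 1 ≤ l) (v : ℝ × ℝ) (j : JetFibre d l) :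
    totalDeriv d h v j = v.1 • totalDeriv d h (1, 0) j + v.2 • totalDeriv d h (0, 1) j := by
  funext p
  simp [totalDeriv]

/-- Leibniz rule for `Φ x (jet m x f)`: the differentiated coefficients act on the old jet, the old
coefficients on its total derivative. -/
theorem IsDiffOp.fderiv_apply (hD : IsOpen D) (hL : IsDiffOp D m L) {v : ℝ × ℝ → ℝ × ℝ}
    (hv : ContDiffOn ℝ ∞ v D) : IsDiffOp D (m + 1) (fun f x => fderiv ℝ (L f) x (v x)) := by
  obtain ⟨Φ, hΦ, H⟩ := hL
  let T : ℝ × ℝ → JetFibre d (m + 1) →L[ℝ] JetFibre d m := fun x =>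
    (v x).1 • (totalDeriv d le_rfl (1, 0)).toContinuousLinearMap +
      (v x).2 • (totalDeriv d le_rfl (0, 1)).toContinuousLinearMap
  have hT : ContDiffOn ℝ ∞ T D := (hv.fst.smul contDiffOn_const).add (hv.snd.smul contDiffOn_const)
  refine ⟨fun x => (fderiv ℝ Φ x (v x)).comp (jetProj d m.le_succ).toContinuousLinearMap +
    (Φ x).comp (T x),
    (((hΦ.fderiv_of_isOpen hD (by simp)).clm_apply hv).clm_comp contDiffOn_const).add
      (hΦ.clm_comp hT), fun U hU hUD f hf x hx => ?_⟩
  have h1 := (differentiableAt_of_smooth hD hΦ (hUD hx)).hasFDerivAt.clm_apply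
    (differentiableAt_of_smooth hU (contDiffOn_jet hU m hf) hx).hasFDerivAt
  have h2 := fderiv_jet hU (le_refl (m + 1)) hf hx (v x)
  have h3 : totalDeriv d (le_refl (m + 1)) (v x) (jet (m + 1) x f) = T x (jet (m + 1) x f) := by
    rw [totalDeriv_eq]
    rfl
  have h4 := congrArg (fun A : ℝ × ℝ →L[ℝ] Z => A (v x))
    ((fderiv_congr_on hU (fun y hy => H U hU hUD f hf y hy) hx).trans h1.fderiv)
  refine h4.trans ?_
  simp only [add_apply, ContinuousLinearMap.comp_apply,
    ContinuousLinearMap.flip_apply]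
  rw [h2, h3, add_comm]
  rfl

theorem IsDiffOp.partialXY (hD : IsOpen D) (hL : IsDiffOp D m L) (p q : ℕ) :
    IsDiffOp D (m + (p + q)) (fun f => partialXY p q (L f)) := by
  induction p with
  | zero =>
    induction q with
    | zero => exact hL
    | succ q ih =>
      simp only [partialXY_zero_succ]
      exact ih.fderiv_apply hD contDiffOn_const
  | succ p ih =>
    simp only [partialXY_succ_left]
    exact (ih.fderiv_apply hD (v := fun _ => (1, 0)) contDiffOn_const).mono_order (by omega)

/-- The quantification over all open subsets in `IsDiffOp` is what allows a comparison of functions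
smooth on different neighbourhoods. -/
theorem IsDiffOp.eq_of_jet_eq (hL : IsDiffOp D m L) {U V : Set (ℝ × ℝ)} (hU : IsOpen U)
    (hUD : U ⊆ D) (hV : IsOpen V) (hVD : V ⊆ D) {f g : ℝ × ℝ → Fin d → ℝ}
    (hf : ContDiffOn ℝ ∞ f U) (hg : ContDiffOn ℝ ∞ g V) {x : ℝ × ℝ} (hxU : x ∈ U) (hxV : x ∈ V)
    (h : jet m x f = jet m x g) : L f x = L g x := by
  obtain ⟨Φ, -, H⟩ := hL
  rw [H U hU hUD f hf x hxU, H V hV hVD g hg x hxV, h]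

end DiffOp

end WebGeometry

end

open scoped ContDiff

noncomputable section

namespace WebGeometry

namespace PlanarWeb

variable {d : ℕ} {D : Set (ℝ × ℝ)} (W : PlanarWeb d D)

/-! ## The linear equations defining the prolongations -/

/-- The coefficient of `dx` in `ω_i`. -/
def formX (i : Fin d) (x : ℝ × ℝ) : ℝ := W.form i x (1, 0)

/-- The coefficient of `dy` in `ω_i`. -/
def formY (i : Fin d) (x : ℝ × ℝ) : ℝ := W.form i x (0, 1)

theorem contDiffOn_formX (i : Fin d) : ContDiffOn ℝ ∞ (W.formX i) D :=
  (W.smooth i).clm_apply contDiffOn_const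

theorem contDiffOn_formY (i : Fin d) : ContDiffOn ℝ ∞ (W.formY i) D :=
  (W.smooth i).clm_apply contDiffOn_const

theorem form_apply (i : Fin d) (x v : ℝ × ℝ) :
    W.form i x v = v.1 * W.formX i x + v.2 * W.formY i x := by
  rw [formX, formY, ← smul_eq_mul, ← smul_eq_mul, ← map_smul, ← map_smul, ← map_add]
  simp

theorem form_eq_zero_iff {α : ℝ × ℝ →L[ℝ] ℝ} : α = 0 ↔ α (1, 0) = 0 ∧ α (0, 1) = 0 := by
  refine ⟨fun h => by simp [h], fun h => ContinuousLinearMap.ext fun v => ?_⟩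
  have : v = v.1 • ((1, 0) : ℝ × ℝ) + v.2 • ((0, 1) : ℝ × ℝ) := by simp
  rw [this, map_add, map_smul, map_smul, h.1, h.2]
  simp

theorem det_ne_zero {i j : Fin d} (hij : i ≠ j) {x : ℝ × ℝ} (hx : x ∈ D) :
    W.formX i x * W.formY j x - W.formY i x * W.formX j x ≠ 0 := by
  intro h
  have hl := LinearIndependent.pair_iff.1 (W.transversal i j hij x hx)
  have key : ∀ s t : ℝ, s * W.formX i x + t * W.formX j x = 0 →
      s * W.formY i x + t * W.formY j x = 0 → s = 0 ∧ t = 0 := fun s t h1 h2 =>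
    hl s t (form_eq_zero_iff.2 ⟨by simpa [formX] using h1, by simpa [formY] using h2⟩)
  have h1 := key (W.formX j x) (-W.formX i x) (by ring) (by linarith)
  have h2 := key (W.formY j x) (-W.formY i x) (by linarith) (by ring)
  have h3 := key 1 0 (by linarith [h1.2]) (by linarith [h2.2])
  exact one_ne_zero h3.1

/-- The value on `v` of `∑ λ_i ω_i`. -/
def linRel (v : ℝ × ℝ) (lam : ℝ × ℝ → Fin d → ℝ) (x : ℝ × ℝ) : ℝ :=
  ∑ i, lam x i * W.form i x v

theorem sum_form_eq_zero_iff (lam : ℝ × ℝ → Fin d → ℝ) (x : ℝ × ℝ) :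
    ∑ i, lam x i • W.form i x = 0 ↔
      W.linRel (1, 0) lam x = 0 ∧ W.linRel (0, 1) lam x = 0 := by
  rw [form_eq_zero_iff]
  simp [linRel]

theorem extD_smul {U : Set (ℝ × ℝ)} (hU : IsOpen U) {g : ℝ × ℝ → ℝ} (hg : ContDiffOn ℝ ∞ g U)
    {α : ℝ × ℝ → (ℝ × ℝ →L[ℝ] ℝ)} (hα : ContDiffOn ℝ ∞ α U) {x : ℝ × ℝ} (hx : x ∈ U)
    (v w : ℝ × ℝ) :
    extD (fun y => g y • α y) x v w =
      fderiv ℝ g x v * α x w - fderiv ℝ g x w * α x v + g x * extD α x v w := by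
  have h := ((differentiableAt_of_smooth hU hg hx).hasFDerivAt.smul
    (differentiableAt_of_smooth hU hα hx).hasFDerivAt).fderiv
  have h' : fderiv ℝ (fun y => g y • α y) x = _ := h
  simp only [extD, h']
  simp
  ring

theorem dForm_eq {U : Set (ℝ × ℝ)} (hU : IsOpen U) (hUD : U ⊆ D) {f : ℝ × ℝ → Fin d → ℝ}
    (hf : ContDiffOn ℝ ∞ f U) (i : Fin d) {x : ℝ × ℝ} (hx : x ∈ U) :
    W.dForm i f x = W.formY i x * partialX (fun y => f y i) x -
      W.formX i x * partialY (fun y => f y i) x + extD (W.form i) x (1, 0) (0, 1) * f x i := by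
  rw [dForm, extD_smul hU (contDiffOn_pi.1 hf i) ((W.smooth i).mono hUD) hx]
  simp only [partialX, partialY, formX, formY]
  ring

theorem contDiffOn_extD (hD : IsOpen D) {α : ℝ × ℝ → (ℝ × ℝ →L[ℝ] ℝ)} (hα : ContDiffOn ℝ ∞ α D)
    {v w : ℝ × ℝ → ℝ × ℝ} (hv : ContDiffOn ℝ ∞ v D) (hw : ContDiffOn ℝ ∞ w D) :
    ContDiffOn ℝ ∞ (fun x => extD α x (v x) (w x)) D := by
  have h := hα.fderiv_of_isOpen hD (m := ∞) (by simp)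
  exact ((h.clm_apply hv).clm_apply hw).sub ((h.clm_apply hw).clm_apply hv)

theorem isDiffOp_linRel (v : ℝ × ℝ) : IsDiffOp D 0 (W.linRel v) := by
  refine (IsDiffOp.sum Finset.univ fun i _ => (isDiffOp_coord i).smul
    (g := fun x => W.form i x v) ((W.smooth i).clm_apply contDiffOn_const)).congr ?_
  intro U _ _ f _ x _
  simp only [linRel, smul_eq_mul, mul_comm]

theorem isDiffOp_dForm (i : Fin d) : IsDiffOp D 1 (W.dForm i) := by
  have hD := W.isOpen
  have h1 := ((isDiffOp_coord (D := D) i).fderiv_apply hD (v := fun _ => (1, 0))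
    contDiffOn_const).smul (W.contDiffOn_formY i)
  have h2 := ((isDiffOp_coord (D := D) i).fderiv_apply hD (v := fun _ => (0, 1))
    contDiffOn_const).smul (W.contDiffOn_formX i).neg
  have h3 := ((isDiffOp_coord (D := D) i).mono_order zero_le_one).smul
    (contDiffOn_extD hD (W.smooth i) (v := fun _ => (1, 0)) (w := fun _ => (0, 1))
      contDiffOn_const contDiffOn_const)
  refine ((h1.add h2).add h3).congr fun U hU hUD f hf x hx => ?_
  rw [W.dForm_eq hU hUD hf i hx]
  simp only [smul_eq_mul, partialX, partialY]
  ring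

/-- The equations defining the prolongations: the components of `∑ λ_i ω_i`
and the functions `d(λ_i ω_i)`. -/
def eqn : Fin 2 ⊕ Fin d → (ℝ × ℝ → Fin d → ℝ) → ℝ × ℝ → ℝ
  | .inl r => W.linRel (![(1, 0), (0, 1)] r)
  | .inr i => W.dForm i

/-- The order of the equation `eqn`. -/
def eqnOrder : Fin 2 ⊕ Fin d → ℕ
  | .inl _ => 0
  | .inr _ => 1

theorem isDiffOp_eqn (r : Fin 2 ⊕ Fin d) : IsDiffOp D (eqnOrder r) (W.eqn r) := by
  rcases r with r | i
  · exact W.isDiffOp_linRel _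
  · exact W.isDiffOp_dForm i

theorem isDiffOp_partialXY_eqn (r : Fin 2 ⊕ Fin d) {p q k : ℕ} (h : p + q + eqnOrder r ≤ k) :
    IsDiffOp D k (fun f => partialXY p q (W.eqn r f)) :=
  ((W.isDiffOp_eqn r).partialXY W.isOpen p q).mono_order (by omega)

/-- Correcting the first two components, a map may be changed into a section of `π` without
changing its `k`-jet, if the equations defining `π` are satisfied to order `k`. -/
theorem exists_isSection_jet_eq {k : ℕ} {g : ℝ × ℝ → Fin d → ℝ} (hg : ContDiffOn ℝ ∞ g D)
    {x : ℝ × ℝ} (hx : x ∈ D) (h1 : VanishesTo (k + 1) (W.linRel (1, 0) g) x)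
    (h2 : VanishesTo (k + 1) (W.linRel (0, 1) g) x) :
    ∃ lam, W.IsSection lam ∧ jet k x lam = jet k x g := by
  have hD := W.isOpen
  let a : Fin d := ⟨0, by have := W.three_le; omega⟩
  let b : Fin d := ⟨1, by have := W.three_le; omega⟩
  have hab : a ≠ b := by simp [a, b]
  let δ : ℝ × ℝ → ℝ := fun y => (W.formX a y * W.formY b y - W.formY a y * W.formX b y)⁻¹
  have hδ : ContDiffOn ℝ ∞ δ D :=
    (((W.contDiffOn_formX a).mul (W.contDiffOn_formY b)).sub
      ((W.contDiffOn_formY a).mul (W.contDiffOn_formX b))).inv fun y hy => W.det_ne_zero hab hy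
  have hA := (W.isDiffOp_linRel (1, 0)).contDiffOn hD subset_rfl hg
  have hB := (W.isDiffOp_linRel (0, 1)).contDiffOn hD subset_rfl hg
  -- Cramer's rule: `c` and `e` are the coefficients of the correction in the components `a`, `b`
  -- that cancels both values of `linRel`. Those values vanish to order `k + 1`, hence so does the
  -- correction.
  let c : Fin d → ℝ × ℝ → ℝ := fun i y =>
    if i = a then -(δ y * W.formY b y) else if i = b then δ y * W.formY a y else 0
  let e : Fin d → ℝ × ℝ → ℝ := fun i y =>
    if i = a then δ y * W.formX b y else if i = b then -(δ y * W.formX a y) else 0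
  have hc : ∀ i, ContDiffOn ℝ ∞ (c i) D := by
    intro i
    by_cases hi : i = a
    · simpa only [c, hi, if_true] using (hδ.mul (W.contDiffOn_formY b)).neg
    · by_cases hi' : i = b
      · simpa only [c, hi', hab.symm, if_true, if_false] using hδ.mul (W.contDiffOn_formY a)
      · simpa only [c, hi, hi', if_false] using contDiffOn_const
  have he : ∀ i, ContDiffOn ℝ ∞ (e i) D := by
    intro i
    by_cases hi : i = a
    · simpa only [e, hi, if_true] using hδ.mul (W.contDiffOn_formX b)
    · by_cases hi' : i = b
      · simpa only [e, hi', hab.symm, if_true, if_false] using (hδ.mul (W.contDiffOn_formX a)).neg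
      · simpa only [e, hi, hi', if_false] using contDiffOn_const
  let lam : ℝ × ℝ → Fin d → ℝ := fun y i =>
    g y i + (c i y * W.linRel (1, 0) g y + e i y * W.linRel (0, 1) g y)
  have hlam : ContDiffOn ℝ ∞ lam D := contDiffOn_pi.2 fun i =>
    (contDiffOn_pi.1 hg i).add (((hc i).mul hA).add ((he i).mul hB))
  refine ⟨lam, ⟨hlam, fun y hy => ?_⟩, ?_⟩
  · have hne := W.det_ne_zero hab hy
    have key : ∀ α : Fin d → ℝ, ∑ i, lam y i * α i = ∑ i, g y i * α i +
        (c a y * W.linRel (1, 0) g y + e a y * W.linRel (0, 1) g y) * α a +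
        (c b y * W.linRel (1, 0) g y + e b y * W.linRel (0, 1) g y) * α b := by
      intro α
      have : ∀ i, lam y i * α i = g y i * α i +
          (if i = a then (c a y * W.linRel (1, 0) g y + e a y * W.linRel (0, 1) g y) * α a else 0) +
          (if i = b then (c b y * W.linRel (1, 0) g y + e b y * W.linRel (0, 1) g y) * α b else 0) := by
        intro i
        by_cases hi : i = a
        · subst hi; simp [lam, hab]; ring
        · by_cases hi' : i = b
          · subst hi'; simp [lam, hab.symm]; ring
          · simp [lam, c, e, hi, hi']
      rw [Finset.sum_congr rfl fun i _ => this i]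
      simp [Finset.sum_add_distrib]
    have hδ' : δ y * (W.formX a y * W.formY b y - W.formY a y * W.formX b y) = 1 :=
      inv_mul_cancel₀ hne
    rw [sum_form_eq_zero_iff]
    constructor
    · have := key fun i => W.formX i y
      change ∑ i, lam y i * W.formX i y = 0
      rw [this]
      change W.linRel (1, 0) g y + _ + _ = 0
      simp only [c, e, if_true, hab.symm, if_false]
      linear_combination (-W.linRel (1, 0) g y) * hδ'
    · have := key fun i => W.formY i y
      change ∑ i, lam y i * W.formY i y = 0
      rw [this]
      change W.linRel (0, 1) g y + _ + _ = 0
      simp only [c, e, if_true, hab.symm, if_false]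
      linear_combination (-W.linRel (0, 1) g y) * hδ'
  · funext p i
    rw [jet_apply, jet_apply, partialXY_apply hD hlam _ _ _ hx, partialXY_apply hD hg _ _ _ hx]
    rw [partialXY_add hD _ _ (contDiffOn_pi.1 hg i) (((hc i).mul hA).add ((he i).mul hB)) hx,
      (VanishesTo.add hD hx ((hc i).mul hA) ((he i).mul hB) (h1.mul hD hx hA (hc i))
        (h2.mul hD hx hB (he i))) p.1.1 p.1.2 (by have := p.2; omega), add_zero]

/-- The definition asks for some section over `D` with the given jet. The equations see only the
jet, and `exists_isSection_jet_eq` turns a polynomial representative into a section, so any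
representative on any neighbourhood can be tested. -/
theorem jet_mem_prolongation_iff {k : ℕ} {U : Set (ℝ × ℝ)} (hU : IsOpen U) (hUD : U ⊆ D)
    {f : ℝ × ℝ → Fin d → ℝ} (hf : ContDiffOn ℝ ∞ f U) (x : D) (hx : (x : ℝ × ℝ) ∈ U) :
    jet k x f ∈ W.prolongation k x ↔
      ∀ r p q, p + q + eqnOrder r ≤ k → partialXY p q (W.eqn r f) x = 0 := by
  have hD := W.isOpen
  have transfer : ∀ {g : ℝ × ℝ → Fin d → ℝ} {V : Set (ℝ × ℝ)}, IsOpen V → V ⊆ D →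
      (x : ℝ × ℝ) ∈ V → ContDiffOn ℝ ∞ g V →
      jet k x g = jet k x f → ∀ {r p q}, p + q + eqnOrder r ≤ k →
      partialXY p q (W.eqn r g) x = partialXY p q (W.eqn r f) x := by
    intro g V hV hVD hxV hg hgf r p q h
    exact (W.isDiffOp_partialXY_eqn r h).eq_of_jet_eq hV hVD hU hUD hg hf hxV hx hgf
  constructor
  · rintro ⟨lam, hlam, hlam', hj⟩ r p q h
    rw [← transfer hD subset_rfl x.2 hlam.1 hj h]
    rcases r with r | i
    · refine partialXY_eq_zero hD p q (fun y hy => ?_) x.2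
      have := (W.sum_form_eq_zero_iff lam y).1 (hlam.2 y hy)
      fin_cases r
      exacts [this.1, this.2]
    · exact hlam' i p q (by simpa [eqnOrder] using h)
  · intro h
    obtain ⟨g, hg, hgj⟩ := exists_jet_eq (x : ℝ × ℝ) (jet k x f)
    have hv : ∀ r : Fin 2, VanishesTo (k + 1) (W.eqn (.inl r) g) x := fun r p q hpq => by
      have ho : p + q + eqnOrder (d := d) (.inl r) ≤ k := by simp only [eqnOrder]; omega
      rw [transfer hD subset_rfl x.2 hg.contDiffOn hgj ho]
      exact h _ _ _ ho
    obtain ⟨lam, hlam, hj⟩ := W.exists_isSection_jet_eq hg.contDiffOn x.2 (hv 0) (hv 1)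
    refine ⟨lam, hlam, fun i p q hpq => ?_, hj.trans hgj⟩
    have ho : p + q + eqnOrder (.inr i) ≤ k := by simp only [eqnOrder]; omega
    exact (transfer hD subset_rfl x.2 hlam.1 (hj.trans hgj) ho).trans (h _ _ _ ho)

theorem mem_prolongation_iff_of_jet {k : ℕ} {g : ℝ × ℝ → Fin d → ℝ} (hg : ContDiff ℝ ∞ g) (x : D) :
    jet k x g ∈ W.prolongation k x ↔
      ∀ r p q, p + q + eqnOrder r ≤ k → partialXY p q (W.eqn r g) x = 0 :=
  W.jet_mem_prolongation_iff W.isOpen subset_rfl hg.contDiffOn x x.2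

theorem jetProj_mem_prolongation {k l : ℕ} (h : k ≤ l) {x : D} {j : JetFibre d l}
    (hj : j ∈ W.prolongation l x) : jetProj d h j ∈ W.prolongation k x := by
  obtain ⟨lam, h1, h2, rfl⟩ := hj
  exact ⟨lam, h1, fun i p q hpq => h2 i p q (by omega), rfl⟩

/-- The fibres of the prolongations are the kernels of a smooth family of linear maps. -/
theorem exists_prolongation_eq_ker (k : ℕ) :
    ∃ C : ℝ × ℝ → JetFibre d k →L[ℝ] (Fin 2 ⊕ Fin d) × JetIndex k → ℝ,
      ContDiffOn ℝ ∞ C D ∧ ∀ (x : D) (j : JetFibre d k), j ∈ W.prolongation k x ↔ C x j = 0 := by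
  have hD := W.isOpen
  -- One index set serves all equations; components whose total order exceeds `k` are replaced by
  -- zero.
  have H : ∀ s : (Fin 2 ⊕ Fin d) × JetIndex k, ∃ Φ : ℝ × ℝ → JetFibre d k →L[ℝ] ℝ,
      ContDiffOn ℝ ∞ Φ D ∧ ∀ f, ContDiffOn ℝ ∞ f D → ∀ x ∈ D,
        (if s.2.1.1 + s.2.1.2 + eqnOrder s.1 ≤ k then partialXY s.2.1.1 s.2.1.2 (W.eqn s.1 f) x else 0)
          = Φ x (jet k x f) := by
    intro s
    split_ifs with h
    · obtain ⟨Φ, hΦ, K⟩ := W.isDiffOp_partialXY_eqn s.1 h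
      exact ⟨Φ, hΦ, fun f hf x hx => K D hD subset_rfl f hf x hx⟩
    · exact ⟨0, contDiffOn_const, fun _ _ _ _ => rfl⟩
  choose Φ hΦ K using H
  refine ⟨fun x => ContinuousLinearMap.pi fun s => Φ s x, ?_, fun x j => ?_⟩
  · have : (fun x => ContinuousLinearMap.pi fun s => Φ s x) = fun x =>
        ∑ s, (ContinuousLinearMap.single ℝ (fun _ => ℝ) s).comp (Φ s x) := by
      funext x
      ext j s
      simp [Finset.sum_apply, Pi.single_apply]
    rw [this]
    exact ContDiffOn.sum fun s _ => contDiffOn_const.clm_comp (hΦ s)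
  · obtain ⟨g, hg, rfl⟩ := exists_jet_eq (x : ℝ × ℝ) j
    rw [W.mem_prolongation_iff_of_jet hg, funext_iff]
    constructor
    · intro h s
      change Φ s x _ = 0
      rw [← K s g hg.contDiffOn x x.2]
      split_ifs with hs
      · exact h _ _ _ hs
      · rfl
    · intro h r p q hr
      have := h (r, ⟨(p, q), by simp only; omega⟩)
      change Φ _ x _ = 0 at this
      rw [← K _ g hg.contDiffOn x x.2] at this
      simpa [hr] using this

/-- The Spencer operator maps sections of a prolongation to sections of the previous one. -/
theorem fderiv_sub_totalDeriv_mem {k l : ℕ} (h : k + 1 ≤ l) {s : ℝ × ℝ → JetFibre d k}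
    (hs : IsSmoothSection D (W.prolongation k) s) (v : ℝ × ℝ) (x : D) {j : JetFibre d l}
    (hj : j ∈ W.prolongation l x) (hjs : jetProj d (k.le_succ.trans h) j = s x) :
    fderiv ℝ s x v - totalDeriv d h v j ∈ W.prolongation k x := by
  have hD := W.isOpen
  obtain ⟨g, hg, hgj⟩ := exists_jet_eq (x : ℝ × ℝ) (fderiv ℝ s x v - totalDeriv d h v j)
  rw [← hgj, W.mem_prolongation_iff_of_jet hg]
  intro r p q hr
  obtain ⟨Φ, hΦ, K⟩ := W.isDiffOp_partialXY_eqn r hr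
  have hj' := hj
  obtain ⟨f, hf, -, rfl⟩ := hj
  -- `Φ (s y) = 0` holds on all of `D`, so it may be differentiated. For `f` the derivative of `Φ
  -- (jet f)` vanishes at `x`, because the jet of `f` lies in a prolongation one order higher
  -- (`e4`). The two derivatives share the term with the derivative of `Φ`, as `s x` is the `k`-jet
  -- of `f`; subtracting leaves the claim.
  have e1 : ∀ y ∈ D, Φ y (s y) = 0 := by
    intro y hy
    obtain ⟨u, hu, huj⟩ := exists_jet_eq y (s y)
    have := hs.2 ⟨y, hy⟩
    rw [← huj, ← K D hD subset_rfl u hu.contDiffOn y hy]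
    exact (W.mem_prolongation_iff_of_jet hu ⟨y, hy⟩).1 (huj ▸ this) r p q hr
  have hd := (differentiableAt_of_smooth hD hΦ x.2).hasFDerivAt
  have e2 := (hd.clm_apply (differentiableAt_of_smooth hD hs.1 x.2).hasFDerivAt).fderiv
  rw [fderiv_congr_on hD (g := fun _ => 0) e1 x.2] at e2
  have e3 := (hd.clm_apply
    (differentiableAt_of_smooth hD (contDiffOn_jet hD k hf.1) x.2).hasFDerivAt).fderiv
  rw [← fderiv_congr_on hD (fun y hy => K D hD subset_rfl f hf.1 y hy) x.2] at e3
  have e4 : fderiv ℝ (partialXY p q (W.eqn r f)) x v = 0 := by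
    have hsm : ContDiffOn ℝ ∞ (W.eqn r f) D := (W.isDiffOp_eqn r).contDiffOn hD subset_rfl hf.1
    have hz := (W.jet_mem_prolongation_iff hD subset_rfl hf.1 x x.2).1 hj'
    rw [fderiv_eq_partial, ← partialXY_succ_left, partialY_partialXY hD _ _ hsm x.2,
      hz r (p + 1) q (by omega), hz r p (q + 1) (by omega)]
    simp
  have e2' := congrArg (fun T : ℝ × ℝ →L[ℝ] ℝ => T v) e2
  have e3' := congrArg (fun T : ℝ × ℝ →L[ℝ] ℝ => T v) e3
  rw [jetProj_jet] at hjs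
  simp only [e4, fderiv_jet hD h hf.1 x.2, hjs, add_apply,
    ContinuousLinearMap.comp_apply, ContinuousLinearMap.flip_apply] at e3'
  simp only [add_apply, ContinuousLinearMap.comp_apply,
    ContinuousLinearMap.flip_apply] at e2'
  refine (K D hD subset_rfl g hg.contDiffOn x x.2).trans ?_
  rw [hgj, map_sub]
  simp at e2' e3' ⊢
  linarith

end PlanarWeb

end WebGeometry

end

open scoped ContDiff

noncomputable section

namespace WebGeometry

/-! ## Recurrence operators on sequences

The homogeneous part of degree `m` of a Taylor expansion is encoded by the sequence
`p ↦ ∂x^p ∂y^(m-p) f`; the constant vector field `b ∂x - a ∂y` then acts as `b S - a`, where `S` is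
the shift. -/

open Polynomial

/-- The shift of sequences. -/
def seqShift : Module.End ℝ (ℕ → ℝ) where
  toFun t p := t (p + 1)
  map_add' _ _ := rfl
  map_smul' _ _ := rfl

/-- The polynomial in the shift that corresponds to the vector field `b ∂x - a ∂y`. -/
def linPoly (a b : ℝ) : ℝ[X] := C b * X - C a

/-- The action of polynomials in the shift on sequences. -/
def seqAct (P : ℝ[X]) (t : ℕ → ℝ) : ℕ → ℝ := aeval seqShift P t

theorem seqAct_mul (P Q : ℝ[X]) (t : ℕ → ℝ) : seqAct (P * Q) t = seqAct P (seqAct Q t) := by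
  simp [seqAct]

theorem seqAct_one (t : ℕ → ℝ) : seqAct 1 t = t := by simp [seqAct]

theorem seqAct_linPoly (a b : ℝ) (t : ℕ → ℝ) (p : ℕ) :
    seqAct (linPoly a b) t p = b * t (p + 1) - a * t p := by
  simp [seqAct, linPoly, seqShift]

theorem seqAct_sum {ι : Type*} (s : Finset ι) (P : ℝ[X]) (t : ι → ℕ → ℝ) :
    seqAct P (∑ i ∈ s, t i) = ∑ i ∈ s, seqAct P (t i) := map_sum _ _ _

theorem seqAct_smul (P : ℝ[X]) (c : ℝ) (t : ℕ → ℝ) : seqAct P (c • t) = c • seqAct P t :=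
  map_smul _ _ _

theorem seqAct_C_mul (P : ℝ[X]) (c : ℝ) (t : ℕ → ℝ) : seqAct (C c * P) t = c • seqAct P t := by
  simp [seqAct]

theorem seqAct_zero (P : ℝ[X]) : seqAct P 0 = 0 := map_zero _

/-- A two-term recurrence: solved upwards from `0` if `b ≠ 0`, entry by entry if `b = 0`. -/
theorem exists_seqAct_linPoly_eq {a b : ℝ} (h : a ≠ 0 ∨ b ≠ 0) (r : ℕ → ℝ) :
    ∃ t, seqAct (linPoly a b) t = r := by
  by_cases hb : b = 0
  · have ha : a ≠ 0 := h.resolve_right (by simpa using hb)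
    refine ⟨fun p => -(r p) / a, funext fun p => ?_⟩
    rw [seqAct_linPoly, hb]
    field_simp
    ring
  · refine ⟨fun p => Nat.rec 0 (fun q t => (r q + a * t) / b) p, funext fun p => ?_⟩
    rw [seqAct_linPoly]
    field_simp
    ring

/-- The form killed by `b ∂x - a ∂y` is a multiple of a power of `a x + b y`. The constant is read
off at the bottom entry if `b ≠ 0`; if `b = 0` only the top entry can be nonzero. -/
theorem exists_geometric {a b : ℝ} (h : a ≠ 0 ∨ b ≠ 0) {L : ℕ} {t : ℕ → ℝ}
    (ht : ∀ p < L, b * t (p + 1) = a * t p) : ∃ c, ∀ p ≤ L, t p = c * a ^ p * b ^ (L - p) := by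
  by_cases hb : b = 0
  · have ha : a ≠ 0 := h.resolve_right (by simpa using hb)
    subst hb
    refine ⟨t L / a ^ L, fun p hp => ?_⟩
    rcases hp.lt_or_eq with hp | rfl
    · have := ht p hp
      rw [zero_pow (by omega), mul_zero]
      simpa [ha] using this.symm
    · simp [ha]
  · refine ⟨t 0 / b ^ L, fun p => ?_⟩
    induction p with
    | zero => intro _; simp [hb]
    | succ p ih =>
      intro hp
      have h1 := ht p hp
      rw [ih (by omega)] at h1
      have h2 : L - p = L - (p + 1) + 1 := by omega
      rw [h2] at h1
      have : b * t (p + 1) = b * (t 0 / b ^ L * a ^ (p + 1) * b ^ (L - (p + 1))) := by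
        rw [h1]; ring
      exact mul_left_cancel₀ hb this

theorem linPoly_ne_zero_of_det {a b a' b' : ℝ} (h : a * b' - b * a' ≠ 0) : a ≠ 0 ∨ b ≠ 0 := by
  by_contra! h'
  simp [h'.1, h'.2] at h

/-- A binary form of degree `L - 1` annihilated by the product of the vector fields
`b_i ∂x - a_i ∂y` is a linear combination of the powers of the linear forms `a_i x + b_i y`. -/
theorem exists_eq_sum_powers {ι : Type*} [DecidableEq ι] (s : Finset ι) (a b : ι → ℝ)
    (hne : ∀ i ∈ s, a i ≠ 0 ∨ b i ≠ 0)
    (hdet : ∀ i ∈ s, ∀ j ∈ s, i ≠ j → a i * b j - b i * a j ≠ 0) (L : ℕ) (t : ℕ → ℝ)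
    (ht : ∀ p, p + s.card < L → seqAct (∏ i ∈ s, linPoly (a i) (b i)) t p = 0) :
    ∃ c : ι → ℝ, ∀ p < L, t p = ∑ i ∈ s, c i * (a i ^ p * b i ^ (L - 1 - p)) := by
  induction s using Finset.induction_on generalizing L t with
  | empty => exact ⟨0, fun p hp => by simpa [seqAct_one] using ht p (by simpa using hp)⟩
  | insert j s hj ih =>
    rcases L with _ | L
    · exact ⟨0, fun p hp => absurd hp (by omega)⟩
    rw [Finset.prod_insert hj, mul_comm, Finset.card_insert_of_notMem hj] at ht
    obtain ⟨c, hc⟩ := ih (fun i hi => hne i (Finset.mem_insert_of_mem hi))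
      (fun i hi k hk => hdet i (Finset.mem_insert_of_mem hi) k (Finset.mem_insert_of_mem hk)) L
      (seqAct (linPoly (a j) (b j)) t) (fun p hp => by
        rw [← seqAct_mul]; exact ht p (by omega))
    have hd : ∀ i ∈ s, a i * b j - b i * a j ≠ 0 := fun i hi =>
      hdet i (Finset.mem_insert_of_mem hi) j (Finset.mem_insert_self j s) (by
        rintro rfl; exact hj hi)
    -- The operator of index `j` maps the sequence of the `L`-th power of the form of index `i` to
    -- `a_i b_j - b_i a_j` times that of the `(L-1)`-st power. Dividing by this determinant lifts
    -- the expansion `c`, and the remainder is killed by the operator, hence geometric.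
    let e : ι → ℝ := fun i => c i / (a i * b j - b i * a j)
    obtain ⟨c', hc'⟩ := exists_geometric (hne j (Finset.mem_insert_self j s)) (L := L)
      (t := fun p => t p - ∑ i ∈ s, e i * (a i ^ p * b i ^ (L - p))) (by
        intro p hp
        have h1 := hc p hp
        rw [seqAct_linPoly] at h1
        have h2 : ∑ i ∈ s, c i * (a i ^ p * b i ^ (L - 1 - p)) =
            b j * ∑ i ∈ s, e i * (a i ^ (p + 1) * b i ^ (L - (p + 1))) -
              a j * ∑ i ∈ s, e i * (a i ^ p * b i ^ (L - p)) := by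
          rw [Finset.mul_sum, Finset.mul_sum, ← Finset.sum_sub_distrib]
          refine Finset.sum_congr rfl fun i hi => ?_
          have h3 : L - p = L - 1 - p + 1 := by omega
          have h4 : L - (p + 1) = L - 1 - p := by omega
          have h5 : c i = e i * (a i * b j - b i * a j) := (div_mul_cancel₀ _ (hd i hi)).symm
          rw [h3, h4, h5]
          ring
        linarith)
    refine ⟨fun i => if i = j then c' else e i, fun p hp => ?_⟩
    rw [Finset.sum_insert hj]
    have h1 := hc' p (by omega)
    have h2 : ∑ i ∈ s, (if i = j then c' else e i) * (a i ^ p * b i ^ (L + 1 - 1 - p)) =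
        ∑ i ∈ s, e i * (a i ^ p * b i ^ (L - p)) := by
      refine Finset.sum_congr rfl fun i hi => ?_
      rw [if_neg (by rintro rfl; exact hj hi)]
      rfl
    simp only [if_true]
    rw [h2]
    simp only [Nat.add_sub_cancel]
    linarith

/-- The linear forms `a_i x + b_i y` are such that a system of binary forms `r_i` of degree `k - 1`
with sum zero is of the form `(b_i ∂x - a_i ∂y) μ_i` with `∑ μ_i (a_i x + b_i y)' = 0`, provided
that an obstruction vanishes, which is void when there are more than `k + 1` forms. -/
theorem exists_symbol_solution {ι : Type*} [DecidableEq ι] [Fintype ι] (a b : ι → ℝ)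
    (hne : ∀ i, a i ≠ 0 ∨ b i ≠ 0) (hdet : ∀ i j, i ≠ j → a i * b j - b i * a j ≠ 0)
    (k : ℕ) (r : ι → ℕ → ℝ) (hr : ∑ i, r i = 0) (i₀ : ι)
    (hob : ∀ p, p + Fintype.card ι < k + 2 → ∑ i ∈ Finset.univ.erase i₀, (b i₀ * a i - a i₀ * b i) *
      seqAct (∏ j ∈ (Finset.univ.erase i₀).erase i, linPoly (a j) (b j)) (r i) p = 0) :
    ∃ μ : ι → ℕ → ℝ, (∀ i, ∀ p < k, b i * μ i (p + 1) - a i * μ i p = r i p) ∧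
      (∀ p ≤ k, ∑ i, μ i p * a i = 0) ∧ ∀ p ≤ k, ∑ i, μ i p * b i = 0 := by
  choose ν hν using fun i => exists_seqAct_linPoly_eq (hne i) (r i)
  -- The `ν_i` solve the equations without the side condition. As `∑ r_i = 0`, the sequence `t`
  -- encodes a form `T` of degree `k + 1` with `∂y T = ∑ b_i ν_i` and `∂x T = ∑ a_i ν_i`.
  let t : ℕ → ℝ := ∑ i, b i • ν i
  have ht1 : seqAct X t = ∑ i, a i • ν i := by
    have h0 : ∀ p, ∑ i, r i p = 0 := fun p => by
      have := congrFun hr p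
      simpa using this
    funext p
    have h1 : seqAct X t p = t (p + 1) := by simp [seqAct, seqShift]
    rw [h1]
    have h2 : ∀ i, r i p = b i * ν i (p + 1) - a i * ν i p := fun i => by
      rw [← hν i, seqAct_linPoly]
    have := h0 p
    rw [Finset.sum_congr rfl fun i _ => h2 i, Finset.sum_sub_distrib, sub_eq_zero] at this
    simpa [t] using this
  -- The field of index `i₀` removes its own term from `T`.
  have ht2 : seqAct (linPoly (a i₀) (b i₀)) t =
      ∑ i ∈ Finset.univ.erase i₀, (b i₀ * a i - a i₀ * b i) • ν i := by
    have h1 : seqAct (linPoly (a i₀) (b i₀)) t = b i₀ • seqAct X t - a i₀ • t := by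
      simp [linPoly, seqAct]
    rw [h1, ht1, Finset.smul_sum, Finset.smul_sum, ← Finset.sum_sub_distrib,
      ← Finset.add_sum_erase _ _ (Finset.mem_univ i₀)]
    have h2 : b i₀ • a i₀ • ν i₀ - a i₀ • b i₀ • ν i₀ = 0 := by
      rw [smul_comm, sub_self]
    rw [h2, zero_add]
    refine Finset.sum_congr rfl fun i _ => ?_
    rw [sub_smul, mul_smul, mul_smul]
  -- Under the product of the remaining operators each `ν_i` meets its own one and becomes `r_i`;
  -- the outcome is the expression in `hob`.
  obtain ⟨c, hc⟩ := exists_eq_sum_powers Finset.univ a b (fun i _ => hne i)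
    (fun i _ j _ h => hdet i j h) (k + 2) t (fun p hp => by
      rw [← Finset.mul_prod_erase _ _ (Finset.mem_univ i₀), mul_comm (linPoly (a i₀) (b i₀)),
        seqAct_mul, ht2, seqAct_sum,
        Finset.sum_apply, ← hob p (by simpa using hp)]
      refine Finset.sum_congr rfl fun i hi => ?_
      rw [seqAct_smul, ← Finset.mul_prod_erase _ _ hi, mul_comm (linPoly (a i) (b i)), seqAct_mul, hν i]
      rfl)
  -- Subtracting multiples of powers leaves the `r_i` unchanged, and with the coefficients of `T` it
  -- cancels both partial derivatives of `T`, which are the two side conditions.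
  refine ⟨fun i p => ν i p - c i * (a i ^ p * b i ^ (k - p)), fun i p hp => ?_, fun p hp => ?_,
    fun p hp => ?_⟩
  · have h1 : b i * ν i (p + 1) - a i * ν i p = r i p := by rw [← seqAct_linPoly, hν]
    have h2 : k - p = k - (p + 1) + 1 := by omega
    beta_reduce
    rw [← h1, h2]
    ring
  · have h1 := hc (p + 1) (by omega)
    have h2 : t (p + 1) = ∑ i, a i * ν i p := by
      have := congrFun ht1 p
      simpa [seqAct, seqShift] using this
    rw [h2] at h1
    rw [← sub_eq_zero, ← Finset.sum_sub_distrib] at h1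
    rw [← h1]
    refine Finset.sum_congr rfl fun i _ => ?_
    have h2 : k + 2 - 1 - (p + 1) = k - p := by omega
    rw [h2]
    ring
  · have h1 := hc p (by omega)
    have h2 : t p = ∑ i, b i * ν i p := by simp [t]
    rw [h2] at h1
    rw [← sub_eq_zero, ← Finset.sum_sub_distrib] at h1
    rw [← h1]
    refine Finset.sum_congr rfl fun i _ => ?_
    have h2 : k + 2 - 1 - p = k - p + 1 := by omega
    rw [h2]
    ring

/-- The linear map sending the coefficients `c_i` to the binary form
`∑ c_i (a_i x + b_i y)^(L-1)`. -/
def powerMap {ι : Type*} [Fintype ι] (a b : ι → ℝ) (L : ℕ) : (ι → ℝ) →ₗ[ℝ] (Fin L → ℝ) where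
  toFun c p := ∑ i, c i * (a i ^ (p : ℕ) * b i ^ (L - 1 - p))
  map_add' _ _ := by funext p; simp [add_mul, Finset.sum_add_distrib]
  map_smul' _ _ := by funext p; simp [mul_assoc, Finset.mul_sum]

/-- For `L` at most the number of forms the hypothesis of `exists_eq_sum_powers` is void, so
`powerMap` is surjective and rank-nullity applies. -/
theorem finrank_ker_powerMap {ι : Type*} [Fintype ι] (a b : ι → ℝ)
    (hne : ∀ i, a i ≠ 0 ∨ b i ≠ 0) (hdet : ∀ i j, i ≠ j → a i * b j - b i * a j ≠ 0)
    {L : ℕ} (hL : L ≤ Fintype.card ι) :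
    Module.finrank ℝ (LinearMap.ker (powerMap a b L)) = Fintype.card ι - L := by
  classical
  have hs : Function.Surjective (powerMap a b L) := by
    intro y
    obtain ⟨c, hc⟩ := exists_eq_sum_powers Finset.univ a b (fun i _ => hne i)
      (fun i _ j _ h => hdet i j h) L (fun p => if h : p < L then y ⟨p, h⟩ else 0)
      (fun p hp => absurd hp (by rw [Finset.card_univ]; omega))
    refine ⟨c, funext fun p => ?_⟩
    have := hc p p.2
    rw [dif_pos p.2] at this
    exact this.symm
  have := LinearMap.finrank_range_add_finrank_ker (powerMap a b L)
  rw [LinearMap.range_eq_top.2 hs, finrank_top] at this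
  simp only [Module.finrank_fintype_fun_eq_card, Fintype.card_fin] at this
  omega

end WebGeometry

end

/-! ### Symbols of the prolongations, lifting of jets, ranks of the fibres -/

open scoped ContDiff

noncomputable section

namespace WebGeometry

/-- The leading part of the Taylor expansion of a function vanishing to order `m`. -/
def leadSeq (m : ℕ) (f : ℝ × ℝ → ℝ) (x : ℝ × ℝ) (p : ℕ) : ℝ :=
  if p ≤ m then partialXY p (m - p) f x else 0

namespace PlanarWeb

variable {d : ℕ} {D : Set (ℝ × ℝ)} (W : PlanarWeb d D)

theorem form_ne_zero (i : Fin d) {x : ℝ × ℝ} (hx : x ∈ D) : W.formX i x ≠ 0 ∨ W.formY i x ≠ 0 := by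
  have h3 := W.three_le
  obtain ⟨j, hj⟩ : ∃ j : Fin d, i ≠ j := by
    by_cases h : i = ⟨0, by omega⟩
    · exact ⟨⟨1, by omega⟩, by subst h; simp⟩
    · exact ⟨_, h⟩
  exact linPoly_ne_zero_of_det (W.det_ne_zero hj hx)

theorem partialXY_linRel {U : Set (ℝ × ℝ)} (hU : IsOpen U) (hUD : U ⊆ D)
    {g : ℝ × ℝ → Fin d → ℝ} (hg : ContDiffOn ℝ ∞ g U) {x : ℝ × ℝ} (hx : x ∈ U) {k : ℕ}
    (hv : ∀ i, VanishesTo k (fun y => g y i) x) {p q : ℕ} (hpq : p + q ≤ k) (v : ℝ × ℝ) :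
    partialXY p q (W.linRel v g) x = ∑ i, partialXY p q (fun y => g y i) x * W.form i x v := by
  have hω : ∀ i, ContDiffOn ℝ ∞ (fun y => W.form i y v) U := fun i =>
    ((W.smooth i).mono hUD).clm_apply contDiffOn_const
  have e : W.linRel v g = fun y => ∑ i, W.form i y v * g y i := by
    funext y; simp only [linRel, mul_comm]
  rw [e, partialXY_sum _ hU _ _ (fun i _ => (hω i).mul (contDiffOn_pi.1 hg i)) hx]
  refine Finset.sum_congr rfl fun i _ => ?_
  rw [(hv i).partialXY_mul hU hx (contDiffOn_pi.1 hg i) (hω i) hpq, mul_comm]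

/-- Derivatives that fall on the coefficients leave a derivative of `g_i` of order at most `k`,
which vanishes; only the symbol survives. -/
theorem partialXY_dForm {U : Set (ℝ × ℝ)} (hU : IsOpen U) (hUD : U ⊆ D)
    {g : ℝ × ℝ → Fin d → ℝ} (hg : ContDiffOn ℝ ∞ g U) {x : ℝ × ℝ} (hx : x ∈ U) {k : ℕ} (i : Fin d)
    (hv : VanishesTo (k + 1) (fun y => g y i) x) {p q : ℕ} (hpq : p + q ≤ k) :
    partialXY p q (W.dForm i g) x = W.formY i x * partialXY (p + 1) q (fun y => g y i) x -
      W.formX i x * partialXY p (q + 1) (fun y => g y i) x := by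
  have hgi := contDiffOn_pi.1 hg i
  have hX := contDiffOn_partialX hU hgi
  have hY := contDiffOn_partialY hU hgi
  have ha := (W.contDiffOn_formX i).mono hUD
  have hb := (W.contDiffOn_formY i).mono hUD
  have he : ContDiffOn ℝ ∞ (fun y => extD (W.form i) y (1, 0) (0, 1)) U :=
    contDiffOn_extD hU ((W.smooth i).mono hUD) (v := fun _ => (1, 0)) (w := fun _ => (0, 1))
      contDiffOn_const contDiffOn_const
  rw [partialXY_congr hU p q (fun y hy => W.dForm_eq hU hUD hg i hy) hx,
    partialXY_add hU p q ((hb.mul hX).sub (ha.mul hY)) (he.mul hgi) hx,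
    partialXY_sub hU p q (hb.mul hX) (ha.mul hY) hx,
    (hv.partialX hU hx hgi).partialXY_mul hU hx hX hb hpq,
    (hv.partialY).partialXY_mul hU hx hY ha hpq,
    hv.partialXY_mul hU hx hgi he (by omega), hv p q (by omega),
    ← partialXY_succ_left' hU p q hgi hx, ← partialXY_succ_right]
  ring

/-- Exterior derivative of `∑ λ_i ω_i = 0`. This is the identity among the equations that the
sum-zero hypothesis of `exists_symbol_solution` demands. -/
theorem sum_dForm {lam : ℝ × ℝ → Fin d → ℝ} (h : W.IsSection lam) {x : ℝ × ℝ} (hx : x ∈ D) :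
    ∑ i, W.dForm i lam x = 0 := by
  have hdiff : ∀ i ∈ Finset.univ, HasFDerivAt (fun y => lam y i • W.form i y)
      (fderiv ℝ (fun y => lam y i • W.form i y) x) x := fun i _ =>
    (differentiableAt_of_smooth W.isOpen (W.smooth_smul i h.1) hx).hasFDerivAt
  have h1 : ∑ i, fderiv ℝ (fun y => lam y i • W.form i y) x = 0 := by
    rw [← (HasFDerivAt.fun_sum hdiff).fderiv, fderiv_congr_on W.isOpen (g := fun _ => 0) h.2 hx]
    simp
  simp only [dForm, extD, Finset.sum_sub_distrib]
  have h2 : ∀ v w : ℝ × ℝ, ∑ i, fderiv ℝ (fun y => lam y i • W.form i y) x v w = 0 := by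
    intro v w
    have := congrArg (fun T : ℝ × ℝ →L[ℝ] ℝ × ℝ →L[ℝ] ℝ => T v w) h1
    simpa using this
  rw [h2, h2, sub_self]

theorem partialXY_eqn_add {f g : ℝ × ℝ → Fin d → ℝ} (hf : ContDiffOn ℝ ∞ f D)
    (hg : ContDiffOn ℝ ∞ g D) (r : Fin 2 ⊕ Fin d) (p q : ℕ) {x : ℝ × ℝ} (hx : x ∈ D) :
    partialXY p q (W.eqn r (fun y => f y + g y)) x =
      partialXY p q (W.eqn r f) x + partialXY p q (W.eqn r g) x := by
  have h1 := (W.isDiffOp_eqn r).contDiffOn W.isOpen subset_rfl hf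
  have h2 := (W.isDiffOp_eqn r).contDiffOn W.isOpen subset_rfl hg
  rw [← partialXY_add W.isOpen p q h1 h2 hx]
  refine partialXY_congr W.isOpen p q (fun y hy => ?_) hx
  rcases r with r | i
  · simp [eqn, linRel, add_mul, Finset.sum_add_distrib]
  · simpa [eqn] using W.dForm_comb i 1 1 hf hg hy

/-- The jets of order `m` which vanish to order `m` and have the coefficients `t i p`. -/
def topJet (m : ℕ) (t : Fin d → ℕ → ℝ) : JetFibre d m :=
  fun p i => if p.1.1 + p.1.2 = m then t i p.1.1 else 0

theorem exists_topJet (m : ℕ) (t : Fin d → ℕ → ℝ) (x : ℝ × ℝ) :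
    ∃ g : ℝ × ℝ → Fin d → ℝ, ContDiff ℝ ∞ g ∧ jet m x g = topJet m t ∧
      (∀ i, VanishesTo m (fun y => g y i) x) ∧
      ∀ i p q, p + q = m → partialXY p q (fun y => g y i) x = t i p := by
  obtain ⟨g, hg, hgj⟩ := exists_jet_eq x (topJet m t)
  have h : ∀ i p q, p + q ≤ m →
      partialXY p q (fun y => g y i) x = if p + q = m then t i p else 0 := by
    intro i p q hpq
    rw [← partialXY_apply isOpen_univ hg.contDiffOn p q i (Set.mem_univ x)]
    exact congrFun (congrFun hgj ⟨(p, q), hpq⟩) i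
  refine ⟨g, hg, hgj, fun i p q hpq => ?_, fun i p q hpq => ?_⟩
  · rw [h i p q hpq.le, if_neg hpq.ne]
  · rw [h i p q hpq.le, if_pos hpq]

/-- Lifting jets from one prolongation to the next, under a condition which is void when there are
enough foliations. -/
theorem exists_lift {k : ℕ} (x : D) {f : ℝ × ℝ → Fin d → ℝ} (hf : W.IsSection f)
    (hv : ∀ i, VanishesTo k (W.dForm i f) x) (i₀ : Fin d)
    (hob : ∀ p, p + d < k + 3 → ∑ i ∈ Finset.univ.erase i₀,
      (W.formY i₀ x * W.formX i x - W.formX i₀ x * W.formY i x) *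
      seqAct (∏ j ∈ (Finset.univ.erase i₀).erase i, linPoly (W.formX j x) (W.formY j x))
        (leadSeq k (W.dForm i f) x) p = 0) :
    ∃ j ∈ W.prolongation (k + 1) x, jetProj d k.le_succ j = jet k x f := by
  have hD := W.isOpen
  -- The jet is corrected only in degree `k + 1`, by `μ`, which has to cancel the leading errors;
  -- hence the minus sign. Beyond degree `k` the sequences `leadSeq` are zero, so their sum vanishes
  -- at every index.
  obtain ⟨μ, h1, h2, h3⟩ := exists_symbol_solution (fun i => W.formX i x) (fun i => W.formY i x)
    (fun i => W.form_ne_zero i x.2)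
    (fun i j h => W.det_ne_zero h x.2) (k + 1)
    (fun i => -leadSeq k (W.dForm i f) x) (by
      funext p
      simp only [Finset.sum_apply, Pi.neg_apply, Finset.sum_neg_distrib, Pi.zero_apply, leadSeq]
      split_ifs
      · rw [← partialXY_sum _ hD _ _ (fun i _ => W.smooth_dForm i hf.1) x.2,
          partialXY_eq_zero hD _ _ (fun y hy => W.sum_dForm hf hy) x.2, neg_zero]
      · simp) i₀ (fun p hp => by
        have := hob p (by simpa using hp)
        rw [← neg_eq_zero, ← Finset.sum_neg_distrib] at this
        rw [← this]
        refine Finset.sum_congr rfl fun i _ => ?_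
        rw [show -leadSeq k (W.dForm i f) x = (-1 : ℝ) • leadSeq k (W.dForm i f) x by simp,
          seqAct_smul]
        simp)
  obtain ⟨g, hg, hgj, hgv, hgt⟩ := exists_topJet (k + 1) μ (x : ℝ × ℝ)
  have hfg : ContDiffOn ℝ ∞ (fun y => f y + g y) D := hf.1.add hg.contDiffOn
  refine ⟨jet (k + 1) x (fun y => f y + g y), ?_, ?_⟩
  · rw [W.jet_mem_prolongation_iff hD subset_rfl hfg x x.2]
    intro r p q hr
    rw [W.partialXY_eqn_add hf.1 hg.contDiffOn r p q x.2]
    rcases r with r | i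
    · have e1 : partialXY p q (W.eqn (.inl r) f) x = 0 := by
        refine partialXY_eq_zero hD p q (fun y hy => ?_) x.2
        have := (W.sum_form_eq_zero_iff f y).1 (hf.2 y hy)
        fin_cases r
        exacts [this.1, this.2]
      have hpq : p + q ≤ k + 1 := hr
      rw [e1, zero_add, eqn, W.partialXY_linRel hD subset_rfl hg.contDiffOn x.2 hgv hpq]
      rcases hpq.lt_or_eq with hpq' | hpq'
      · exact Finset.sum_eq_zero fun i _ => by rw [hgv i p q hpq', zero_mul]
      · have : ∀ i, partialXY p q (fun y => g y i) x = μ i p := fun i => hgt i p q hpq'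
        simp only [this]
        fin_cases r
        · exact h2 p (by omega)
        · exact h3 p (by omega)
    · have hpq : p + q ≤ k := by simpa [eqnOrder] using hr
      rw [eqn, W.partialXY_dForm hD subset_rfl hg.contDiffOn x.2 i (hgv i) hpq]
      rcases hpq.lt_or_eq with hpq' | hpq'
      · rw [hv i p q hpq', hgv i (p + 1) q (by omega), hgv i p (q + 1) (by omega)]
        simp
      · rw [hgt i (p + 1) q (by omega), hgt i p (q + 1) (by omega), h1 i p (by omega)]
        have : k - p = q := by omega
        simp [leadSeq, this, show p ≤ k by omega]
  · funext p
    change partialXY p.1.1 p.1.2 (fun y => f y + g y) x = partialXY p.1.1 p.1.2 f x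
    rw [partialXY_add hD _ _ hf.1 hg.contDiffOn x.2]
    have : partialXY p.1.1 p.1.2 g x = 0 := by
      funext i
      rw [partialXY_apply isOpen_univ hg.contDiffOn _ _ _ (Set.mem_univ _)]
      exact hgv i _ _ (by have := p.2; omega)
    rw [this, add_zero]

/-- At these orders there are at least `k + 3` foliations, and the condition in `exists_lift`
concerns no index at all. -/
theorem map_jetProj_prolongation {k : ℕ} (hk : k + 1 ≤ d - 2) (x : D) :
    (W.prolongation (k + 1) x).map (jetProj d k.le_succ) = W.prolongation k x := by
  apply le_antisymm
  · rintro _ ⟨j, hj, rfl⟩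
    exact W.jetProj_mem_prolongation _ hj
  · rintro _ ⟨f, hf, hv, rfl⟩
    have := W.three_le
    exact W.exists_lift x hf hv ⟨0, by omega⟩ fun p hp => absurd hp (by omega)

/-- The leading parts of the elements of a prolongation. -/
def powerJet (m : ℕ) (x : ℝ × ℝ) : (Fin d → ℝ) →ₗ[ℝ] JetFibre d m where
  toFun c := topJet m fun i p => c i * (W.formX i x ^ p * W.formY i x ^ (m - p))
  map_add' _ _ := by funext p i; simp [topJet, add_mul]; split_ifs <;> simp
  map_smul' _ _ := by funext p i; simp [topJet, mul_assoc]

theorem powerJet_injective (m : ℕ) (x : D) : Function.Injective (W.powerJet m x) := by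
  rw [← LinearMap.ker_eq_bot, LinearMap.ker_eq_bot']
  intro c hc
  funext i
  rcases W.form_ne_zero i x.2 with h | h
  · have := congrFun (congrFun hc ⟨(m, 0), by simp⟩) i
    simpa [powerJet, topJet, h] using this
  · have := congrFun (congrFun hc ⟨(0, m), by simp⟩) i
    simpa [powerJet, topJet, h] using this

/-- For jets with only top order terms, `d(λ_i ω_i) = 0` says that the `i`-th component is `c_i
ℓ_i^m` with `ℓ_i = a_i x + b_i y`. The relation `∑ λ_i ω_i = 0` then states that both partial
derivatives of `∑ c_i ℓ_i^{m+1}` vanish; this form has `m + 2` coefficients. -/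
theorem map_powerJet_ker (m : ℕ) (x : D) :
    ((LinearMap.ker (powerMap (fun i => W.formX i x) (fun i => W.formY i x) (m + 2))).map
      (W.powerJet m x) : Set (JetFibre d m)) =
      {j | j ∈ W.prolongation m x ∧ ∀ p : JetIndex m, p.1.1 + p.1.2 < m → j p = 0} := by
  ext j
  constructor
  · rintro ⟨c, hc, rfl⟩
    refine ⟨?_, fun p hp => by funext i; simp [powerJet, topJet, hp.ne]⟩
    obtain ⟨g, hg, hgj, hgv, hgt⟩ := exists_topJet m
      (fun i p => c i * (W.formX i x ^ p * W.formY i x ^ (m - p))) (x : ℝ × ℝ)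
    have hj : W.powerJet m x c = jet m x g := hgj.symm
    rw [hj, W.mem_prolongation_iff_of_jet hg]
    intro r p q hr
    have hc' : ∀ p < m + 2, ∑ i, c i * (W.formX i x ^ p * W.formY i x ^ (m + 1 - p)) = 0 :=
      fun p hp => congrFun hc ⟨p, hp⟩
    rcases r with r | i
    · have hpq : p + q ≤ m := hr
      rw [eqn, W.partialXY_linRel W.isOpen subset_rfl hg.contDiffOn x.2 hgv hpq]
      rcases hpq.lt_or_eq with hpq' | hpq'
      · exact Finset.sum_eq_zero fun i _ => by rw [hgv i p q hpq', zero_mul]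
      · simp only [fun i => hgt i p q hpq']
        fin_cases r
        · refine Eq.trans ?_ (hc' (p + 1) (by omega))
          refine Finset.sum_congr rfl fun i _ => ?_
          rw [show m + 1 - (p + 1) = m - p by omega]
          change _ * W.formX i x = _
          ring
        · refine Eq.trans ?_ (hc' p (by omega))
          refine Finset.sum_congr rfl fun i _ => ?_
          rw [show m + 1 - p = m - p + 1 by omega]
          change _ * W.formY i x = _
          ring
    · have hpq : p + q + 1 ≤ m := hr
      obtain ⟨m, rfl⟩ : ∃ m', m = m' + 1 := ⟨m - 1, by omega⟩
      rw [eqn, W.partialXY_dForm W.isOpen subset_rfl hg.contDiffOn x.2 i (hgv i)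
        (show p + q ≤ m by omega)]
      rcases (show p + q ≤ m by omega).lt_or_eq with hpq' | hpq'
      · rw [hgv i (p + 1) q (by omega), hgv i p (q + 1) (by omega)]
        simp
      · rw [hgt i (p + 1) q (by omega), hgt i p (q + 1) (by omega),
          show m + 1 - p = m + 1 - (p + 1) + 1 by omega]
        ring
  · rintro ⟨hj, hlow⟩
    obtain ⟨g, hg, rfl⟩ := exists_jet_eq (x : ℝ × ℝ) j
    rw [W.mem_prolongation_iff_of_jet hg] at hj
    have hgv : ∀ i, VanishesTo m (fun y => g y i) x := fun i p q hpq => by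
      rw [← partialXY_apply isOpen_univ hg.contDiffOn _ _ _ (Set.mem_univ _)]
      exact congrFun (hlow ⟨(p, q), hpq.le⟩ hpq) i
    have hgeom : ∀ i, ∃ c, ∀ p ≤ m, partialXY p (m - p) (fun y => g y i) x =
        c * W.formX i x ^ p * W.formY i x ^ (m - p) := by
      intro i
      refine exists_geometric (W.form_ne_zero i x.2) (L := m)
        (t := fun p => partialXY p (m - p) (fun y => g y i) x) fun p hp => ?_
      obtain ⟨m, rfl⟩ : ∃ m', m = m' + 1 := ⟨m - 1, by omega⟩
      have := hj (.inr i) p (m - p) (by simp only [eqnOrder]; omega)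
      rw [eqn, W.partialXY_dForm W.isOpen subset_rfl hg.contDiffOn x.2 i (hgv i)
        (show p + (m - p) ≤ m by omega), sub_eq_zero] at this
      simp only [show m + 1 - p = m - p + 1 by omega, show m + 1 - (p + 1) = m - p by omega]
      exact this
    choose c hc using hgeom
    refine ⟨c, ?_, ?_⟩
    · have h2 : ∀ (v : Fin 2) p, p ≤ m → ∑ i, (c i * W.formX i x ^ p * W.formY i x ^ (m - p)) *
          W.form i x (![(1, 0), (0, 1)] v) = 0 := by
        intro v p hp
        have := hj (.inl v) p (m - p) (by simp only [eqnOrder]; omega)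
        rw [eqn, W.partialXY_linRel W.isOpen subset_rfl hg.contDiffOn x.2 hgv
          (show p + (m - p) ≤ m by omega)] at this
        refine Eq.trans ?_ this
        exact Finset.sum_congr rfl fun i _ => by rw [hc i p hp]
      rw [SetLike.mem_coe, LinearMap.mem_ker]
      funext p
      change ∑ i, c i * (W.formX i x ^ (p : ℕ) * W.formY i x ^ (m + 1 - p)) = 0
      rcases (show (p : ℕ) ≤ m + 1 by have := p.2; omega).lt_or_eq with hp | hp
      · rw [← h2 1 p (by omega)]
        refine Finset.sum_congr rfl fun i _ => ?_
        rw [show m + 1 - (p : ℕ) = m - p + 1 by omega]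
        change _ = _ * W.formY i x
        ring
      · rw [← h2 0 m le_rfl, hp]
        refine Finset.sum_congr rfl fun i _ => ?_
        change _ = _ * W.formX i x
        simp
        ring
    · funext p i
      rw [jet_apply, partialXY_apply isOpen_univ hg.contDiffOn _ _ _ (Set.mem_univ _)]
      change (if p.1.1 + p.1.2 = m then _ else _) = _
      split_ifs with h
      · have := hc i p.1.1 (by omega)
        rw [show m - p.1.1 = p.1.2 by omega] at this ⊢
        rw [this, mul_assoc]
      · exact (hgv i _ _ (by have := p.2; omega)).symm

theorem finrank_map_powerJet_ker {m : ℕ} (hm : m + 2 ≤ d) (x : D) :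
    Module.finrank ℝ ((LinearMap.ker
      (powerMap (fun i => W.formX i x) (fun i => W.formY i x) (m + 2))).map (W.powerJet m x)) =
      d - (m + 2) := by
  rw [← (Submodule.equivMapOfInjective _ (W.powerJet_injective m x) _).finrank_eq, finrank_ker_powerMap _ _
    (fun i => W.form_ne_zero i x.2) (fun i j h => W.det_ne_zero h x.2) (by simpa using hm)]
  simp

theorem prolongation_inf_ker (k : ℕ) (x : D) :
    W.prolongation (k + 1) x ⊓ LinearMap.ker (jetProj d k.le_succ) =
      (LinearMap.ker (powerMap (fun i => W.formX i x) (fun i => W.formY i x) (k + 1 + 2))).map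
        (W.powerJet (k + 1) x) := by
  refine SetLike.coe_injective ?_
  rw [map_powerJet_ker]
  ext j
  refine and_congr_right fun _ => ⟨fun h p hp => ?_, fun h => ?_⟩
  · exact congrFun h ⟨p.1, by omega⟩
  · exact funext fun p => h ⟨p.1, _⟩ (Nat.lt_succ_of_le p.2)

theorem finrank_prolongation_inf_ker {k : ℕ} (hk : k + 1 ≤ d - 2) (x : D) :
    Module.finrank ℝ (W.prolongation (k + 1) x ⊓ LinearMap.ker (jetProj d k.le_succ) :
      Submodule ℝ _) = d - (k + 1) - 2 := by
  rw [prolongation_inf_ker, W.finrank_map_powerJet_ker (by omega)]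
  omega

/-- Rank-nullity along the tower. At `k = 0` there are no lower derivatives, and `map_powerJet_ker`
describes all of `E`. -/
theorem finrank_prolongation {k : ℕ} (hk : k ≤ d - 2) (x : D) :
    Module.finrank ℝ (W.prolongation k x) = ∑ j ∈ Finset.range (k + 1), (d - 2 - j) := by
  have h3 := W.three_le
  induction k with
  | zero =>
    have : W.prolongation 0 x = (LinearMap.ker (powerMap (fun i => W.formX i x)
        (fun i => W.formY i x) (0 + 2))).map (W.powerJet 0 x) := by
      refine SetLike.coe_injective ?_
      rw [map_powerJet_ker]
      ext j
      simp
    rw [this, W.finrank_map_powerJet_ker (by omega)]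
    simp
  | succ k ih =>
    have h1 := LinearMap.finrank_range_add_finrank_ker
      ((jetProj d k.le_succ).domRestrict (W.prolongation (k + 1) x))
    rw [LinearMap.range_domRestrict, W.map_jetProj_prolongation hk, ih (by omega)] at h1
    have h2 : Module.finrank ℝ (LinearMap.ker
        ((jetProj d k.le_succ).domRestrict (W.prolongation (k + 1) x))) = d - (k + 1) - 2 := by
      rw [← W.finrank_prolongation_inf_ker hk x, LinearMap.ker_domRestrict,
        ← Submodule.finrank_map_subtype_eq, Submodule.map_comap_subtype]
    rw [Finset.sum_range_succ, ← h1, h2]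
    omega

end PlanarWeb

end WebGeometry

end

open scoped ContDiff

noncomputable section

namespace WebGeometry

/-! ## Vector subbundles -/

section Subbundles

variable {V Z : Type*} [NormedAddCommGroup V] [NormedSpace ℝ V] [FiniteDimensional ℝ V]
  [NormedAddCommGroup Z] [NormedSpace ℝ Z] [FiniteDimensional ℝ Z]
  {D : Set (ℝ × ℝ)}

/-- A smooth family of endomorphisms which is invertible at a point is invertible nearby, with a
smooth family of inverses. -/
theorem exists_smooth_inverse (hD : IsOpen D) {M : ℝ × ℝ → V →L[ℝ] V} (hM : ContDiffOn ℝ ∞ M D)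
    {x : ℝ × ℝ} (hx : x ∈ D) (h : M x = 1) :
    ∃ U, IsOpen U ∧ x ∈ U ∧ U ⊆ D ∧ ∃ N : ℝ × ℝ → V →L[ℝ] V, ContDiffOn ℝ ∞ N U ∧
      ∀ y ∈ U, M y * N y = 1 ∧ N y * M y = 1 := by
  have : CompleteSpace V := FiniteDimensional.complete ℝ V
  refine ⟨D ∩ M ⁻¹' {a | IsUnit a}, hM.continuousOn.isOpen_inter_preimage hD Units.isOpen,
    ⟨hx, by simp [h]⟩, Set.inter_subset_left, fun y => Ring.inverse (M y), fun y hy => ?_,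
    fun y hy => ⟨Ring.mul_inverse_cancel _ hy.2, Ring.inverse_mul_cancel _ hy.2⟩⟩
  obtain ⟨u, hu⟩ := hy.2
  have h1 := contDiffAt_ringInverse ℝ u (n := ∞)
  rw [hu] at h1
  exact h1.comp_contDiffWithinAt y ((hM y hy.1).mono Set.inter_subset_left)

/-- A smooth family of injective linear maps has locally a smooth family of left inverses. -/
theorem exists_smooth_leftInverse (hD : IsOpen D) {E : ℝ × ℝ → V →L[ℝ] Z}
    (hE : ContDiffOn ℝ ∞ E D) {x : ℝ × ℝ} (hx : x ∈ D) (h : Function.Injective (E x)) :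
    ∃ U, IsOpen U ∧ x ∈ U ∧ U ⊆ D ∧ ∃ G : ℝ × ℝ → Z →L[ℝ] V, ContDiffOn ℝ ∞ G U ∧
      ∀ y ∈ U, ∀ v, G y (E y v) = v := by
  obtain ⟨Λ, hΛ⟩ := (E x).toLinearMap.exists_leftInverse_of_injective (LinearMap.ker_eq_bot.2 h)
  obtain ⟨U, hU, hxU, hUD, N, hN, hNM⟩ := exists_smooth_inverse hD
    (M := fun y => Λ.toContinuousLinearMap.comp (E y)) (contDiffOn_const.clm_comp hE) hx
    (by ext v; exact LinearMap.congr_fun hΛ v)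
  refine ⟨U, hU, hxU, hUD, fun y => (N y).comp Λ.toContinuousLinearMap,
    hN.clm_comp contDiffOn_const, fun y hy v => ?_⟩
  exact congrArg (fun A : V →L[ℝ] V => A v) (hNM y hy).2

/-- The kernels of a smooth family of linear maps of constant rank form a vector bundle. -/
theorem isVectorSubbundle_of_ker (hD : IsOpen D) {C : ℝ × ℝ → V →L[ℝ] Z}
    (hC : ContDiffOn ℝ ∞ C D) {A : D → Submodule ℝ V} (hA : ∀ x j, j ∈ A x ↔ C x j = 0) {r : ℕ}
    (hr : ∀ x, Module.finrank ℝ (A x) = r) : IsVectorSubbundle D A r := by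
  intro x
  have hAk : ∀ y : D, A y = LinearMap.ker (C y).toLinearMap := fun y => by
    ext j; exact hA y j
  -- Compressed to the range of `C x`, the family is surjective at `x` with right inverse `S`, so `Q
  -- C S` is the identity at `x` and invertible nearby.
  let R := LinearMap.range (C x).toLinearMap
  obtain ⟨Q, hQ⟩ := R.subtype.exists_leftInverse_of_injective R.ker_subtype
  obtain ⟨S, hS⟩ := (C x).toLinearMap.rangeRestrict.exists_rightInverse_of_surjective
    (LinearMap.range_rangeRestrict _)
  let Qc : Z →L[ℝ] R := Q.toContinuousLinearMap
  let Sc : R →L[ℝ] V := S.toContinuousLinearMap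
  have hQC : ContDiffOn ℝ ∞ (fun y => Qc.comp (C y)) D := contDiffOn_const.clm_comp hC
  obtain ⟨U, hU, hxU, hUD, N, hN, hNM⟩ := exists_smooth_inverse hD
    (M := fun y => (Qc.comp (C y)).comp Sc) (hQC.clm_comp contDiffOn_const) x.2 (by
      refine ContinuousLinearMap.ext fun v => ?_
      have h1 : C x (S v) = v := congrArg Subtype.val (LinearMap.congr_fun hS v)
      change Q (C x (S v)) = v
      rw [h1]
      exact LinearMap.congr_fun hQ v)
  -- Constant rank enters here: `A y` lies in the kernel of the compressed map, and the dimensions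
  -- agree.
  have hker : ∀ y (hy : y ∈ U), LinearMap.ker (Qc.comp (C y)).toLinearMap = A ⟨y, hUD hy⟩ := by
    intro y hy
    symm
    refine Submodule.eq_of_le_of_finrank_eq (fun j hj => ?_) ?_
    · have := (hA ⟨y, hUD hy⟩ j).1 hj
      change Qc (C y j) = 0
      rw [this, map_zero]
    · have hsurj : LinearMap.range (Qc.comp (C y)).toLinearMap = ⊤ :=
        LinearMap.range_eq_top.2 fun v => ⟨Sc (N y v),
          congrArg (fun T : R →L[ℝ] R => T v) (hNM y hy).1⟩
      have h1 := (Qc.comp (C y)).toLinearMap.finrank_range_add_finrank_ker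
      rw [hsurj, finrank_top] at h1
      have h2 := (C x).toLinearMap.finrank_range_add_finrank_ker
      have h3 := hr x
      rw [hAk x] at h3
      rw [hr]
      change Module.finrank ℝ R + _ = _ at h2
      omega
  let b := Module.finBasisOfFinrankEq ℝ (A x) (hr x)
  -- The basis of `A x`, projected to the nearby kernels along the image of `S`.
  let e : Fin r → ℝ × ℝ → V := fun i y => b i - Sc (N y (Qc (C y (b i))))
  have he : ∀ i, ContDiffOn ℝ ∞ (e i) U := fun i => contDiffOn_const.sub
    (Sc.contDiff.comp_contDiffOn (hN.clm_apply ((hQC.mono hUD).clm_apply contDiffOn_const)))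
  have hex : ∀ i, e i x = b i := fun i => by
    have : C x (b i) = 0 := (hA x _).1 (b i).2
    simp [e, this]
  have hli : LinearIndependent ℝ fun i => e i x := by
    simp only [hex]
    exact b.linearIndependent.map' (A x).subtype (A x).ker_subtype
  have hopen : IsOpen (U ∩ (fun y i => e i y) ⁻¹' {f | LinearIndependent ℝ f}) :=
    (continuousOn_pi.2 fun i => (he i).continuousOn).isOpen_inter_preimage hU
      isOpen_setOfPred_linearIndependent
  refine ⟨_, hopen, ⟨hxU, hli⟩, e, fun i => (he i).mono fun y hy => hy.1.1, fun y hy => ⟨hy.2, ?_⟩⟩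
  refine Submodule.eq_of_le_of_finrank_eq ?_ ?_
  · rw [Submodule.span_le]
    rintro _ ⟨i, rfl⟩
    rw [SetLike.mem_coe, ← hker y hy.1]
    change Qc (C y (b i - Sc (N y (Qc (C y (b i)))))) = 0
    have := congrArg (fun T : R →L[ℝ] R => T (Qc (C y (b i)))) (hNM y hy.1).1
    change Qc (C y (Sc (N y (Qc (C y (b i)))))) = Qc (C y (b i)) at this
    rw [map_sub, map_sub, this, sub_self]
  · rw [hr, finrank_span_eq_card hy.2, Fintype.card_fin]

end Subbundles

namespace PlanarWeb

variable {d k : ℕ} {D : Set (ℝ × ℝ)} (W : PlanarWeb d D)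

theorem isVectorSubbundle_prolongation (hk : k ≤ d - 2) :
    IsVectorSubbundle D (W.prolongation k) (∑ j ∈ Finset.range (k + 1), (d - 2 - j)) := by
  obtain ⟨C, hC, h⟩ := W.exists_prolongation_eq_ker k
  exact isVectorSubbundle_of_ker W.isOpen hC h (W.finrank_prolongation hk)

theorem sum_rank (hk : k + 3 = d) :
    ∑ j ∈ Finset.range (k + 1), (d - 2 - j) = (d - 1) * (d - 2) / 2 := by
  subst hk
  have h1 : ∑ j ∈ Finset.range (k + 1), (k + 3 - 2 - j) = ∑ j ∈ Finset.range (k + 1 + 1), j := by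
    rw [← Finset.sum_range_reflect (fun j => j), Finset.sum_range_succ _ (k + 1)]
    simp
  rw [h1, Finset.sum_range_id]
  rfl

theorem sum_rank_succ (hk : k + 3 = d) :
    ∑ j ∈ Finset.range (k + 1 + 1), (d - 2 - j) = (d - 1) * (d - 2) / 2 := by
  rw [Finset.sum_range_succ, sum_rank hk]
  omega

/-- With `k + 1 = d - 2` the kernel has dimension `d - (d - 2) - 2 = 0`, and lifting is still
unobstructed. Throughout, `k + 3 = d` replaces the truncated subtraction `d - 3`. -/
theorem bijOn_jetProj (hk : k + 3 = d) (x : D) :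
    Set.BijOn (jetProj d k.le_succ) (W.prolongation (k + 1) x) (W.prolongation k x) := by
  refine ⟨fun j hj => W.jetProj_mem_prolongation _ hj, fun j hj j' hj' h => ?_, fun s hs => ?_⟩
  · have h0 := W.finrank_prolongation_inf_ker (k := k) (by omega) x
    rw [show d - (k + 1) - 2 = 0 by omega, Submodule.finrank_eq_zero] at h0
    have : j - j' ∈ W.prolongation (k + 1) x ⊓ LinearMap.ker (jetProj d k.le_succ) :=
      ⟨sub_mem hj hj', by simp [h]⟩
    rw [h0, Submodule.mem_bot] at this
    exact sub_eq_zero.1 this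
  · rw [SetLike.mem_coe, ← W.map_jetProj_prolongation (k := k) (by omega) x] at hs
    exact hs

/-- The local data which describe the last non-trivial prolongations: a frame `E` of `𝔄_{d-2}`
and a left inverse `G` of the corresponding frame of `𝔄_{d-3}`. -/
theorem exists_frame (hk : k + 3 = d) (x : D) :
    ∃ U, IsOpen U ∧ (x : ℝ × ℝ) ∈ U ∧ ∃ hUD : U ⊆ D,
      ∃ E : ℝ × ℝ → (Fin ((d - 1) * (d - 2) / 2) → ℝ) →L[ℝ] JetFibre d (k + 1),
      ∃ G : ℝ × ℝ → JetFibre d k →L[ℝ] (Fin ((d - 1) * (d - 2) / 2) → ℝ),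
        ContDiffOn ℝ ∞ E U ∧ ContDiffOn ℝ ∞ G U ∧
        (∀ y (hy : y ∈ U) c, E y c ∈ W.prolongation (k + 1) ⟨y, hUD hy⟩) ∧
        (∀ y (hy : y ∈ U), ∀ j ∈ W.prolongation (k + 1) ⟨y, hUD hy⟩, ∃ c, E y c = j) ∧
        ∀ y ∈ U, ∀ c, G y (jetProj d k.le_succ (E y c)) = c := by
  have hb := W.isVectorSubbundle_prolongation (k := k + 1) (by omega)
  rw [sum_rank_succ hk] at hb
  obtain ⟨U, hU, hxU, e, he, hf⟩ := hb x
  let E : ℝ × ℝ → (Fin ((d - 1) * (d - 2) / 2) → ℝ) →L[ℝ] JetFibre d (k + 1) := fun y =>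
    ∑ i, (ContinuousLinearMap.proj (R := ℝ) (φ := fun _ => ℝ) i).smulRight (e i y)
  have hEa : ∀ y c, E y c = ∑ i, c i • e i y := fun y c => by simp [E]
  have hE : ContDiffOn ℝ ∞ E (U ∩ D) := by
    refine ContDiffOn.sum fun i _ => ?_
    exact ((ContinuousLinearMap.smulRightL ℝ (Fin ((d - 1) * (d - 2) / 2) → ℝ)
      (JetFibre d (k + 1)) (ContinuousLinearMap.proj i)).contDiff).comp_contDiffOn (he i)
  have hmem : ∀ y (hy : y ∈ U ∩ D) c, E y c ∈ W.prolongation (k + 1) ⟨y, hy.2⟩ := by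
    intro y hy c
    rw [hEa, ← (hf ⟨y, hy.2⟩ hy.1).2]
    exact Submodule.sum_mem _ fun i _ => Submodule.smul_mem _ _ (Submodule.subset_span ⟨i, rfl⟩)
  have hinj : Function.Injective
      ((jetProj d k.le_succ).toContinuousLinearMap.comp (E x)) := by
    intro c c' h
    have h1 : E x c = E x c' := (W.bijOn_jetProj hk x).2.1 (hmem x ⟨hxU, x.2⟩ c)
      (hmem x ⟨hxU, x.2⟩ c') h
    rw [hEa, hEa] at h1
    have h2 := (Fintype.linearIndependent_iff.1 (hf x hxU).1) (fun i => c i - c' i) (by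
      simp only [sub_smul, Finset.sum_sub_distrib, h1, sub_self])
    exact funext fun i => sub_eq_zero.1 (h2 i)
  obtain ⟨U', hU', hxU', hUU', G, hG, hGE⟩ := exists_smooth_leftInverse (hU.inter W.isOpen)
    (E := fun y => (jetProj d k.le_succ).toContinuousLinearMap.comp (E y))
    (contDiffOn_const.clm_comp hE) ⟨hxU, x.2⟩ hinj
  refine ⟨U', hU', hxU', hUU'.trans Set.inter_subset_right, E, G, hE.mono hUU', hG,
    fun y hy c => hmem y (hUU' hy) c, fun y hy j hj => ?_, hGE⟩
  rw [← (hf ⟨y, (hUU' hy).2⟩ (hUU' hy).1).2] at hj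
  obtain ⟨c, hc⟩ := (Submodule.mem_span_range_iff_exists_fun ℝ).1 hj
  exact ⟨c, by rw [hEa, hc]⟩

/-! ## The connection -/

/-- The inverse of the last projection, extended by zero. -/
def liftJet (W : PlanarWeb d D) (k : ℕ) (x : ℝ × ℝ) (s : JetFibre d k) : JetFibre d (k + 1) :=
  open Classical in
  if h : ∃ hx : x ∈ D, ∃ j ∈ W.prolongation (k + 1) ⟨x, hx⟩, jetProj d k.le_succ j = s
  then h.choose_spec.choose else 0

theorem liftJet_eq (hk : k + 3 = d) (x : D) {j : JetFibre d (k + 1)}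
    (hj : j ∈ W.prolongation (k + 1) x) : W.liftJet k x (jetProj d k.le_succ j) = j := by
  have h : ∃ hx : (x : ℝ × ℝ) ∈ D, ∃ j' ∈ W.prolongation (k + 1) ⟨x, hx⟩,
      jetProj d k.le_succ j' = jetProj d k.le_succ j := ⟨x.2, j, hj, rfl⟩
  rw [liftJet, dif_pos h]
  exact (W.bijOn_jetProj hk x).2.1 h.choose_spec.choose_spec.1 hj h.choose_spec.choose_spec.2

theorem liftJet_mem (hk : k + 3 = d) (x : D) {s : JetFibre d k} (hs : s ∈ W.prolongation k x) :
    W.liftJet k x s ∈ W.prolongation (k + 1) x ∧ jetProj d k.le_succ (W.liftJet k x s) = s := by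
  obtain ⟨j, hj, rfl⟩ := (W.bijOn_jetProj hk x).2.2 hs
  rw [W.liftJet_eq hk x hj]
  exact ⟨hj, rfl⟩

/-- The connection on `𝔄_{d-3}`. -/
def nabla (W : PlanarWeb d D) (k : ℕ) (v : ℝ × ℝ) (s : ℝ × ℝ → JetFibre d k) (x : ℝ × ℝ) :
    JetFibre d k :=
  fderiv ℝ s x v - totalDeriv d le_rfl v (W.liftJet k x (s x))

theorem nabla_eq (hk : k + 3 = d) (v : ℝ × ℝ) {s : ℝ × ℝ → JetFibre d k} (x : D)
    {j : JetFibre d (k + 1)} (hj : j ∈ W.prolongation (k + 1) x)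
    (h : jetProj d k.le_succ j = s x) :
    W.nabla k v s x = fderiv ℝ s x v - totalDeriv d le_rfl v j := by
  rw [nabla, ← h, W.liftJet_eq hk x hj]

/-- `liftJet` is chosen pointwise, but in a local frame it is `s ↦ E (G s)`. -/
theorem contDiffOn_liftJet (hk : k + 3 = d) {s : ℝ × ℝ → JetFibre d k}
    (hs : IsSmoothSection D (W.prolongation k) s) :
    ContDiffOn ℝ ∞ (fun x => W.liftJet k x (s x)) D := by
  intro x hx
  obtain ⟨U, hU, hxU, hUD, E, G, hE, hG, hm, hsurj, hGE⟩ := W.exists_frame hk ⟨x, hx⟩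
  have h1 : ContDiffOn ℝ ∞ (fun y => E y (G y (s y))) U :=
    hE.clm_apply (hG.clm_apply (hs.1.mono hUD))
  have h2 : ∀ y ∈ U, W.liftJet k y (s y) = E y (G y (s y)) := by
    intro y hy
    obtain ⟨h3, h4⟩ := W.liftJet_mem hk ⟨y, hUD hy⟩ (hs.2 ⟨y, hUD hy⟩)
    obtain ⟨c, hc⟩ := hsurj y hy _ h3
    rw [← hc] at h4 ⊢
    conv_rhs => rw [← h4, hGE y hy]
  exact ((h1.congr h2).contDiffAt (hU.mem_nhds hxU)).contDiffWithinAt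

theorem isLinearConnection_nabla (hk : k + 3 = d) :
    IsLinearConnection D (W.prolongation k) (W.nabla k) := by
  have hD := W.isOpen
  have hlift : ∀ {x : D} {s t : JetFibre d k}, s ∈ W.prolongation k x → t ∈ W.prolongation k x →
      ∀ a b : ℝ, W.liftJet k x (a • s + b • t) = a • W.liftJet k x s + b • W.liftJet k x t := by
    intro x s t hs ht a b
    obtain ⟨h1, h2⟩ := W.liftJet_mem hk x hs
    obtain ⟨h3, h4⟩ := W.liftJet_mem hk x ht
    conv_lhs => rw [← h2, ← h4, ← map_smul, ← map_smul, ← map_add]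
    exact W.liftJet_eq hk x (add_mem (Submodule.smul_mem _ _ h1) (Submodule.smul_mem _ _ h3))
  constructor
  · intro v s hs
    refine ⟨?_, fun x => ?_⟩
    · exact (contDiffOn_fderiv_apply hD hs.1 v).sub
        ((totalDeriv d le_rfl v).toContinuousLinearMap.contDiff.comp_contDiffOn
          (W.contDiffOn_liftJet hk hs))
    · obtain ⟨h1, h2⟩ := W.liftJet_mem hk x (hs.2 x)
      exact W.fderiv_sub_totalDeriv_mem le_rfl hs v x h1 h2
  · intro v w s _ x _
    simp only [nabla, map_add]
    rw [totalDeriv_eq _ (v + w), totalDeriv_eq _ v, totalDeriv_eq _ w]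
    simp only [Prod.fst_add, Prod.snd_add, add_smul]
    abel
  · intro c v s _ x _
    simp only [nabla, map_smul]
    rw [totalDeriv_eq _ (c • v), totalDeriv_eq _ v]
    simp only [Prod.smul_fst, Prod.smul_snd, smul_eq_mul, mul_smul, smul_sub, smul_add]
  · intro v s t hs ht x hx
    have h1 := hlift (x := ⟨x, hx⟩) (hs.2 ⟨x, hx⟩) (ht.2 ⟨x, hx⟩) 1 1
    simp only [one_smul] at h1
    have h2 := ((differentiableAt_of_smooth hD hs.1 hx).hasFDerivAt.add
      (differentiableAt_of_smooth hD ht.1 hx).hasFDerivAt).fderiv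
    have h2' : fderiv ℝ (fun y => s y + t y) x = _ := h2
    simp only [nabla, h1, h2', map_add, add_apply]
    abel
  · intro v f s hf hs x hx
    have h1 := hlift (x := ⟨x, hx⟩) (hs.2 ⟨x, hx⟩) (hs.2 ⟨x, hx⟩) (f x) 0
    simp only [zero_smul, add_zero] at h1
    have h2 := ((differentiableAt_of_smooth hD hf hx).hasFDerivAt.smul
      (differentiableAt_of_smooth hD hs.1 hx).hasFDerivAt).fderiv
    have h2' : fderiv ℝ (fun y => f y • s y) x = _ := h2
    simp only [nabla, h1, h2', map_smul, add_apply, smul_apply,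
      ContinuousLinearMap.smulRight_apply, smul_sub]
    abel

end PlanarWeb

end WebGeometry

end

/-! ### Uniqueness of solutions, the rank bound, change of the defining forms -/

open scoped ContDiff

noncomputable section

namespace WebGeometry

/-- Gronwall's inequality along the segment from the centre to `y`. -/
theorem eq_zero_of_norm_fderiv_le {V : Type*} [NormedAddCommGroup V] [NormedSpace ℝ V]
    {F : ℝ × ℝ → V} {x : ℝ × ℝ} {ρ K : ℝ} (hF : ∀ y ∈ Metric.ball x ρ, DifferentiableAt ℝ F y)
    (hK : ∀ y ∈ Metric.ball x ρ, ∀ v, ‖fderiv ℝ F y v‖ ≤ K * ‖v‖ * ‖F y‖) (h0 : F x = 0) :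
    ∀ y ∈ Metric.ball x ρ, F y = 0 := by
  intro y hy
  have hseg : ∀ t ∈ Set.Icc (0 : ℝ) 1, x + t • (y - x) ∈ Metric.ball x ρ := by
    intro t ht
    rw [mem_ball_iff_norm] at hy ⊢
    rw [add_sub_cancel_left, norm_smul, Real.norm_of_nonneg ht.1]
    exact (mul_le_of_le_one_left (norm_nonneg _) ht.2).trans_lt hy
  have hd : ∀ t ∈ Set.Icc (0 : ℝ) 1, HasDerivAt (fun t : ℝ => F (x + t • (y - x)))
      (fderiv ℝ F (x + t • (y - x)) (y - x)) t := by
    intro t ht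
    have h1 : HasDerivAt (fun t : ℝ => x + t • (y - x)) (y - x) t := by
      simpa using ((hasDerivAt_id t).smul_const (y - x)).const_add x
    exact (hF _ (hseg t ht)).hasFDerivAt.comp_hasDerivAt t h1
  have := eq_zero_of_abs_deriv_le_mul_abs_self_of_eq_zero_right (K := K * ‖y - x‖)
    (fun t ht => (hd t ht).continuousAt.continuousWithinAt)
    (fun t ht => (hd t (Set.Ico_subset_Icc_self ht)).hasDerivWithinAt) (by simpa using h0)
    (fun t ht => hK _ (hseg t (Set.Ico_subset_Icc_self ht)) _) 1 (by simp)
  simpa using this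

namespace PlanarWeb

variable {d k : ℕ} {D : Set (ℝ × ℝ)} (W : PlanarWeb d D)

theorem IsSolution.mono {W : PlanarWeb d D} {lam : ℝ × ℝ → Fin d → ℝ} (h : W.IsSolution lam)
    {U : Set (ℝ × ℝ)} (hU : IsOpen U) (hUD : U ⊆ D) : (W.restrict U hU hUD).IsSolution lam :=
  ⟨⟨h.1.1.mono hUD, fun x hx => h.1.2 x (hUD hx)⟩, fun i x hx => h.2 i x (hUD hx)⟩

theorem dForm_congr (i : Fin d) {U : Set (ℝ × ℝ)} (hU : IsOpen U) {f g : ℝ × ℝ → Fin d → ℝ}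
    (h : Set.EqOn f g U) : Set.EqOn (W.dForm i f) (W.dForm i g) U := fun x hx => by
  have : Set.EqOn (fun y => f y i • W.form i y) (fun y => g y i • W.form i y) U := fun y hy => by
    simp only [h hy]
  simp only [dForm, extD, fderiv_congr_on hU this hx]

theorem IsSolution.congr {W : PlanarWeb d D} {f g : ℝ × ℝ → Fin d → ℝ} (hf : W.IsSolution f)
    (h : Set.EqOn g f D) : W.IsSolution g :=
  ⟨⟨hf.1.1.congr h, fun x hx => by rw [h hx]; exact hf.1.2 x hx⟩,
    fun i x hx => by rw [W.dForm_congr i W.isOpen h hx]; exact hf.2 i x hx⟩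

theorem IsSolution.jet_mem {W : PlanarWeb d D} {lam : ℝ × ℝ → Fin d → ℝ} (h : W.IsSolution lam)
    (m : ℕ) (x : D) : jet m x lam ∈ W.prolongation m x :=
  ⟨lam, h.1, fun i p q _ => partialXY_eq_zero W.isOpen p q (h.2 i) x.2, rfl⟩

theorem IsSolution.exists_sol {W : PlanarWeb d D} {lam : ℝ × ℝ → Fin d → ℝ}
    (h : W.IsSolution lam) : ∃ mu ∈ W.Sol, Set.EqOn mu lam D := by
  classical
  have he : Set.EqOn (D.indicator lam) lam D := fun x hx => Set.indicator_of_mem hx lam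
  exact ⟨D.indicator lam, ⟨h.congr he, fun x hx => Set.indicator_of_notMem hx lam⟩, he⟩

theorem exists_norm_totalDeriv_le (d : ℕ) {k l : ℕ} (h : k + 1 ≤ l) :
    ∃ K, 0 ≤ K ∧ ∀ v j, ‖totalDeriv d h v j‖ ≤ K * ‖v‖ * ‖j‖ := by
  let X := (totalDeriv d h (1, 0)).toContinuousLinearMap
  let Y := (totalDeriv d h (0, 1)).toContinuousLinearMap
  refine ⟨‖X‖ + ‖Y‖, by positivity, fun v j => ?_⟩
  rw [totalDeriv_eq]
  have h1 : ‖v.1‖ ≤ ‖v‖ := norm_fst_le v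
  have h2 : ‖v.2‖ ≤ ‖v‖ := norm_snd_le v
  calc ‖v.1 • X j + v.2 • Y j‖ ≤ ‖v.1‖ * (‖X‖ * ‖j‖) + ‖v.2‖ * (‖Y‖ * ‖j‖) := by
        refine (norm_add_le _ _).trans ?_
        rw [norm_smul, norm_smul]
        gcongr
        · exact X.le_opNorm j
        · exact Y.le_opNorm j
    _ ≤ ‖v‖ * (‖X‖ * ‖j‖) + ‖v‖ * (‖Y‖ * ‖j‖) := by gcongr
    _ = (‖X‖ + ‖Y‖) * ‖v‖ * ‖j‖ := by ring

/-- A solution is determined near a point by its jet of order `d - 3` there. -/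
theorem IsSolution.eventually_jet_eq_zero (hk : k + 3 = d) {W : PlanarWeb d D}
    {lam : ℝ × ℝ → Fin d → ℝ} (h : W.IsSolution lam) {x : ℝ × ℝ} (hx : x ∈ D)
    (h0 : jet k x lam = 0) : ∀ᶠ y in nhds x, jet k y lam = 0 := by
  obtain ⟨U, hU, hxU, hUD, E, G, hE, hG, hm, hsurj, hGE⟩ := W.exists_frame hk ⟨x, hx⟩
  obtain ⟨K, hK0, hK⟩ := exists_norm_totalDeriv_le d (le_refl (k + 1))
  have hc : ContinuousAt (fun y => ‖E y‖ * ‖G y‖) x :=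
    (((hE.continuousOn.continuousAt (hU.mem_nhds hxU)).norm).mul
      ((hG.continuousOn.continuousAt (hU.mem_nhds hxU)).norm))
  obtain ⟨ρ, hρ, hball⟩ := Metric.eventually_nhds_iff_ball.1
    ((hc.eventually (gt_mem_nhds (lt_add_one _))).and (hU.mem_nhds hxU))
  set M := ‖E x‖ * ‖G x‖ + 1
  refine Metric.eventually_nhds_iff_ball.2 ⟨ρ, hρ, ?_⟩
  refine eq_zero_of_norm_fderiv_le (K := K * M) (fun y hy => ?_) (fun y hy v => ?_) h0
  · exact differentiableAt_of_smooth W.isOpen (contDiffOn_jet W.isOpen k h.1.1)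
      (hUD (hball y hy).2)
  · have hyU := (hball y hy).2
    obtain ⟨c, hc'⟩ := hsurj y hyU _ (h.jet_mem (k + 1) ⟨y, hUD hyU⟩)
    have hGc := hGE y hyU c
    rw [hc', jetProj_jet] at hGc
    -- The `(d-2)`-jet of a solution is `E (G j)` with `j` its `(d-3)`-jet, so the derivative of `j`
    -- is bounded linearly by `j` itself.
    rw [fderiv_jet W.isOpen le_rfl h.1.1 (hUD hyU), ← hc', ← hGc]
    have hM := (hball y hy).1.le
    calc ‖totalDeriv d (le_refl (k + 1)) v (E y (G y (jet k y lam)))‖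
        ≤ K * ‖v‖ * (‖E y‖ * (‖G y‖ * ‖jet k y lam‖)) := by
          refine (hK _ _).trans ?_
          gcongr
          refine ((E y).le_opNorm _).trans ?_
          gcongr
          exact (G y).le_opNorm _
      _ = K * ‖v‖ * ((‖E y‖ * ‖G y‖) * ‖jet k y lam‖) := by ring
      _ ≤ K * ‖v‖ * (M * ‖jet k y lam‖) := by gcongr
      _ = K * M * ‖v‖ * ‖jet k y lam‖ := by ring

/-- The zero set of the `(d-3)`-jet is open by `eventually_jet_eq_zero` and relatively closed by
continuity. -/
theorem IsSolution.eq_zero (hk : k + 3 = d) {W : PlanarWeb d D} (hD : IsPreconnected D)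
    {lam : ℝ × ℝ → Fin d → ℝ} (h : W.IsSolution lam) {x : ℝ × ℝ} (hx : x ∈ D)
    (h0 : jet k x lam = 0) : ∀ y ∈ D, lam y = 0 := by
  have hcont := (contDiffOn_jet W.isOpen k h.1.1).continuousOn
  let u : Set (ℝ × ℝ) := {y | y ∈ D ∧ jet k y lam = 0}
  have hu : IsOpen u := isOpen_iff_mem_nhds.2 fun y hy =>
    Filter.inter_mem (W.isOpen.mem_nhds hy.1) (h.eventually_jet_eq_zero hk hy.1 hy.2)
  have hsub := hD.subset_of_closure_inter_subset hu ⟨x, hx, hx, h0⟩ (by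
    rintro y ⟨hy, hyD⟩
    refine ⟨hyD, ?_⟩
    have hca := hcont.continuousAt (W.isOpen.mem_nhds hyD)
    exact (isClosed_singleton (x := (0 : JetFibre d k))).mem_of_frequently_of_tendsto
      ((mem_closure_iff_frequently.1 hy).mono fun z hz => hz.2) hca)
  intro y hy
  have := congrFun (hsub hy).2 ⟨(0, 0), by simp⟩
  exact this

/-- The jet at a point, as a linear map on the space of solutions. -/
def jetMap (k : ℕ) (x : D) : W.Sol →ₗ[ℝ] W.prolongation k x where
  toFun lam := ⟨jet k x lam, lam.2.1.jet_mem k x⟩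
  map_add' f g := by
    have := jet_comb (k := k) W.isOpen 1 1 f.2.1.1.1 g.2.1.1.1 x.2
    simp only [one_smul] at this
    exact Subtype.ext this
  map_smul' c f := by
    have := jet_comb (k := k) W.isOpen c 0 f.2.1.1.1 f.2.1.1.1 x.2
    simp only [zero_smul, add_zero] at this
    exact Subtype.ext this

theorem jetMap_injective (hk : k + 3 = d) (hD : IsPreconnected D) (x : D) :
    Function.Injective (W.jetMap k x) := by
  rw [← LinearMap.ker_eq_bot, LinearMap.ker_eq_bot']
  intro f hf
  refine Subtype.ext (funext fun y => ?_)
  by_cases hy : y ∈ D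
  · exact f.2.1.eq_zero hk hD x.2 (congrArg Subtype.val hf) y hy
  · exact f.2.2 y hy

theorem finiteDimensional_sol (hk : k + 3 = d) (hD : IsPreconnected D) (x : D) :
    FiniteDimensional ℝ W.Sol :=
  Module.Finite.of_injective _ (W.jetMap_injective hk hD x)

theorem finrank_top_prolongation (hk : k + 3 = d) (x : D) :
    Module.finrank ℝ (W.prolongation k x) = (d - 1) * (d - 2) / 2 := by
  rw [W.finrank_prolongation (by omega), sum_rank hk]

theorem rank_le (hk : k + 3 = d) (hD : IsPreconnected D) (x : D) :
    W.rank ≤ (d - 1) * (d - 2) / 2 := by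
  rw [← W.finrank_top_prolongation hk x]
  exact LinearMap.finrank_le_finrank_of_injective (W.jetMap_injective hk hD x)

/-- `jetMap` is injective into a space of the maximal dimension. Since the left-hand side does not
mention `x`, realizability of all jets passes from one point to every other. -/
theorem rank_eq_iff (hk : k + 3 = d) (hD : IsPreconnected D) (x : D) :
    W.rank = (d - 1) * (d - 2) / 2 ↔
      ∀ j ∈ W.prolongation k x, ∃ lam, W.IsSolution lam ∧ jet k x lam = j := by
  have := W.finiteDimensional_sol hk hD x
  have hinj := W.jetMap_injective hk hD x
  rw [← W.finrank_top_prolongation hk x]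
  constructor
  · intro h j hj
    obtain ⟨f, hf⟩ := (LinearMap.injective_iff_surjective_of_finrank_eq_finrank h).1 hinj ⟨j, hj⟩
    exact ⟨f, f.2.1, congrArg Subtype.val hf⟩
  · intro h
    refine LinearEquiv.finrank_eq (LinearEquiv.ofBijective (W.jetMap k x) ⟨hinj, ?_⟩)
    rintro ⟨j, hj⟩
    obtain ⟨lam, hlam, rfl⟩ := h j hj
    obtain ⟨mu, hmu, he⟩ := hlam.exists_sol
    exact ⟨⟨mu, hmu⟩, Subtype.ext (jet_congr W.isOpen he x.2)⟩

/-! ## Changing the forms defining the foliations -/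

theorem SameFoliations.exists_smul {N W : PlanarWeb d D} (h : N.SameFoliations W) :
    ∃ c : Fin d → ℝ × ℝ → ℝ, (∀ i, ContDiffOn ℝ ∞ (c i) D) ∧ (∀ i, ∀ x ∈ D, c i x ≠ 0) ∧
      ∀ i, ∀ x ∈ D, N.form i x = c i x • W.form i x := by
  -- Euclidean projection quotient of two proportional covectors: smooth, whichever coordinate of
  -- the form is nonzero.
  let c : Fin d → ℝ × ℝ → ℝ := fun i x =>
    (N.formX i x * W.formX i x + N.formY i x * W.formY i x) *
      (W.formX i x * W.formX i x + W.formY i x * W.formY i x)⁻¹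
  have hpos : ∀ i, ∀ x ∈ D, W.formX i x * W.formX i x + W.formY i x * W.formY i x ≠ 0 := by
    intro i x hx h0
    rcases W.form_ne_zero i hx with h | h
    · have := mul_self_pos.2 h; nlinarith [mul_self_nonneg (W.formY i x)]
    · have := mul_self_pos.2 h; nlinarith [mul_self_nonneg (W.formX i x)]
  have hc : ∀ i, ∀ x ∈ D, N.form i x = c i x • W.form i x := by
    intro i x hx
    have h1 : N.form i x (W.formY i x, -W.formX i x) = 0 := (h i x hx _).2 (by
      rw [form_apply]; ring)
    rw [form_apply] at h1
    simp only at h1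
    have h2 : (W.formX i x * W.formX i x + W.formY i x * W.formY i x) *
      (W.formX i x * W.formX i x + W.formY i x * W.formY i x)⁻¹ = 1 :=
      mul_inv_cancel₀ (hpos i x hx)
    rw [← sub_eq_zero, form_eq_zero_iff]
    constructor
    · change N.formX i x - c i x * W.formX i x = 0
      simp only [c]
      linear_combination (-N.formX i x) * h2 +
        (W.formX i x * W.formX i x + W.formY i x * W.formY i x)⁻¹ * W.formY i x * h1
    · change N.formY i x - c i x * W.formY i x = 0
      simp only [c]
      linear_combination (-N.formY i x) * h2 -
        (W.formX i x * W.formX i x + W.formY i x * W.formY i x)⁻¹ * W.formX i x * h1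
  refine ⟨c, fun i => ?_, fun i x hx h0 => ?_, hc⟩
  · exact (((N.contDiffOn_formX i).mul (W.contDiffOn_formX i)).add
      ((N.contDiffOn_formY i).mul (W.contDiffOn_formY i))).mul
      ((((W.contDiffOn_formX i).mul (W.contDiffOn_formX i)).add
      ((W.contDiffOn_formY i).mul (W.contDiffOn_formY i))).inv (hpos i))
  · have h1 := hc i x hx
    rw [h0, zero_smul, form_eq_zero_iff] at h1
    rcases N.form_ne_zero i hx with h | h
    exacts [h h1.1, h h1.2]

theorem SameFoliations.symm {N W : PlanarWeb d D} (h : N.SameFoliations W) : W.SameFoliations N :=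
  fun i x hx v => (h i x hx v).symm

/-- The map `λ_i ↦ c_i λ_i` keeps the products `λ_i ω_i`, in which alone the abelian equation is
stated. -/
theorem SameFoliations.rank_le {N W : PlanarWeb d D} (h : N.SameFoliations W) (hk : k + 3 = d)
    (hD : IsConnected D) : N.rank ≤ W.rank := by
  obtain ⟨⟨x₀, hx₀⟩, hD⟩ := hD
  have := W.finiteDimensional_sol hk hD ⟨x₀, hx₀⟩
  obtain ⟨c, hc, hc0, hcf⟩ := h.exists_smul
  have hsol : ∀ f ∈ N.Sol, (fun x i => c i x * f x i) ∈ W.Sol := by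
    rintro f ⟨hf, hf0⟩
    have e : ∀ i, ∀ x ∈ D, (c i x * f x i) • W.form i x = f x i • N.form i x := fun i x hx => by
      rw [hcf i x hx, smul_smul, mul_comm]
    refine ⟨⟨⟨contDiffOn_pi.2 fun i => (hc i).mul (contDiffOn_pi.1 hf.1.1 i), fun x hx => ?_⟩,
      fun i x hx => ?_⟩, fun x hx => ?_⟩
    · rw [Finset.sum_congr rfl fun i _ => e i x hx]
      exact hf.1.2 x hx
    · have h2 := hf.2 i x hx
      simp only [dForm, extD] at h2 ⊢
      rwa [fderiv_congr_on W.isOpen (e i) hx]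
    · funext i
      simp [hf0 x hx]
  let T : N.Sol →ₗ[ℝ] W.Sol :=
    { toFun f := ⟨fun x i => c i x * f.1 x i, hsol f.1 f.2⟩
      map_add' f g := Subtype.ext (by funext x i; simp [mul_add])
      map_smul' a f := Subtype.ext (by funext x i; simp [mul_left_comm]) }
  refine LinearMap.finrank_le_finrank_of_injective (f := T) fun f g hfg => Subtype.ext ?_
  funext x i
  by_cases hx : x ∈ D
  · have : c i x * f.1 x i = c i x * g.1 x i :=
      congrFun (congrFun (congrArg Subtype.val hfg) x) i
    exact mul_left_cancel₀ (hc0 i x hx) this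
  · rw [f.2.2 x hx, g.2.2 x hx]

theorem SameFoliations.rank_eq {N W : PlanarWeb d D} (h : N.SameFoliations W) (hk : k + 3 = d)
    (hD : IsConnected D) : N.rank = W.rank :=
  le_antisymm (h.rank_le hk hD) (h.symm.rank_le hk hD)

theorem SameFoliations.restrict {N W : PlanarWeb d D} (h : N.SameFoliations W) (U : Set (ℝ × ℝ))
    (hU : IsOpen U) (hUD : U ⊆ D) :
    (N.restrict U hU hUD).SameFoliations (W.restrict U hU hUD) :=
  fun i x hx => h i x (hUD hx)

/-- The web given by multiples of the forms of `W`. -/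
def rescale (W : PlanarWeb d D) (c : Fin d → ℝ × ℝ → ℝ) (hc : ∀ i, ContDiffOn ℝ ∞ (c i) D)
    (hc0 : ∀ i, ∀ x ∈ D, c i x ≠ 0) : PlanarWeb d D where
  three_le := W.three_le
  isOpen := W.isOpen
  form i x := c i x • W.form i x
  smooth i := (hc i).smul (W.smooth i)
  transversal i j hij x hx := by
    rw [LinearIndependent.pair_iff]
    intro s t hst
    rw [smul_smul, smul_smul] at hst
    have := LinearIndependent.pair_iff.1 (W.transversal i j hij x hx) _ _ hst
    exact ⟨(mul_eq_zero.1 this.1).resolve_right (hc0 i x hx),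
      (mul_eq_zero.1 this.2).resolve_right (hc0 j x hx)⟩

theorem sameFoliations_rescale (c : Fin d → ℝ × ℝ → ℝ) (hc : ∀ i, ContDiffOn ℝ ∞ (c i) D)
    (hc0 : ∀ i, ∀ x ∈ D, c i x ≠ 0) : (W.rescale c hc hc0).SameFoliations W := by
  intro i x hx v
  simp [rescale, hc0 i x hx]

/-- Vanishing of `ω_1 ∧ (ω_2 + ω_{i+2})` makes the second factor a multiple of `ω_1`; evaluating on
`∂_1` shows that the multiple is `-a_i`. -/
theorem isNormalized_of (h : ∀ x ∈ D, (∀ i : Fin (d - 2),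
      W.form₁ x (1, 0) * (W.form₂ x (0, 1) + W.form (shift i) x (0, 1)) =
        W.form₁ x (0, 1) * (W.form₂ x (1, 0) + W.form (shift i) x (1, 0))) ∧
      W.form₁ x + W.form₂ x +
        W.form (shift ⟨0, by have := W.three_le; omega⟩) x = 0) : W.IsNormalized := by
  intro x hx
  have hne : W.form₁ x (1, 0) * W.form₂ x (0, 1) - W.form₁ x (0, 1) * W.form₂ x (1, 0) ≠ 0 :=
    W.det_ne_zero (by simp) hx
  have hb : ∀ i : Fin (d - 2), W.basicInvariant i x *
      (W.form₁ x (1, 0) * W.form₂ x (0, 1) - W.form₁ x (0, 1) * W.form₂ x (1, 0)) =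
      -(W.form (shift i) x (1, 0) * W.form₂ x (0, 1) -
        W.form (shift i) x (0, 1) * W.form₂ x (1, 0)) := by
    intro i
    rw [basicInvariant, form_apply, frame]
    simp only [Matrix.cons_val_zero, Prod.smul_mk, smul_eq_mul, formX, formY]
    field_simp
    ring
  have key : ∀ i : Fin (d - 2),
      W.basicInvariant i x • W.form₁ x + W.form₂ x + W.form (shift i) x = 0 := by
    intro i
    have h1 := (h x hx).1 i
    have h2 := hb i
    rw [form_eq_zero_iff]
    constructor
    · refine (mul_eq_zero.1 ?_).resolve_right hne
      simp only [add_apply, smul_apply, smul_eq_mul]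
      linear_combination W.form₁ x (1, 0) * h2 + W.form₂ x (1, 0) * h1
    · refine (mul_eq_zero.1 ?_).resolve_right hne
      simp only [add_apply, smul_apply, smul_eq_mul]
      linear_combination W.form₁ x (0, 1) * h2 + W.form₂ x (0, 1) * h1
  refine ⟨key, ?_⟩
  have h1 := key ⟨0, by have := W.three_le; omega⟩
  have h2 := (h x hx).2
  have h3 : (W.basicInvariant ⟨0, by have := W.three_le; omega⟩ x - 1) • W.form₁ x = 0 := by
    refine ContinuousLinearMap.ext fun v => ?_
    have := congrArg (fun T : ℝ × ℝ →L[ℝ] ℝ => T v) (h1.trans h2.symm)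
    simp only [add_apply, smul_apply, smul_eq_mul] at this
    change (_ - 1) * W.form₁ x v = 0
    linarith
  rcases smul_eq_zero.1 h3 with h3 | h3
  · linarith
  · rw [h3] at hne
    simp at hne

theorem exists_isNormalized : ∃ N : PlanarWeb d D, N.IsNormalized ∧ N.SameFoliations W := by
  have h3 := W.three_le
  let a : Fin d := ⟨0, by omega⟩
  let b : Fin d := ⟨1, by omega⟩
  let e : Fin d := ⟨2, by omega⟩
  have hab : a ≠ b := by simp [a, b]
  have hae : a ≠ e := by simp [a, e]
  have hbe : b ≠ e := by simp [b, e]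
  let w : Fin d → Fin d → ℝ × ℝ → ℝ := fun i j x =>
    W.formX i x * W.formY j x - W.formY i x * W.formX j x
  have hw : ∀ i j, ContDiffOn ℝ ∞ (w i j) D := fun i j =>
    ((W.contDiffOn_formX i).mul (W.contDiffOn_formY j)).sub
      ((W.contDiffOn_formY i).mul (W.contDiffOn_formX j))
  have hw0 : ∀ {i j}, i ≠ j → ∀ x ∈ D, w i j x ≠ 0 := fun hij x hx => W.det_ne_zero hij hx
  -- The first three factors come from the identity `w_be ω_a + w_ea ω_b + w_ab ω_e = 0` for three
  -- covectors in the plane. For the other indices the factor is chosen so that `ω_a ∧ (c_b ω_b +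
  -- c_i ω_i) = 0`; at `i = e` it agrees with `w_ab`.
  let c : Fin d → ℝ × ℝ → ℝ := fun i x =>
    if i = a then w b e x else if i = b then w e a x else w a e x * w a b x * (w a i x)⁻¹
  have hc : ∀ i, ContDiffOn ℝ ∞ (c i) D := by
    intro i
    by_cases hi : i = a
    · simpa only [c, hi, if_true] using hw b e
    · by_cases hi' : i = b
      · simpa only [c, hi', hab.symm, if_true, if_false] using hw e a
      · simp only [c, hi, hi', if_false]
        exact ((hw a e).mul (hw a b)).mul ((hw a i).inv fun x hx => hw0 (Ne.symm hi) x hx)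
  have hc0 : ∀ i, ∀ x ∈ D, c i x ≠ 0 := by
    intro i x hx
    by_cases hi : i = a
    · simpa only [c, hi, if_true] using hw0 hbe x hx
    · by_cases hi' : i = b
      · simpa only [c, hi', hab.symm, if_true, if_false] using hw0 hae.symm x hx
      · simp only [c, hi, hi', if_false]
        exact mul_ne_zero (mul_ne_zero (hw0 hae x hx) (hw0 hab x hx))
          (inv_ne_zero (hw0 (Ne.symm hi) x hx))
  refine ⟨W.rescale c hc hc0, isNormalized_of _ fun x hx => ⟨fun i => ?_, ?_⟩,
    W.sameFoliations_rescale c hc hc0⟩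
  · have hia : shift i ≠ a := by simp [shift, a]
    have hib : shift i ≠ b := by simp [shift, b]
    have hci : c (shift i) x = w a e x * w a b x * (w a (shift i) x)⁻¹ := by
      simp only [c, hia, hib, if_false]
    have hca : c a x = w b e x := by simp only [c, if_true]
    have hcb : c b x = w e a x := by simp only [c, hab.symm, if_true, if_false]
    have h1 : w a (shift i) x * (w a (shift i) x)⁻¹ = 1 :=
      mul_inv_cancel₀ (hw0 (Ne.symm hia) x hx)
    change c a x * W.formX a x * (c b x * W.formY b x + c (shift i) x * W.formY (shift i) x) =
      c a x * W.formY a x * (c b x * W.formX b x + c (shift i) x * W.formX (shift i) x)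
    have hwi : W.formX a x * W.formY (shift i) x - W.formY a x * W.formX (shift i) x =
      w a (shift i) x := rfl
    have hwb : W.formX a x * W.formY b x - W.formY a x * W.formX b x = w a b x := rfl
    have hwe : w e a x = -w a e x := by simp only [w]; ring
    rw [hci, hcb, hwe]
    linear_combination (c a x * w a e x * w a b x * (w a (shift i) x)⁻¹) * hwi -
      (c a x * w a e x) * hwb + c a x * w a e x * w a b x * h1
  · have h1 : w a e x * (w a e x)⁻¹ = 1 := mul_inv_cancel₀ (hw0 hae x hx)
    have hca : c a x = w b e x := by simp only [c, if_true]
    have hcb : c b x = w e a x := by simp only [c, hab.symm, if_true, if_false]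
    have hce : c e x = w a b x := by
      simp only [c, hae.symm, hbe.symm, if_false]
      linear_combination w a b x * h1
    change c a x • W.form a x + c b x • W.form b x + c e x • W.form e x = 0
    rw [hca, hcb, hce, form_eq_zero_iff]
    constructor
    · change w b e x * W.formX a x + w e a x * W.formX b x + w a b x * W.formX e x = 0
      simp only [w]; ring
    · change w b e x * W.formY a x + w e a x * W.formY b x + w a b x * W.formY e x = 0
      simp only [w]; ring

end PlanarWeb

end WebGeometry

end

open scoped ContDiff

noncomputable section

namespace WebGeometry

/-! ## The multi-bracket of a bordered diagonal matrix -/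

section Ndet

section ComposeOps

variable {V : Type*}

/-- The composition of the operators `G i`, `i ∈ l`. -/
def composeOps {ι : Type*} (G : ι → V → V) (l : List ι) (φ : V) : V :=
  l.foldr (fun i ψ => G i ψ) φ

@[simp] theorem composeOps_nil {ι : Type*} (G : ι → V → V) (φ : V) : composeOps G [] φ = φ := rfl

@[simp] theorem composeOps_cons {ι : Type*} (G : ι → V → V) (i : ι) (l : List ι) (φ : V) :
    composeOps G (i :: l) φ = G i (composeOps G l φ) := rfl

theorem composeOps_append {ι : Type*} (G : ι → V → V) (l l' : List ι) (φ : V) :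
    composeOps G (l ++ l') φ = composeOps G l (composeOps G l' φ) := by
  simp [composeOps]

theorem composeOps_map {ι κ : Type*} (G : ι → V → V) (h : κ → ι) (l : List κ) (φ : V) :
    composeOps G (l.map h) φ = composeOps (fun i => G (h i)) l φ := by
  simp [composeOps, List.foldr_map]

end ComposeOps

variable {V : Type*} [AddCommGroup V]

theorem ndet_diagonal (n : ℕ) (B : Fin n → V → V) (φ : V) :
    ndet n (fun r c => if r = c then B r else 0) φ = composeOps id (List.ofFn B) φ := by
  induction n with
  | zero => rfl
  | succ n ih =>
    rw [ndet]
    beta_reduce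
    rw [Finset.sum_eq_single 0]
    · have h : (fun r c : Fin n => if (Fin.succAbove 0 r) = c.succ then B (Fin.succAbove 0 r) else 0)
          = fun r c => if r = c then B r.succ else 0 := by
        funext r c
        simp [Fin.succ_inj]
      rw [h, ih fun r => B r.succ, List.ofFn_succ]
      simp
    · intro i _ hi
      simp [hi]
    · simp

/-- The operators are not assumed additive, so preservation of zero is a separate hypothesis. -/
theorem ndet_zero_row (n : ℕ) (A : Fin n → Fin n → V → V) (hA : ∀ i j, A i j 0 = 0) (r : Fin n)
    (hr : ∀ j, A r j = 0) (φ : V) : ndet n A φ = 0 := by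
  induction n with
  | zero => exact r.elim0
  | succ n ih =>
    refine Finset.sum_eq_zero fun i _ => ?_
    by_cases h : i = r
    · simp [h, hr]
    · obtain ⟨s, hs⟩ := Fin.exists_succAbove_eq (Ne.symm h)
      rw [ih _ (fun _ _ => hA _ _) s (fun j => by rw [hs, hr]), hA, smul_zero]

/-- The diagonal matrix of the `B i` with a last row of `b`. -/
def bordered (n : ℕ) (B : Fin n → V → V) (b : V → V) : Fin (n + 1) → Fin n → V → V :=
  Fin.snoc (α := fun _ => Fin n → V → V) (fun r c => if r = c then B r else 0) (fun _ => b)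

theorem bordered_castSucc (n : ℕ) (B : Fin n → V → V) (b : V → V) (r c : Fin n) :
    bordered n B b r.castSucc c = if r = c then B r else 0 := by
  simp [bordered]

theorem bordered_last (n : ℕ) (B : Fin n → V → V) (b : V → V) (c : Fin n) :
    bordered n B b (Fin.last n) c = b := by
  simp [bordered]

theorem bordered_succ (n : ℕ) (B : Fin (n + 1) → V → V) (b : V → V) (r : Fin (n + 1)) (c : Fin n) :
    bordered (n + 1) B b r.succ c.succ = bordered n (fun i => B i.succ) b r c := by
  refine Fin.lastCases ?_ (fun r => ?_) r
  · rw [Fin.succ_last, bordered_last, bordered_last]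
  · rw [← Fin.castSucc_succ, bordered_castSucc, bordered_castSucc]
    simp [Fin.succ_inj]

theorem bordered_apply_zero (n : ℕ) {B : Fin n → V → V} {b : V → V} (hB : ∀ i, B i 0 = 0)
    (hb : b 0 = 0) (r : Fin (n + 1)) (c : Fin n) : bordered n B b r c 0 = 0 := by
  refine Fin.lastCases ?_ (fun r => ?_) r
  · rw [bordered_last, hb]
  · rw [bordered_castSucc]
    split_ifs <;> simp [hB]

theorem ndet_bordered_last (n : ℕ) (B : Fin n → V → V) (b : V → V) (φ : V) :
    ndet n (fun r => bordered n B b ((Fin.last n).succAbove r)) φ =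
      composeOps id (List.ofFn B) φ := by
  rw [← ndet_diagonal]
  congr 1
  funext r c
  rw [Fin.succAbove_last, bordered_castSucc]

/-- Without its `i`-th row the matrix has a single nonvanishing product, with `b` in column `i` and
the diagonal entries elsewhere. The sign counts the rows that `b` has to pass. -/
theorem ndet_bordered_castSucc (n : ℕ) (B : Fin (n + 1) → V → V) (b : V → V)
    (hB : ∀ i, B i 0 = 0) (hb : b 0 = 0) (hneg : ∀ i φ, B i (-φ) = -B i φ) (i : Fin (n + 1)) (φ : V) :
    ndet (n + 1) (fun r => bordered (n + 1) B b (i.castSucc.succAbove r)) φ =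
      (-1 : ℤ) ^ (n - i : ℕ) • composeOps id (List.ofFn (Function.update B i b)) φ := by
  induction n with
  | zero =>
    obtain rfl : i = 0 := Fin.fin_one_eq_zero i
    rw [ndet]
    beta_reduce
    rw [Fin.sum_univ_one]
    have h : bordered 1 B b ((Fin.castSucc (0 : Fin 1)).succAbove 0) 0 = b := bordered_last 1 B b 0
    refine (congrArg (fun g : V → V => (-1 : ℤ) ^ 0 • g (ndet 0 _ φ)) h).trans ?_
    simp [ndet]
  | succ n ih =>
    rw [ndet]
    beta_reduce
    refine Fin.cases ?_ (fun i => ?_) i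
    -- With row `0` deleted, the only entry of column `0` is the `b` of the last row.
    · rw [Finset.sum_eq_single (Fin.last (n + 1))]
      · have h1 : (fun r c : Fin (n + 1) => bordered (n + 2) B b
            ((Fin.castSucc (0 : Fin (n + 2))).succAbove ((Fin.last (n + 1)).succAbove r)) c.succ) =
            fun r c => if r = c then B r.succ else 0 := by
          funext r c
          rw [Fin.castSucc_zero, Fin.succAbove_zero, Fin.succAbove_last, bordered_succ,
            bordered_castSucc]
        have h2 : bordered (n + 2) B b
            ((Fin.castSucc (0 : Fin (n + 2))).succAbove (Fin.last (n + 1))) 0 = b := by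
          rw [Fin.castSucc_zero, Fin.succAbove_zero, Fin.succ_last, bordered_last]
        rw [h1, h2, ndet_diagonal _ fun r => B r.succ, List.ofFn_succ]
        simp
      · intro k _ hk
        obtain ⟨k, rfl⟩ := Fin.exists_castSucc_eq.2 hk
        have : bordered (n + 2) B b
            ((Fin.castSucc (0 : Fin (n + 2))).succAbove k.castSucc) 0 = 0 := by
          rw [Fin.castSucc_zero, Fin.succAbove_zero, ← Fin.castSucc_succ, bordered_castSucc,
            if_neg (Fin.succ_ne_zero k)]
        rw [this]
        simp
      · simp
    -- The minors belonging to the other rows contain the remainder of row `0`, which is zero.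
    · rw [Finset.sum_eq_single 0]
      · have h1 : (fun r c : Fin (n + 1) => bordered (n + 2) B b
            (i.succ.castSucc.succAbove ((0 : Fin (n + 2)).succAbove r)) c.succ) =
            fun r => bordered (n + 1) (fun j => B j.succ) b (i.castSucc.succAbove r) := by
          funext r c
          rw [Fin.succAbove_zero, Fin.castSucc_succ, Fin.succ_succAbove_succ, bordered_succ]
        have h2 : bordered (n + 2) B b (i.succ.castSucc.succAbove 0) 0 = B 0 := by
          rw [Fin.castSucc_succ, Fin.succ_succAbove_zero, ← Fin.castSucc_zero, bordered_castSucc,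
            if_pos rfl]
        have h3 : ∀ (e : ℕ) ψ, B 0 ((-1 : ℤ) ^ e • ψ) = (-1 : ℤ) ^ e • B 0 ψ := by
          intro e ψ
          rcases neg_one_pow_eq_or ℤ e with h | h <;> rw [h] <;> simp [hneg]
        rw [h1, h2, ih (fun j => B j.succ) (fun j => hB _) (fun j => hneg _) i, h3,
          List.ofFn_succ (f := Function.update B i.succ b)]
        have h4 : (fun j : Fin (n + 1) => Function.update B i.succ b j.succ) =
            Function.update (fun j => B j.succ) i b := by
          funext j
          simp only [Function.update_apply, Fin.succ_inj]
        rw [h4, Function.update_of_ne (Fin.succ_ne_zero i).symm]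
        simp
      · intro k _ hk
        rw [ndet_zero_row _ _ (fun _ _ => bordered_apply_zero _ hB hb _ _) 0, bordered_apply_zero _ hB hb,
          smul_zero]
        intro j
        rw [Fin.succAbove_ne_zero_zero hk, Fin.castSucc_succ, Fin.succ_succAbove_zero,
          ← Fin.castSucc_zero, bordered_castSucc, if_neg (Fin.succ_ne_zero j).symm]
      · simp

/-- The multi-bracket of a bordered diagonal matrix. -/
theorem multiBracket_bordered (n : ℕ) (B : Fin n → V → V) (b : V → V)
    (hB : ∀ i, B i 0 = 0) (hb : b 0 = 0) (hneg : ∀ i φ, B i (-φ) = -B i φ) (u : Fin n → V) :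
    multiBracket n (bordered n B b) u = (-1 : ℤ) ^ n • (composeOps id (List.ofFn B) (∑ j, b (u j)) -
      ∑ i, composeOps id (List.ofFn (Function.update B i b)) (B i (u i))) := by
  rw [multiBracket, Fin.sum_univ_castSucc, ndet_bordered_last, add_comm, smul_sub, sub_eq_add_neg]
  congr 1
  · simp [bordered_last]
  · rw [Finset.smul_sum, ← Finset.sum_neg_distrib]
    refine Finset.sum_congr rfl fun i _ => ?_
    rcases n with _ | n
    · exact i.elim0
    rw [ndet_bordered_castSucc n B b hB hb hneg, smul_smul, Fin.val_castSucc, ← pow_add,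
      Nat.add_sub_cancel' (Nat.lt_succ_iff.1 i.2), pow_succ, mul_neg_one, neg_smul, neg_neg,
      Finset.sum_eq_single i]
    · rw [bordered_castSucc, if_pos rfl]
    · intro j _ hj
      rw [bordered_castSucc, if_neg (Ne.symm hj)]
      rfl
    · simp

/-- The two words that act on one unknown in the multi-bracket consist of the same operators, `a`
and `f i` having changed places. -/
theorem ofFn_update_append_perm {ι : Type*} (n : ℕ) (f : Fin n → ι) (i : Fin n) (a : ι) :
    (List.ofFn (Function.update f i a) ++ [f i]).Perm (List.ofFn f ++ [a]) := by
  induction n with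
  | zero => exact i.elim0
  | succ n ih =>
    rw [List.ofFn_succ, List.ofFn_succ]
    refine Fin.cases ?_ (fun i => ?_) i
    · have h : (fun j : Fin n => Function.update f 0 a j.succ) = fun j => f j.succ := by
        funext j; rw [Function.update_of_ne (Fin.succ_ne_zero j)]
      rw [h, Function.update_self]
      refine (List.perm_append_comm).trans ?_
      exact (List.perm_append_comm (l₁ := [a]) (l₂ := List.ofFn fun j => f j.succ)).cons (f 0)
    · have h : (fun j : Fin n => Function.update f i.succ a j.succ) =
          Function.update (fun j => f j.succ) i a := by
        funext j; simp only [Function.update_apply, Fin.succ_inj]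
      rw [h, Function.update_of_ne (Fin.succ_ne_zero i).symm]
      exact (ih (fun j => f j.succ) i).cons _

end Ndet

end WebGeometry

end

open scoped ContDiff

noncomputable section

namespace WebGeometry

open PlanarWeb (Weighted)

/-! ## Compositions of first order operators -/

/-- `G` differentiates along `ξ`, up to terms of order zero, and raises the weight by one. -/
def IsFirstOrder (D : Set (ℝ × ℝ)) (ξ : ℝ × ℝ → ℝ × ℝ) (G : Weighted → Weighted) : Prop :=
  ∃ c : ℕ → ℝ × ℝ → ℝ, (∀ w, ContDiffOn ℝ ∞ (c w) D) ∧
    ∀ U, IsOpen U → U ⊆ D → ∀ (φ : Weighted) w, ContDiffOn ℝ ∞ (φ w) U → ∀ x ∈ U,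
      G φ (w + 1) x = fderiv ℝ (φ w) x (ξ x) + c w x * φ w x

section FirstOrder

variable {d m M w : ℕ} {D : Set (ℝ × ℝ)} {ι : Type*} {G : ι → Weighted → Weighted}
  {ξ : ι → ℝ × ℝ → ℝ × ℝ} {Φ : (ℝ × ℝ → Fin d → ℝ) → Weighted}

theorem IsFirstOrder.contDiffOn {ξ : ℝ × ℝ → ℝ × ℝ} {G : Weighted → Weighted}
    (hG : IsFirstOrder D ξ G) (hξ : ContDiffOn ℝ ∞ ξ D) {U : Set (ℝ × ℝ)} (hU : IsOpen U)
    (hUD : U ⊆ D) {φ : Weighted} (hφ : ContDiffOn ℝ ∞ (φ w) U) :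
    ContDiffOn ℝ ∞ (G φ (w + 1)) U := by
  obtain ⟨c, hc, H⟩ := hG
  exact (((hφ.fderiv_of_isOpen hU (by simp)).clm_apply (hξ.mono hUD)).add
    (((hc w).mono hUD).mul hφ)).congr fun x hx => H U hU hUD φ w hφ x hx

theorem IsFirstOrder.isDiffOp (hD : IsOpen D) {ξ : ℝ × ℝ → ℝ × ℝ} {G : Weighted → Weighted}
    (hG : IsFirstOrder D ξ G) (hξ : ContDiffOn ℝ ∞ ξ D)
    (hΦ : IsDiffOp D m fun f => Φ f w) : IsDiffOp D (m + 1) fun f => G (Φ f) (w + 1) := by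
  obtain ⟨c, hc, H⟩ := hG
  refine ((hΦ.fderiv_apply hD hξ).add ((hΦ.smul (hc w)).mono_order m.le_succ)).congr ?_
  intro U hU hUD f hf x hx
  exact H U hU hUD _ w (hΦ.contDiffOn hU hUD hf) x hx

theorem isDiffOp_composeOps (hD : IsOpen D) (hG : ∀ i, IsFirstOrder D (ξ i) (G i))
    (hξ : ∀ i, ContDiffOn ℝ ∞ (ξ i) D) (hΦ : IsDiffOp D m fun f => Φ f w) (l : List ι) :
    IsDiffOp D (m + l.length) fun f => composeOps G l (Φ f) (w + l.length) := by
  induction l with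
  | nil => exact hΦ
  | cons i l ih => exact (hG i).isDiffOp hD (Φ := fun f => composeOps G l (Φ f)) (hξ i) ih

theorem contDiffOn_composeOps (hG : ∀ i, IsFirstOrder D (ξ i) (G i))
    (hξ : ∀ i, ContDiffOn ℝ ∞ (ξ i) D) {U : Set (ℝ × ℝ)} (hU : IsOpen U) (hUD : U ⊆ D)
    {φ : Weighted} (hφ : ContDiffOn ℝ ∞ (φ w) U) (l : List ι) :
    ContDiffOn ℝ ∞ (composeOps G l φ (w + l.length)) U := by
  induction l with
  | nil => exact hφ
  | cons i l ih => exact (hG i).contDiffOn (hξ i) hU hUD (φ := composeOps G l φ) ih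

/-- `IsFirstOrder` does not assert additivity of `G`; on smooth components it follows from the
formula. -/
theorem IsFirstOrder.sub {ξ : ℝ × ℝ → ℝ × ℝ} {G : Weighted → Weighted}
    (hG : IsFirstOrder D ξ G) : ∃ c : ℝ × ℝ → ℝ, ContDiffOn ℝ ∞ c D ∧
      ∀ U, IsOpen U → U ⊆ D → ∀ φ ψ : Weighted, ContDiffOn ℝ ∞ (φ w) U → ContDiffOn ℝ ∞ (ψ w) U →
        ∀ x ∈ U, G φ (w + 1) x - G ψ (w + 1) x =
          fderiv ℝ (fun y => φ w y - ψ w y) x (ξ x) + c x • (φ w x - ψ w x) := by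
  obtain ⟨c, hc, H⟩ := hG
  refine ⟨c w, hc w, fun U hU hUD φ ψ hφ hψ x hx => ?_⟩
  rw [H U hU hUD φ w hφ x hx, H U hU hUD ψ w hψ x hx, fderiv_fun_sub
    (differentiableAt_of_smooth hU hφ hx) (differentiableAt_of_smooth hU hψ hx)]
  simp
  ring

theorem composeOps_sum (hG : ∀ i, IsFirstOrder D (ξ i) (G i))
    (hξ : ∀ i, ContDiffOn ℝ ∞ (ξ i) D) {U : Set (ℝ × ℝ)} (hU : IsOpen U) (hUD : U ⊆ D)
    {κ : Type*} (s : Finset κ) {φ : κ → Weighted} (hφ : ∀ j, ContDiffOn ℝ ∞ (φ j w) U)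
    (l : List ι) : Set.EqOn (composeOps G l (∑ j ∈ s, φ j) (w + l.length))
      (fun x => ∑ j ∈ s, composeOps G l (φ j) (w + l.length) x) U := by
  induction l with
  | nil => intro x _; simp
  | cons i l ih =>
    intro x hx
    have hs := fun j => contDiffOn_composeOps hG hξ hU hUD (hφ j) l
    have hsum : ContDiffOn ℝ ∞ (composeOps G l (∑ j ∈ s, φ j) (w + l.length)) U :=
      contDiffOn_composeOps hG hξ hU hUD (by
        simpa [Finset.sum_fn] using ContDiffOn.sum fun j _ => hφ j) l
    obtain ⟨c, -, H⟩ := hG i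
    have h1 := H U hU hUD _ _ hsum x hx
    have h2 := fun j => H U hU hUD _ _ (hs j) x hx
    simp only [composeOps_cons, List.length_cons, ← add_assoc]
    rw [h1, fderiv_congr_on hU ih hx, ih hx, fderiv_fun_sum fun j _ =>
      differentiableAt_of_smooth hU (hs j) hx, Finset.sum_congr rfl fun j _ => h2 j,
      Finset.sum_add_distrib, Finset.mul_sum, sum_apply]

/-- The second derivatives cancel by symmetry. -/
theorem IsFirstOrder.commutator (hD : IsOpen D) {ξ η : ℝ × ℝ → ℝ × ℝ} {G H : Weighted → Weighted}
    (hG : IsFirstOrder D ξ G) (hH : IsFirstOrder D η H) (hξ : ContDiffOn ℝ ∞ ξ D)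
    (hη : ContDiffOn ℝ ∞ η D) (hΦ : IsDiffOp D m fun f => Φ f w) :
    IsDiffOp D (m + 1) fun f x => G (H (Φ f)) (w + 2) x - H (G (Φ f)) (w + 2) x := by
  have hGc := fun U hU hUD f (hf : ContDiffOn ℝ ∞ f U) =>
    hG.contDiffOn hξ hU hUD (hΦ.contDiffOn hU hUD hf)
  have hHc := fun U hU hUD f (hf : ContDiffOn ℝ ∞ f U) =>
    hH.contDiffOn hη hU hUD (hΦ.contDiffOn hU hUD hf)
  obtain ⟨c, hc, HG⟩ := hG
  obtain ⟨e, he, HH⟩ := hH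
  have hdξ := hξ.fderiv_of_isOpen hD (m := ∞) (by simp)
  have hdη := hη.fderiv_of_isOpen hD (m := ∞) (by simp)
  have hdc := (hc w).fderiv_of_isOpen hD (m := ∞) (by simp)
  have hde := (he w).fderiv_of_isOpen hD (m := ∞) (by simp)
  -- The Lie bracket of `ξ` and `η`, with extra terms because the zero order coefficients depend on
  -- the weight.
  let ζ : ℝ × ℝ → ℝ × ℝ := fun x => fderiv ℝ η x (ξ x) - fderiv ℝ ξ x (η x) +
    (e w x - e (w + 1) x) • ξ x + (c (w + 1) x - c w x) • η x
  let g : ℝ × ℝ → ℝ := fun x => fderiv ℝ (e w) x (ξ x) - fderiv ℝ (c w) x (η x) +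
    c (w + 1) x * e w x - e (w + 1) x * c w x
  have hζ : ContDiffOn ℝ ∞ ζ D := (((hdη.clm_apply hξ).sub (hdξ.clm_apply hη)).add
    (((he w).sub (he (w + 1))).smul hξ)).add (((hc (w + 1)).sub (hc w)).smul hη)
  have hg : ContDiffOn ℝ ∞ g D := (((hde.clm_apply hξ).sub (hdc.clm_apply hη)).add
    ((hc (w + 1)).mul (he w))).sub ((he (w + 1)).mul (hc w))
  refine ((hΦ.fderiv_apply hD hζ).add ((hΦ.smul hg).mono_order m.le_succ)).congr ?_
  intro U hU hUD f hf x hx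
  have hφ := hΦ.contDiffOn hU hUD hf
  rw [HG U hU hUD _ (w + 1) (hHc U hU hUD f hf) x hx, HH U hU hUD _ (w + 1) (hGc U hU hUD f hf) x hx,
    fderiv_congr_on hU (fun y hy => HH U hU hUD _ w hφ y hy) hx,
    fderiv_congr_on hU (fun y hy => HG U hU hUD _ w hφ y hy) hx,
    HH U hU hUD _ w hφ x hx, HG U hU hUD _ w hφ x hx]
  generalize Φ f w = φ at *
  have d1 := differentiableAt_of_smooth hU (hφ.fderiv_of_isOpen hU (m := ∞) (by simp)) hx
  have d0 := differentiableAt_of_smooth hU hφ hx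
  have dξ := differentiableAt_of_smooth hD hξ (hUD hx)
  have dη := differentiableAt_of_smooth hD hη (hUD hx)
  have dc := differentiableAt_of_smooth hD (hc w) (hUD hx)
  have de := differentiableAt_of_smooth hD (he w) (hUD hx)
  have E1 := ((d1.hasFDerivAt.clm_apply dη.hasFDerivAt).add (de.hasFDerivAt.mul d0.hasFDerivAt)).fderiv
  have E2 := ((d1.hasFDerivAt.clm_apply dξ.hasFDerivAt).add (dc.hasFDerivAt.mul d0.hasFDerivAt)).fderiv
  have E1' : fderiv ℝ (fun y => fderiv ℝ φ y (η y) + e w y * φ y) x = _ := E1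
  have E2' : fderiv ℝ (fun y => fderiv ℝ φ y (ξ y) + c w y * φ y) x = _ := E2
  rw [E1', E2']
  have hcomm := fderiv_fderiv_comm hU hφ hx (ξ x) (η x)
  simp only [add_apply, ContinuousLinearMap.comp_apply, ContinuousLinearMap.flip_apply,
    smul_apply, smul_eq_mul, ζ, g, map_add, map_sub, map_smul]
  rw [hcomm]
  ring

/-- Permuting the factors of a composition changes it by an operator of lower order. -/
theorem isDiffOp_composeOps_sub (hD : IsOpen D) (hG : ∀ i, IsFirstOrder D (ξ i) (G i))
    (hξ : ∀ i, ContDiffOn ℝ ∞ (ξ i) D) (hΦ : IsDiffOp D m fun f => Φ f w) {l l' : List ι}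
    (h : l.Perm l') (hM : m + l.length ≤ M + 1) :
    IsDiffOp D M fun f x => composeOps G l (Φ f) (w + l.length) x -
      composeOps G l' (Φ f) (w + l.length) x := by
  induction h generalizing M with
  | nil => simpa using isDiffOp_zero
  | @cons i l l' h ih =>
    -- For `M = 0` the bound on the length leaves a word with one letter, and nothing is permuted.
    rcases M with _ | M
    · obtain rfl : l = [] := List.length_eq_zero_iff.1 (by simp at hM; omega)
      obtain rfl := h.nil_eq
      simpa using isDiffOp_zero
    · have hd := ih (M := M) (by simp at hM; omega)
      have hl := isDiffOp_composeOps hD hG hξ hΦ l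
      have hl' := isDiffOp_composeOps hD hG hξ hΦ l'
      rw [← h.length_eq] at hl'
      obtain ⟨c, hc, H⟩ := (hG i).sub (w := w + l.length)
      refine ((hd.fderiv_apply hD (hξ i)).add ((hd.smul hc).mono_order M.le_succ)).congr ?_
      intro U hU hUD f hf x hx
      exact H U hU hUD _ _ (hl.contDiffOn hU hUD hf) (hl'.contDiffOn hU hUD hf) x hx
  | swap i j l =>
    have hl := isDiffOp_composeOps hD hG hξ hΦ l
    refine ((hG j).commutator hD (Φ := fun f => composeOps G l (Φ f)) (hG i) (hξ j) (hξ i)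
      hl).mono_order ?_
    simp at hM
    omega
  | trans h₁ h₂ ih₁ ih₂ =>
    have h2 := ih₂ (M := M) (by rwa [← h₁.length_eq])
    rw [← h₁.length_eq] at h2
    exact ((ih₁ hM).add h2).congr fun U hU hUD f hf x hx => by ring

/-- The symbol of a composition of first order operators. -/
theorem leadSeq_composeOps (hD : IsOpen D) (hG : ∀ i, IsFirstOrder D (ξ i) (G i))
    (hξ : ∀ i, ContDiffOn ℝ ∞ (ξ i) D) {φ : Weighted} (hφ : ContDiffOn ℝ ∞ (φ w) D) {x : ℝ × ℝ}
    (hx : x ∈ D) (l : List ι) (hv : VanishesTo (m + l.length) (φ w) x) :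
    VanishesTo m (composeOps G l φ (w + l.length)) x ∧
    ∀ p ≤ m, leadSeq m (composeOps G l φ (w + l.length)) x p =
      seqAct ((l.map fun i => linPoly (-(ξ i x).2) (ξ i x).1).prod)
        (leadSeq (m + l.length) (φ w) x) p := by
  induction l generalizing m with
  | nil => exact ⟨hv, fun p _ => by simp [seqAct_one]⟩
  | cons i l ih =>
    obtain ⟨ih1, ih2⟩ := ih (m := m + 1) (hv.mono (by simp; omega))
    have hψ := contDiffOn_composeOps hG hξ hD subset_rfl hφ l
    set ψ := composeOps G l φ with hψd
    obtain ⟨c, hc, H⟩ := hG i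
    have hX := ih1.partialX hD hx hψ
    have hY := ih1.partialY
    have sX := contDiffOn_partialX hD hψ
    have sY := contDiffOn_partialY hD hψ
    have hE : Set.EqOn (G i ψ (w + l.length + 1)) (fun y =>
        ((ξ i y).1 * partialX (ψ (w + l.length)) y + (ξ i y).2 * partialY (ψ (w + l.length)) y) +
          c (w + l.length) y * ψ (w + l.length) y) D := fun y hy => by
      rw [H D hD subset_rfl ψ _ hψ y hy, fderiv_eq_partial]
      rfl
    have s1 := (hξ i).fst.mul sX
    have s2 := (hξ i).snd.mul sY
    have s3 := (hc (w + l.length)).mul hψ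
    -- Up to order `m` the coefficients may be frozen at `x`, and the zero order term drops out
    -- because `ψ` vanishes to order `m + 1`.
    have key : ∀ p q, p + q ≤ m → partialXY p q (G i ψ (w + l.length + 1)) x =
        (ξ i x).1 * partialXY p q (partialX (ψ (w + l.length))) x +
        (ξ i x).2 * partialXY p q (partialY (ψ (w + l.length))) x := fun p q hpq => by
      rw [partialXY_congr hD p q hE hx, partialXY_add hD p q (s1.add s2) s3 hx,
        partialXY_add hD p q s1 s2 hx, hX.partialXY_mul hD hx sX (hξ i).fst hpq,
        hY.partialXY_mul hD hx sY (hξ i).snd hpq, ih1.partialXY_mul hD hx hψ (hc _) (by omega),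
        ih1 p q (by omega), mul_zero, add_zero]
    refine ⟨fun p q hpq => ?_, fun p hp => ?_⟩
    · change partialXY p q (G i ψ (w + l.length + 1)) x = 0
      rw [key p q hpq.le, hX p q hpq, hY p q hpq]
      simp
    · have e0 := ih2 p (by omega)
      have e1 := ih2 (p + 1) (by omega)
      rw [leadSeq, if_pos (by omega)] at e0 e1
      rw [show m + 1 + l.length = m + (i :: l).length by simp; omega] at e0 e1
      rw [List.map_cons, List.prod_cons, seqAct_mul, seqAct_linPoly, ← e0, ← e1, leadSeq, if_pos hp]
      change partialXY p (m - p) (G i ψ (w + l.length + 1)) x = _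
      rw [key p (m - p) (by omega), show m + 1 - p = m - p + 1 by omega, partialXY_succ_right,
        show m + 1 - (p + 1) = m - p by omega, partialXY_succ_left' hD _ _ hψ hx]
      ring

end FirstOrder

end WebGeometry

end

open scoped ContDiff

noncomputable section

namespace WebGeometry

namespace PlanarWeb

variable {d : ℕ} {D : Set (ℝ × ℝ)} (W : PlanarWeb d D)

/-! ## The obstruction as a differential operator -/

/-- The index of `ω_1`. -/
def idx₁ : Fin d := ⟨0, by have := W.three_le; omega⟩

/-- The index of `ω_2`. -/
def idx₂ : Fin d := ⟨1, by have := W.three_le; omega⟩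

theorem idx₁_ne_idx₂ : W.idx₁ ≠ W.idx₂ := by simp [idx₁, idx₂]

/-- The coefficient of `dx ∧ dy` in `ω_1 ∧ ω_2`. -/
def coframeDet (x : ℝ × ℝ) : ℝ :=
  W.formX W.idx₁ x * W.formY W.idx₂ x - W.formY W.idx₁ x * W.formX W.idx₂ x

theorem coframeDet_ne_zero {x : ℝ × ℝ} (hx : x ∈ D) : W.coframeDet x ≠ 0 :=
  W.det_ne_zero W.idx₁_ne_idx₂ hx

theorem contDiffOn_coframeDet : ContDiffOn ℝ ∞ W.coframeDet D :=
  ((W.contDiffOn_formX _).mul (W.contDiffOn_formY _)).sub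
    ((W.contDiffOn_formY _).mul (W.contDiffOn_formX _))

theorem contDiffOn_inv_coframeDet : ContDiffOn ℝ ∞ (fun x => (W.coframeDet x)⁻¹) D :=
  W.contDiffOn_coframeDet.inv fun _ hx => W.coframeDet_ne_zero hx

theorem frame_zero (x : ℝ × ℝ) :
    W.frame 0 x = (W.coframeDet x)⁻¹ • (W.formY W.idx₂ x, -W.formX W.idx₂ x) := rfl

theorem frame_one (x : ℝ × ℝ) :
    W.frame 1 x = (W.coframeDet x)⁻¹ • (-W.formY W.idx₁ x, W.formX W.idx₁ x) := rfl

theorem contDiffOn_frame (r : Fin 2) : ContDiffOn ℝ ∞ (W.frame r) D := by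
  fin_cases r
  · exact W.contDiffOn_inv_coframeDet.smul
      ((W.contDiffOn_formY _).prodMk (W.contDiffOn_formX _).neg)
  · exact W.contDiffOn_inv_coframeDet.smul
      ((W.contDiffOn_formY _).neg.prodMk (W.contDiffOn_formX _))

theorem contDiffOn_basicInvariant (i : Fin (d - 2)) : ContDiffOn ℝ ∞ (W.basicInvariant i) D :=
  ((W.smooth _).clm_apply (W.contDiffOn_frame 0)).neg

theorem contDiffOn_chern (r : Fin 2) : ContDiffOn ℝ ∞ (W.chern r) D := by
  fin_cases r
  · exact (contDiffOn_extD W.isOpen (W.smooth _) (W.contDiffOn_frame 0) (W.contDiffOn_frame 1)).neg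
  · exact contDiffOn_extD W.isOpen (W.smooth _) (W.contDiffOn_frame 0) (W.contDiffOn_frame 1)

theorem isFirstOrder_δ (r : Fin 2) : IsFirstOrder D (W.frame r) (W.δ r) :=
  ⟨fun w x => -(w * W.chern r x), fun w => (contDiffOn_const.mul (W.contDiffOn_chern r)).neg,
    fun U hU hUD φ w hφ x hx => by rw [δ]; ring⟩

/-- The vector field `∂_1 - a_i ∂_2`, tangent to the leaves of the `(i+2)`-nd foliation of a
normalized web. -/
def leafField (i : Fin (d - 2)) (x : ℝ × ℝ) : ℝ × ℝ :=
  W.frame 0 x - W.basicInvariant i x • W.frame 1 x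

theorem contDiffOn_leafField (i : Fin (d - 2)) : ContDiffOn ℝ ∞ (W.leafField i) D :=
  (W.contDiffOn_frame 0).sub ((W.contDiffOn_basicInvariant i).smul (W.contDiffOn_frame 1))

theorem isFirstOrder_Δ (i : Fin (d - 2)) : IsFirstOrder D (W.leafField i) (W.Δ i) := by
  have ha := W.contDiffOn_basicInvariant i
  refine ⟨fun w x => -(w * W.chern 0 x) - fderiv ℝ (W.basicInvariant i) x (W.frame 1 x) +
    w * W.chern 1 x * W.basicInvariant i x, fun w => ?_, fun U hU hUD φ w hφ x hx => ?_⟩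
  · exact ((contDiffOn_const.mul (W.contDiffOn_chern 0)).neg.sub
      ((ha.fderiv_of_isOpen W.isOpen (by simp)).clm_apply (W.contDiffOn_frame 1))).add
      ((contDiffOn_const.mul (W.contDiffOn_chern 1)).mul ha)
  · have h := ((differentiableAt_of_smooth W.isOpen ha (hUD hx)).hasFDerivAt.mul
      (differentiableAt_of_smooth hU hφ hx).hasFDerivAt).fderiv
    have h' : fderiv ℝ (fun y => W.basicInvariant i y * φ w y) x = _ := h
    simp only [Δ, Pi.sub_apply, δ, h', leafField, map_sub, map_smul, add_apply, smul_apply,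
      smul_eq_mul]
    ring

/-- The operators `Δ_1, …, Δ_{d-2}, δ_1`. -/
def abelianOp : Fin (d - 2 + 1) → Weighted → Weighted :=
  Fin.snoc (α := fun _ => Weighted → Weighted) W.Δ (W.δ 0)

/-- The vector fields underlying `abelianOp`. -/
def abelianField : Fin (d - 2 + 1) → ℝ × ℝ → ℝ × ℝ :=
  Fin.snoc (α := fun _ => ℝ × ℝ → ℝ × ℝ) W.leafField (W.frame 0)

@[simp] theorem abelianOp_castSucc (i : Fin (d - 2)) : W.abelianOp i.castSucc = W.Δ i := by
  simp [abelianOp]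

@[simp] theorem abelianOp_last : W.abelianOp (Fin.last _) = W.δ 0 := by simp [abelianOp]

@[simp] theorem abelianField_castSucc (i : Fin (d - 2)) :
    W.abelianField i.castSucc = W.leafField i := by simp [abelianField]

@[simp] theorem abelianField_last : W.abelianField (Fin.last _) = W.frame 0 := by
  simp [abelianField]

theorem isFirstOrder_abelianOp (i : Fin (d - 2 + 1)) :
    IsFirstOrder D (W.abelianField i) (W.abelianOp i) := by
  refine Fin.lastCases ?_ (fun i => ?_) i
  · simpa using W.isFirstOrder_δ 0
  · simpa using W.isFirstOrder_Δ i

theorem contDiffOn_abelianField (i : Fin (d - 2 + 1)) : ContDiffOn ℝ ∞ (W.abelianField i) D := by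
  refine Fin.lastCases ?_ (fun i => ?_) i
  · simpa using W.contDiffOn_frame 0
  · simpa using W.contDiffOn_leafField i

theorem δ_neg (r : Fin 2) (φ : Weighted) : W.δ r (-φ) = -W.δ r φ := by
  funext w x
  rcases w with _ | w
  · simp [δ]
  · have h : fderiv ℝ (-φ w) x = -fderiv ℝ (φ w) x := fderiv_neg
    simp only [δ, Pi.neg_apply, h, neg_apply]
    ring

theorem δ_zero (r : Fin 2) : W.δ r 0 = 0 := by
  funext w x
  rcases w with _ | w <;> simp [δ]

theorem Δ_neg (i : Fin (d - 2)) (φ : Weighted) : W.Δ i (-φ) = -W.Δ i φ := by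
  have h : (fun w x => W.basicInvariant i x * (-φ) w x) =
      -(fun w x => W.basicInvariant i x * φ w x : Weighted) := by
    funext w x; simp
  rw [Δ, Δ, h, δ_neg, δ_neg]
  abel

theorem Δ_zero (i : Fin (d - 2)) : W.Δ i 0 = 0 := by
  have h : (fun w x => W.basicInvariant i x * (0 : Weighted) w x) = (0 : Weighted) := by
    funext w x; simp
  rw [Δ, h, δ_zero, δ_zero, sub_zero]

/-- The functions `u_i = λ_{i+2}`, of weight one. -/
def webUnknown (lam : ℝ × ℝ → Fin d → ℝ) (i : Fin (d - 2)) : Weighted :=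
  Pi.single 1 fun y => lam y (shift i)

theorem multiBracket_abelianMatrix (u : Fin (d - 2) → Weighted) :
    multiBracket (d - 2) W.abelianMatrix u = (-1 : ℤ) ^ (d - 2) •
      (composeOps W.abelianOp (List.ofFn Fin.castSucc) (∑ j, W.δ 0 (u j)) -
        ∑ i, composeOps W.abelianOp
          (List.ofFn (Function.update Fin.castSucc i (Fin.last _))) (W.Δ i (u i))) := by
  have key : ∀ s : Fin (d - 2) → Fin (d - 2 + 1), ∀ φ,
      composeOps id (List.ofFn fun i => W.abelianOp (s i)) φ =
        composeOps W.abelianOp (List.ofFn s) φ := fun s φ => by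
    have : (List.ofFn fun i => W.abelianOp (s i)) = (List.ofFn s).map W.abelianOp := by
      rw [List.map_ofFn]; rfl
    rw [this, composeOps_map]
    rfl
  refine (multiBracket_bordered (d - 2) W.Δ (W.δ 0) W.Δ_zero (W.δ_zero 0) W.Δ_neg u).trans ?_
  congr 2
  · rw [← key]
    simp
  · refine Finset.sum_congr rfl fun i _ => ?_
    rw [← key]
    congr 2
    funext j
    by_cases h : j = i
    · subst h; simp
    · simp [Function.update_of_ne h]

theorem add_two_eq (W : PlanarWeb d D) : 2 + (d - 2) = d := by have := W.three_le; omega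

/-- The weight `d` is written as `2 + (d - 2)`: the left-hand sides of the system have weight `2`,
and `d - 2` operators follow. -/
theorem obstruction_apply (lam : ℝ × ℝ → Fin d → ℝ) (x : ℝ × ℝ) :
    W.obstruction lam x = (-1 : ℝ) ^ (d - 2) *
      (composeOps W.abelianOp (List.ofFn Fin.castSucc) (∑ j, W.δ 0 (webUnknown lam j))
          (2 + (d - 2)) x -
        ∑ i, composeOps W.abelianOp (List.ofFn (Function.update Fin.castSucc i (Fin.last _)))
          (W.Δ i (webUnknown lam i)) (2 + (d - 2)) x) := by
  have h := congrFun (congrFun (W.multiBracket_abelianMatrix (webUnknown lam)) (2 + (d - 2))) x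
  have h' : W.obstruction lam x =
      multiBracket (d - 2) W.abelianMatrix (webUnknown lam) (2 + (d - 2)) x :=
    congrArg (fun w => multiBracket (d - 2) W.abelianMatrix (webUnknown lam) w x) W.add_two_eq.symm
  rw [h', h]
  simp only [Pi.smul_apply, Pi.sub_apply, Finset.sum_apply, zsmul_eq_mul]
  push_cast
  rfl

theorem isDiffOp_webUnknown (i : Fin (d - 2)) : IsDiffOp D 0 fun lam => webUnknown lam i 1 :=
  (isDiffOp_coord (shift i)).congr fun U hU hUD f hf x hx => by simp [webUnknown]

/-- The obstruction is a linear differential operator of order `d - 2`. -/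
theorem isDiffOp_obstruction : IsDiffOp D (d - 2) W.obstruction := by
  have hG := W.isFirstOrder_abelianOp
  have hξ := W.contDiffOn_abelianField
  -- Two words of length `d - 1` in the same letters: their difference has order `d - 2`.
  have hi : ∀ i : Fin (d - 2), IsDiffOp D (d - 2) fun lam x =>
      composeOps W.abelianOp (List.ofFn Fin.castSucc ++ [Fin.last _]) (webUnknown lam i)
        (2 + (d - 2)) x -
      composeOps W.abelianOp
        (List.ofFn (Function.update Fin.castSucc i (Fin.last _)) ++ [i.castSucc])
        (webUnknown lam i) (2 + (d - 2)) x := fun i => by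
    have h := isDiffOp_composeOps_sub W.isOpen hG hξ (isDiffOp_webUnknown i)
      (ofFn_update_append_perm (d - 2) Fin.castSucc i (Fin.last _)).symm (M := d - 2) (by simp)
    have hw : 1 + (List.ofFn (Fin.castSucc (n := d - 2)) ++ [Fin.last _]).length = 2 + (d - 2) := by
      simp; omega
    rwa [hw] at h
  refine ((IsDiffOp.sum Finset.univ fun i _ => hi i).smul
    (g := fun _ => (-1) ^ (d - 2)) contDiffOn_const).congr ?_
  intro U hU hUD f hf x hx
  have h2 : ∀ j, ContDiffOn ℝ ∞ (W.δ 0 (webUnknown f j) 2) U := fun j =>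
    (W.isFirstOrder_δ 0).contDiffOn (W.contDiffOn_frame 0) hU hUD
      ((isDiffOp_webUnknown j).contDiffOn hU hUD hf)
  have hs := composeOps_sum hG hξ hU hUD Finset.univ h2 (List.ofFn Fin.castSucc) hx
  rw [List.length_ofFn] at hs
  rw [obstruction_apply, hs, ← Finset.sum_sub_distrib, smul_eq_mul]
  congr 1
  refine Finset.sum_congr rfl fun i _ => ?_
  rw [composeOps_append, composeOps_append]
  simp

end PlanarWeb

end WebGeometry

end

open scoped ContDiff

noncomputable section

namespace WebGeometry

/-- The leading derivatives of a product with a function vanishing to order `m`. -/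
theorem VanishesTo.leadSeq_mul {D : Set (ℝ × ℝ)} {x : ℝ × ℝ} {m : ℕ} (hD : IsOpen D) (hx : x ∈ D)
    {f g h : ℝ × ℝ → ℝ} (hf : ContDiffOn ℝ ∞ f D) (hg : ContDiffOn ℝ ∞ g D)
    (hv : VanishesTo m f x) (hh : Set.EqOn h (fun y => g y * f y) D) :
    leadSeq m h x = g x • leadSeq m f x := by
  funext p
  simp only [leadSeq, Pi.smul_apply, smul_eq_mul]
  split_ifs with hp
  · rw [partialXY_congr hD _ _ hh hx, hv.partialXY_mul hD hx hf hg (by omega)]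
  · simp

namespace PlanarWeb

variable {d : ℕ} {D : Set (ℝ × ℝ)} (W : PlanarWeb d D)

/-! ## Normalized webs -/

theorem form₁_frame_zero {x : ℝ × ℝ} (hx : x ∈ D) : W.form₁ x (W.frame 0 x) = 1 := by
  rw [frame_zero, map_smul]
  have h := W.coframeDet_ne_zero hx
  have : W.form₁ x (W.formY W.idx₂ x, -W.formX W.idx₂ x) = W.coframeDet x := by
    refine (W.form_apply W.idx₁ x _).trans ?_
    simp only [coframeDet]; ring
  rw [this, smul_eq_mul, inv_mul_cancel₀ h]

theorem form₁_frame_one (x : ℝ × ℝ) : W.form₁ x (W.frame 1 x) = 0 := by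
  rw [frame_one, map_smul]
  have : W.form₁ x (-W.formY W.idx₁ x, W.formX W.idx₁ x) = 0 := by
    refine (W.form_apply W.idx₁ x _).trans ?_
    simp only; ring
  rw [this, smul_zero]

theorem form₂_frame_zero (x : ℝ × ℝ) : W.form₂ x (W.frame 0 x) = 0 := by
  rw [frame_zero, map_smul]
  have : W.form₂ x (W.formY W.idx₂ x, -W.formX W.idx₂ x) = 0 := by
    refine (W.form_apply W.idx₂ x _).trans ?_
    simp only; ring
  rw [this, smul_zero]

theorem form₂_frame_one {x : ℝ × ℝ} (hx : x ∈ D) : W.form₂ x (W.frame 1 x) = 1 := by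
  rw [frame_one, map_smul]
  have h := W.coframeDet_ne_zero hx
  have : W.form₂ x (-W.formY W.idx₁ x, W.formX W.idx₁ x) = W.coframeDet x := by
    refine (W.form_apply W.idx₂ x _).trans ?_
    simp only [coframeDet]; ring
  rw [this, smul_eq_mul, inv_mul_cancel₀ h]

theorem extD_frame (α : ℝ × ℝ → (ℝ × ℝ →L[ℝ] ℝ)) {x : ℝ × ℝ} (hx : x ∈ D) :
    extD α x (W.frame 0 x) (W.frame 1 x) = (W.coframeDet x)⁻¹ * extD α x (1, 0) (0, 1) := by
  have h := W.coframeDet_ne_zero hx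
  have e : ∀ a b : ℝ, ((a, b) : ℝ × ℝ) = a • ((1, 0) : ℝ × ℝ) + b • ((0, 1) : ℝ × ℝ) := by simp
  rw [frame_zero, frame_one, e (W.formY W.idx₂ x), e (-W.formY W.idx₁ x)]
  simp only [extD, map_smul, map_add, add_apply, smul_apply, smul_eq_mul]
  have h2 : (W.coframeDet x)⁻¹ * W.coframeDet x = 1 := inv_mul_cancel₀ h
  have h3 : W.coframeDet x =
    W.formX W.idx₁ x * W.formY W.idx₂ x - W.formY W.idx₁ x * W.formX W.idx₂ x := rfl
  generalize (W.coframeDet x)⁻¹ = z at *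
  rw [h3] at h2
  linear_combination (z * (fderiv ℝ α x (1, 0) (0, 1) - fderiv ℝ α x (0, 1) (1, 0))) * h2

variable {W}

/-- In weight one the coefficient `g_1` makes `δ_1 f` the coefficient of `d(f ω_2)` with respect to
`ω_1 ∧ ω_2`. -/
theorem δ_single {f : ℝ × ℝ → ℝ} (hf : ContDiffOn ℝ ∞ f D) {x : ℝ × ℝ} (hx : x ∈ D) :
    W.δ 0 (Pi.single 1 f) 2 x =
      (W.coframeDet x)⁻¹ * extD (fun y => f y • W.form₂ y) x (1, 0) (0, 1) := by
  rw [← W.extD_frame _ hx, extD_smul W.isOpen hf (α := W.form₂) (W.smooth W.idx₂) hx]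
  change fderiv ℝ ((Pi.single 1 f : Weighted) 1) x (W.frame 0 x) -
    ((1 : ℕ) : ℝ) * W.chern 0 x * (Pi.single 1 f : Weighted) 1 x =
    fderiv ℝ f x (W.frame 0 x) * W.form₂ x (W.frame 1 x) -
      fderiv ℝ f x (W.frame 1 x) * W.form₂ x (W.frame 0 x) +
      f x * extD W.form₂ x (W.frame 0 x) (W.frame 1 x)
  rw [Pi.single_eq_same, W.form₂_frame_one hx, W.form₂_frame_zero x]
  simp [chern]
  ring

theorem IsNormalized.form_shift (hW : W.IsNormalized) {x : ℝ × ℝ} (hx : x ∈ D) (i : Fin (d - 2)) :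
    W.form (shift i) x = -(W.basicInvariant i x • W.form₁ x + W.form₂ x) := by
  have := (hW x hx).1 i
  rw [add_comm] at this
  exact eq_neg_of_add_eq_zero_left this

/-- By normalization `f ω_{i+2} = -(a_i f ω_1 + f ω_2)`; the two terms produce `δ_2 (a_i f)` and
`δ_1 f`. With `δ_single` this identifies the system for the `u_i` with the abelian equation. -/
theorem IsNormalized.Δ_single (hW : W.IsNormalized) {f : ℝ × ℝ → ℝ} (hf : ContDiffOn ℝ ∞ f D)
    {x : ℝ × ℝ} (hx : x ∈ D) (i : Fin (d - 2)) :
    W.Δ i (Pi.single 1 f) 2 x =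
      -(W.coframeDet x)⁻¹ * extD (fun y => f y • W.form (shift i) y) x (1, 0) (0, 1) := by
  have ha := W.contDiffOn_basicInvariant i
  have haf : ContDiffOn ℝ ∞ (fun y => W.basicInvariant i y * f y) D := ha.mul hf
  have h1 : ∀ v w, extD (fun y => f y • W.form (shift i) y) x v w =
      -(extD (fun y => (W.basicInvariant i y * f y) • W.form₁ y) x v w +
        extD (fun y => f y • W.form₂ y) x v w) := fun v w => by
    have s1 := differentiableAt_of_smooth W.isOpen (haf.smul (W.smooth W.idx₁)) hx
    have s2 := differentiableAt_of_smooth W.isOpen (hf.smul (W.smooth W.idx₂)) hx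
    have e : Set.EqOn (fun y => f y • W.form (shift i) y)
        (fun y => -((W.basicInvariant i y * f y) • W.form₁ y + f y • W.form₂ y)) D := fun y hy => by
      beta_reduce
      rw [hW.form_shift hy i]
      module
    have h' : fderiv ℝ (fun y => -((W.basicInvariant i y * f y) • W.form₁ y + f y • W.form₂ y)) x
        = _ := (s1.hasFDerivAt.add s2.hasFDerivAt).neg.fderiv
    simp only [extD]
    rw [fderiv_congr_on W.isOpen e hx, h']
    change (-(fderiv ℝ (fun y => (W.basicInvariant i y * f y) • W.form₁ y) x +
      fderiv ℝ (fun y => f y • W.form₂ y) x)) v w - (-(fderiv ℝ (fun y =>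
      (W.basicInvariant i y * f y) • W.form₁ y) x + fderiv ℝ (fun y => f y • W.form₂ y) x)) w v = _
    simp only [neg_apply, add_apply]
    ring
  have h2 : (fun (w : ℕ) x => W.basicInvariant i x * (Pi.single 1 f : Weighted) w x) =
      (Pi.single 1 fun y => W.basicInvariant i y * f y : Weighted) := by
    funext w y
    by_cases hw : w = 1
    · subst hw; simp
    · simp [Pi.single_eq_of_ne hw]
  rw [Δ, Pi.sub_apply, Pi.sub_apply, δ_single hf hx, h2, h1, neg_mul, mul_neg, neg_neg, mul_add,
    add_comm, sub_eq_add_neg, add_right_inj, ← W.extD_frame _ hx,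
    extD_smul W.isOpen haf (α := W.form₁) (W.smooth W.idx₁) hx]
  change -(fderiv ℝ ((Pi.single 1 fun y => W.basicInvariant i y * f y : Weighted) 1) x
    (W.frame 1 x) - ((1 : ℕ) : ℝ) * W.chern 1 x *
      (Pi.single 1 fun y => W.basicInvariant i y * f y : Weighted) 1 x) =
    fderiv ℝ (fun y => W.basicInvariant i y * f y) x (W.frame 0 x) * W.form₁ x (W.frame 1 x) -
      fderiv ℝ (fun y => W.basicInvariant i y * f y) x (W.frame 1 x) * W.form₁ x (W.frame 0 x) +
      W.basicInvariant i x * f x * extD W.form₁ x (W.frame 0 x) (W.frame 1 x)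
  rw [Pi.single_eq_same, W.form₁_frame_one x, W.form₁_frame_zero hx]
  simp [chern]
  ring

theorem shift_injective : Function.Injective (shift (d := d)) := fun i j h => by
  have := congrArg Fin.val h
  simp only [shift] at this
  exact Fin.ext (by omega)

theorem shift_ne_idx₂ (W : PlanarWeb d D) (i : Fin (d - 2)) : shift i ≠ W.idx₂ := by
  simp [shift, idx₂]

theorem univ_erase_idx₁ (W : PlanarWeb d D) :
    Finset.univ.erase W.idx₁ = insert W.idx₂ (Finset.univ.image shift) := by
  ext j
  simp only [Finset.mem_erase, Finset.mem_univ, and_true, Finset.mem_insert, Finset.mem_image,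
    true_and, idx₁, idx₂, shift, Fin.ext_iff, ne_eq]
  constructor
  · intro h
    by_cases h1 : (j : ℕ) = 1
    · exact Or.inl h1
    · exact Or.inr ⟨⟨j - 2, by omega⟩, by simp only; omega⟩
  · rintro (h | ⟨i, h⟩) <;> omega

theorem idx₂_notMem_image_shift (W : PlanarWeb d D) : W.idx₂ ∉ Finset.univ.image (shift (d := d)) := by
  simp only [Finset.mem_image, Finset.mem_univ, true_and, not_exists]
  exact W.shift_ne_idx₂

theorem sum_erase_idx₁ (W : PlanarWeb d D) {A : Type*} [AddCommMonoid A] (g : Fin d → A) :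
    ∑ i ∈ Finset.univ.erase W.idx₁, g i = g W.idx₂ + ∑ i, g (shift i) := by
  rw [univ_erase_idx₁, Finset.sum_insert W.idx₂_notMem_image_shift,
    Finset.sum_image fun _ _ _ _ h => shift_injective h]

theorem prod_erase_idx₁_idx₂ (W : PlanarWeb d D) {A : Type*} [CommMonoid A] (g : Fin d → A) :
    ∏ j ∈ (Finset.univ.erase W.idx₁).erase W.idx₂, g j = ∏ i, g (shift i) := by
  rw [univ_erase_idx₁, Finset.erase_insert W.idx₂_notMem_image_shift,
    Finset.prod_image fun _ _ _ _ h => shift_injective h]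

theorem prod_erase_idx₁_shift (W : PlanarWeb d D) {A : Type*} [CommMonoid A] (g : Fin d → A)
    (i : Fin (d - 2)) : ∏ j ∈ (Finset.univ.erase W.idx₁).erase (shift i), g j =
      g W.idx₂ * ∏ j ∈ Finset.univ.erase i, g (shift j) := by
  rw [univ_erase_idx₁, Finset.erase_insert_of_ne (W.shift_ne_idx₂ i).symm,
    ← Finset.image_erase shift_injective,
    Finset.prod_insert fun h => W.idx₂_notMem_image_shift
      (Finset.image_subset_image (Finset.erase_subset _ _) h),
    Finset.prod_image fun _ _ _ _ h => shift_injective h]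

/-- On a section of the bundle of a normalized web, `λ_2 = λ_3 + ⋯ + λ_d`. -/
theorem IsNormalized.sum_shift (hW : W.IsNormalized) {lam : ℝ × ℝ → Fin d → ℝ}
    (h : W.IsSection lam) {x : ℝ × ℝ} (hx : x ∈ D) : ∑ i, lam x (shift i) = lam x W.idx₂ := by
  have h1 := congrArg (fun α : ℝ × ℝ →L[ℝ] ℝ => α (W.frame 1 x)) (h.2 x hx)
  have e2 : W.form W.idx₂ x (W.frame 1 x) = 1 := W.form₂_frame_one hx
  have e1 : W.form W.idx₁ x (W.frame 1 x) = 0 := W.form₁_frame_one x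
  have e3 : ∀ i, W.form (shift i) x (W.frame 1 x) = -1 := fun i => by
    rw [hW.form_shift hx i]
    simp [W.form₁_frame_one x, W.form₂_frame_one hx]
  rw [← Finset.add_sum_erase _ _ (Finset.mem_univ W.idx₁), sum_erase_idx₁] at h1
  simp only [add_apply, sum_apply, smul_apply, e1, e2, e3, smul_eq_mul, mul_zero, zero_add, mul_one,
    mul_neg, zero_apply, Finset.sum_neg_distrib] at h1
  linarith

theorem IsNormalized.sum_δ_webUnknown (hW : W.IsNormalized) {lam : ℝ × ℝ → Fin d → ℝ}
    (h : W.IsSection lam) : Set.EqOn ((∑ j, W.δ 0 (webUnknown lam j)) 2)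
      (fun x => (W.coframeDet x)⁻¹ * W.dForm W.idx₂ lam x) D := by
  intro x hx
  have hs := fun i => contDiffOn_pi.1 h.1 (shift i)
  simp only [Finset.sum_apply, webUnknown, δ_single (hs _) hx, ← Finset.mul_sum]
  congr 1
  have e : Set.EqOn (fun y => lam y W.idx₂ • W.form₂ y)
      (fun y => ∑ i, lam y (shift i) • W.form₂ y) D := fun y hy => by
    beta_reduce
    rw [← Finset.sum_smul, hW.sum_shift h hy]
  have h' : ∀ i, DifferentiableAt ℝ (fun y => lam y (shift i) • W.form₂ y) x := fun i =>
    differentiableAt_of_smooth W.isOpen ((hs i).smul (W.smooth W.idx₂)) hx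
  change _ = extD (fun y => lam y W.idx₂ • W.form₂ y) x (1, 0) (0, 1)
  simp only [extD, Finset.sum_sub_distrib]
  rw [fderiv_congr_on W.isOpen e hx, fderiv_fun_sum fun i _ => h' i]
  simp only [sum_apply]

theorem IsNormalized.Δ_webUnknown (hW : W.IsNormalized) {lam : ℝ × ℝ → Fin d → ℝ}
    (h : W.IsSection lam) (i : Fin (d - 2)) : Set.EqOn (W.Δ i (webUnknown lam i) 2)
      (fun x => -(W.coframeDet x)⁻¹ * W.dForm (shift i) lam x) D := fun _ hx =>
  hW.Δ_single (contDiffOn_pi.1 h.1 (shift i)) hx i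

open Polynomial in
-- `∂_1` is annihilated by `ω_2`, hence proportional to the field `ξ` of `ω_2`.
theorem linPoly_frame (W : PlanarWeb d D) (x : ℝ × ℝ) :
    linPoly (-(W.frame 0 x).2) (W.frame 0 x).1 =
      C (W.coframeDet x)⁻¹ * linPoly (W.formX W.idx₂ x) (W.formY W.idx₂ x) := by
  simp only [linPoly, frame_zero, Prod.smul_fst, Prod.smul_snd, smul_eq_mul, mul_neg, neg_neg,
    map_mul]
  ring

open Polynomial in
-- `∂_1 - a_i ∂_2` is annihilated by `ω_{i+2}`, so the symbols of the `Δ_i` are the linear factors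
-- of the lifting condition.
theorem IsNormalized.linPoly_leafField (hW : W.IsNormalized) {x : ℝ × ℝ} (hx : x ∈ D)
    (i : Fin (d - 2)) : linPoly (-(W.leafField i x).2) (W.leafField i x).1 =
      C (-(W.coframeDet x)⁻¹) * linPoly (W.formX (shift i) x) (W.formY (shift i) x) := by
  have hX : W.formX (shift i) x =
      -(W.basicInvariant i x * W.formX W.idx₁ x + W.formX W.idx₂ x) := by
    rw [formX, hW.form_shift hx i]; rfl
  have hY : W.formY (shift i) x =
      -(W.basicInvariant i x * W.formY W.idx₁ x + W.formY W.idx₂ x) := by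
    rw [formY, hW.form_shift hx i]; rfl
  rw [hX, hY]
  simp only [linPoly, leafField, frame_zero, frame_one, Prod.smul_fst, Prod.smul_snd, Prod.fst_sub,
    Prod.snd_sub, smul_eq_mul, map_mul, map_neg, map_sub, map_add]
  ring

end PlanarWeb

end WebGeometry

end

open scoped ContDiff

noncomputable section

namespace WebGeometry

namespace PlanarWeb

variable {d : ℕ} {D : Set (ℝ × ℝ)} {W : PlanarWeb d D}

/-! ## The obstruction as compatibility condition -/

/-- The value at `x` of a composition of `d - 2` of the operators of the abelian system. -/
theorem composeOps_abelianOp_eq {φ : Weighted} (hφ : ContDiffOn ℝ ∞ (φ 2) D) {x : ℝ × ℝ}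
    (hx : x ∈ D) (hv : VanishesTo (d - 2) (φ 2) x) (s : Fin (d - 2) → Fin (d - 2 + 1)) :
    composeOps W.abelianOp (List.ofFn s) φ (2 + (d - 2)) x =
      seqAct (∏ j, linPoly (-(W.abelianField (s j) x).2) (W.abelianField (s j) x).1)
        (leadSeq (d - 2) (φ 2) x) 0 := by
  have h := (leadSeq_composeOps (m := 0) W.isOpen W.isFirstOrder_abelianOp W.contDiffOn_abelianField
    hφ hx (List.ofFn s) (by simpa using hv)).2 0 le_rfl
  rw [List.map_ofFn, List.prod_ofFn, List.length_ofFn, zero_add] at h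
  exact h

open Polynomial in
/-- The obstruction is the compatibility condition for lifting jets. -/
theorem IsNormalized.sum_seqAct_eq (hW : W.IsNormalized) {x : ℝ × ℝ} (hx : x ∈ D)
    {f : ℝ × ℝ → Fin d → ℝ} (hf : W.IsSection f)
    (hv : ∀ i, VanishesTo (d - 2) (W.dForm i f) x) :
    ∑ i ∈ Finset.univ.erase W.idx₁,
      (W.formY W.idx₁ x * W.formX i x - W.formX W.idx₁ x * W.formY i x) *
      seqAct (∏ j ∈ (Finset.univ.erase W.idx₁).erase i, linPoly (W.formX j x) (W.formY j x))
        (leadSeq (d - 2) (W.dForm i f) x) 0 =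
      -W.coframeDet x ^ (d - 2 + 2) * W.obstruction f x := by
  have hdet := W.coframeDet_ne_zero hx
  have hsm := fun i => W.smooth_dForm i hf.1
  have hinv := W.contDiffOn_inv_coframeDet
  set P : Fin d → ℝ[X] := fun j => linPoly (W.formX j x) (W.formY j x) with hP
  set z := (W.coframeDet x)⁻¹ with hz
  have e₁ := hW.sum_δ_webUnknown hf
  have e₂ := hW.Δ_webUnknown hf
  have s₁ : ContDiffOn ℝ ∞ ((∑ j, W.δ 0 (webUnknown f j)) 2) D := (hinv.mul (hsm _)).congr e₁
  have s₂ : ∀ i, ContDiffOn ℝ ∞ (W.Δ i (webUnknown f i) 2) D := fun i =>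
    (hinv.neg.mul (hsm _)).congr (e₂ i)
  have v₁ := ((hv W.idx₂).mul W.isOpen hx (hsm _) hinv).congr W.isOpen hx e₁
  have v₂ := fun i => ((hv (shift i)).mul W.isOpen hx (hsm _) hinv.neg).congr W.isOpen hx (e₂ i)
  have l₁ := (hv W.idx₂).leadSeq_mul W.isOpen hx (hsm _) hinv e₁
  have l₂ := fun i => (hv (shift i)).leadSeq_mul W.isOpen hx (hsm _) hinv.neg (e₂ i)
  have c₁ := composeOps_abelianOp_eq (W := W) s₁ hx v₁ Fin.castSucc
  have c₂ := fun i => composeOps_abelianOp_eq (W := W) (s₂ i) hx (v₂ i)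
    (Function.update Fin.castSucc i (Fin.last _))
  simp only [abelianField_castSucc, hW.linPoly_leafField hx, Finset.prod_mul_distrib,
    Finset.prod_const, Finset.card_univ, Fintype.card_fin, ← C_pow, seqAct_C_mul, l₁, seqAct_smul]
    at c₁
  -- One factor `δ_1` contributes `z`, each of the `d - 3` remaining `Δ_j` contributes `-z`.
  have p₂ : ∀ i, ∏ j, linPoly
      (-(W.abelianField (Function.update Fin.castSucc i (Fin.last _) j) x).2)
      (W.abelianField (Function.update Fin.castSucc i (Fin.last _) j) x).1 =
      C (z * (-z) ^ (d - 3)) * (P W.idx₂ * ∏ j ∈ Finset.univ.erase i, P (shift j)) := fun i => by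
    rw [← Finset.mul_prod_erase _ _ (Finset.mem_univ i), Function.update_self, abelianField_last,
      linPoly_frame]
    have : ∀ j ∈ Finset.univ.erase i, linPoly
        (-(W.abelianField (Function.update Fin.castSucc i (Fin.last _) j) x).2)
        (W.abelianField (Function.update Fin.castSucc i (Fin.last _) j) x).1 =
        C (-z) * P (shift j) := fun j hj => by
      rw [Function.update_of_ne (Finset.ne_of_mem_erase hj), abelianField_castSucc,
        hW.linPoly_leafField hx]
    rw [Finset.prod_congr rfl this, Finset.prod_mul_distrib, Finset.prod_const,
      Finset.card_erase_of_mem (Finset.mem_univ i), Finset.card_univ, Fintype.card_fin,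
      ← C_pow, show d - 2 - 1 = d - 3 by omega, C_mul]
    ring
  simp only [p₂, l₂, seqAct_C_mul, seqAct_smul] at c₂
  rw [obstruction_apply, c₁, Finset.sum_congr rfl fun i _ => c₂ i, sum_erase_idx₁,
    prod_erase_idx₁_idx₂]
  simp only [prod_erase_idx₁_shift]
  -- In a normalized web all coefficients of the lifting condition agree up to sign: `-det` for
  -- `ω_2`, `det` for every `ω_{i+2}`. This reproduces the difference in `obstruction_apply`.
  have h₂ : W.formY W.idx₁ x * W.formX W.idx₂ x - W.formX W.idx₁ x * W.formY W.idx₂ x =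
      -W.coframeDet x := by rw [coframeDet]; ring
  have h₃ : ∀ i, W.formY W.idx₁ x * W.formX (shift i) x - W.formX W.idx₁ x * W.formY (shift i) x =
      W.coframeDet x := fun i => by
    have hX : W.formX (shift i) x =
        -(W.basicInvariant i x * W.formX W.idx₁ x + W.formX W.idx₂ x) := by
      rw [formX, hW.form_shift hx i]; rfl
    have hY : W.formY (shift i) x =
        -(W.basicInvariant i x * W.formY W.idx₁ x + W.formY W.idx₂ x) := by
      rw [formY, hW.form_shift hx i]; rfl
    rw [hX, hY, coframeDet]; ring
  simp only [h₂, h₃, Pi.smul_apply, smul_eq_mul, ← Finset.mul_sum]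
  have hd : d - 2 = d - 3 + 1 := by have := W.three_le; omega
  have hzz : W.coframeDet x = z⁻¹ := by rw [hz, inv_inv]
  have hz0 : z ≠ 0 := inv_ne_zero hdet
  generalize seqAct (∏ i, P (shift i)) (leadSeq (d - 2) (W.dForm W.idx₂ f) x) 0 = A
  generalize ∑ i, seqAct (P W.idx₂ * ∏ j ∈ Finset.univ.erase i, P (shift j))
    (leadSeq (d - 2) (W.dForm (shift i) f) x) 0 = B
  clear_value z
  rw [hzz, hd, inv_inv, neg_pow z (d - 3), neg_pow z (d - 3 + 1), pow_succ (-1 : ℝ)]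
  have hε : (-1 : ℝ) ^ (d - 3) * (-1) ^ (d - 3) = 1 := by rw [← mul_pow]; norm_num
  generalize (-1 : ℝ) ^ (d - 3) = ε at *
  have hzp : z ^ (d - 3) ≠ 0 := pow_ne_zero _ hz0
  simp only [pow_succ, inv_pow]
  field_simp
  linear_combination (A - B) * hε

/-- At `k = d - 2` the condition in `exists_lift` concerns only the index `0`. -/
theorem IsNormalized.exists_lift_of_obstruction_eq_zero (hW : W.IsNormalized) (x : D)
    {f : ℝ × ℝ → Fin d → ℝ} (hf : W.IsSection f)
    (hv : ∀ i, VanishesTo (d - 2) (W.dForm i f) x) (h : W.obstruction f x = 0) :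
    ∃ j ∈ W.prolongation (d - 2 + 1) x, jetProj d (d - 2).le_succ j = jet (d - 2) x f := by
  refine W.exists_lift x hf hv W.idx₁ fun p hp => ?_
  obtain rfl : p = 0 := by have := W.three_le; omega
  rw [hW.sum_seqAct_eq x.2 hf hv, h, mul_zero]

theorem IsNormalized.obstruction_eq_zero (hW : W.IsNormalized) {f : ℝ × ℝ → Fin d → ℝ}
    (hf : W.IsSolution f) {x : ℝ × ℝ} (hx : x ∈ D) : W.obstruction f x = 0 := by
  have h0 : ∀ i p q, partialXY p q (W.dForm i f) x = 0 := fun i p q => by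
    rw [partialXY_congr W.isOpen p q (g := fun _ => (0 : ℝ)) (fun y hy => hf.2 i y hy) hx,
      partialXY_const_zero]
  have h := hW.sum_seqAct_eq hx hf.1 fun i p q _ => h0 i p q
  have hl : ∀ i, leadSeq (d - 2) (W.dForm i f) x = 0 := fun i => by
    funext p
    simp [leadSeq, h0]
  simp only [hl, seqAct_zero, Pi.zero_apply, mul_zero, Finset.sum_const_zero] at h
  have hdet := W.coframeDet_ne_zero hx
  simpa [hdet] using h.symm

/-- The obstruction as a linear function on the fibre at `x` of `𝔄_{d-2}`. -/
def obstructionMap (W : PlanarWeb d D) (x : D) : W.prolongation (d - 2) x →ₗ[ℝ] ℝ :=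
  (W.isDiffOp_obstruction.choose x).toLinearMap.domRestrict _

theorem obstructionMap_jet (x : D) {f : ℝ × ℝ → Fin d → ℝ} {U : Set (ℝ × ℝ)} (hU : IsOpen U)
    (hUD : U ⊆ D) (hf : ContDiffOn ℝ ∞ f U) (hx : (x : ℝ × ℝ) ∈ U)
    (h : jet (d - 2) x f ∈ W.prolongation (d - 2) x) :
    W.obstructionMap x ⟨jet (d - 2) x f, h⟩ = W.obstruction f x :=
  (W.isDiffOp_obstruction.choose_spec.2 U hU hUD f hf x hx).symm

theorem IsNormalized.map_jetProj_of_obstructionMap (hW : W.IsNormalized) (x : D)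
    (h : W.obstructionMap x = 0) {j : JetFibre d (d - 2)} (hj : j ∈ W.prolongation (d - 2) x) :
    ∃ j' ∈ W.prolongation (d - 2 + 1) x, jetProj d (d - 2).le_succ j' = j := by
  obtain ⟨f, hf, hv, rfl⟩ := id hj
  refine hW.exists_lift_of_obstruction_eq_zero x hf (fun i p q hpq => hv i p q hpq) ?_
  rw [← obstructionMap_jet x W.isOpen subset_rfl hf.1 x.2 hj, h]
  rfl

end PlanarWeb

end WebGeometry

end

open scoped ContDiff

noncomputable section

namespace WebGeometry

/-! ## Flat sections of a linear connection -/

section Frobenius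

variable {E V : Type*} [NormedAddCommGroup E] [NormedSpace ℝ E] [NormedAddCommGroup V]
  [NormedSpace ℝ V]

/-- Gronwall with constant `1` gives `ε (exp t - 1)`, and `exp 1 - 1 < 2`. -/
theorem norm_le_two_mul_of_norm_deriv_le {f f' : ℝ → V} {ε : ℝ} (hε : 0 ≤ ε)
    (hf : ∀ t ∈ Set.Icc (0 : ℝ) 1, HasDerivWithinAt f (f' t) (Set.Icc 0 1) t) (h0 : f 0 = 0)
    (hb : ∀ t ∈ Set.Icc (0 : ℝ) 1, ‖f' t‖ ≤ ‖f t‖ + ε) :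
    ∀ t ∈ Set.Icc (0 : ℝ) 1, ‖f t‖ ≤ 2 * ε := by
  intro t ht
  have h := norm_le_gronwallBound_of_norm_deriv_right_le (δ := 0) (K := 1) (ε := ε)
    (fun t ht => (hf t ht).continuousWithinAt)
    (fun t ht => (hf t (Set.Ico_subset_Icc_self ht)).mono_of_mem_nhdsWithin
      (Icc_mem_nhdsGE_of_mem ht)) (by simp [h0])
    (fun t ht => by simpa using hb t (Set.Ico_subset_Icc_self ht)) t ht
  refine h.trans ?_
  rw [gronwallBound_of_K_ne_0 one_ne_zero]
  have h1 : Real.exp t ≤ Real.exp 1 := Real.exp_le_exp.2 ht.2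
  have h2 := Real.exp_one_lt_d9
  simp only [sub_zero, zero_mul, zero_add, div_one, one_mul]
  nlinarith

/-- On the ball of radius `‖c‖` about `c` the speed is at most `1/2 * 2‖c‖`, so the solution stays
there for all of `[0, 1]`. -/
theorem exists_linear_ode_solution [CompleteSpace V] {A : ℝ → V →L[ℝ] V}
    (hA : ContinuousOn A (Set.Icc 0 1)) (hb : ∀ t ∈ Set.Icc (0 : ℝ) 1, ‖A t‖ ≤ 1 / 2) (c : V) :
    ∃ φ : ℝ → V, φ 0 = c ∧
      ∀ t ∈ Set.Icc (0 : ℝ) 1, HasDerivWithinAt φ (A t (φ t)) (Set.Icc 0 1) t := by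
  have h : IsPicardLindelof (fun t x => A t x) (⟨0, by simp⟩ : Set.Icc (0 : ℝ) 1) c ‖c‖₊ 0 ‖c‖₊
      (1 / 2) := by
    refine ⟨fun t ht => ?_, fun x _ => hA.clm_apply continuousOn_const, fun t ht x hx => ?_, ?_⟩
    · refine ((A t).lipschitz.weaken ?_).lipschitzOnWith
      rw [← NNReal.coe_le_coe]
      simpa using hb t ht
    · have hx' : ‖x‖ ≤ ‖c‖ + ‖c‖ := by
        rw [mem_closedBall_iff_norm, coe_nnnorm] at hx
        calc ‖x‖ = ‖c + (x - c)‖ := by rw [add_sub_cancel]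
          _ ≤ _ := (norm_add_le _ _).trans (by gcongr)
      calc ‖A t x‖ ≤ ‖A t‖ * ‖x‖ := (A t).le_opNorm x
        _ ≤ 1 / 2 * (‖c‖ + ‖c‖) := by gcongr; exact hb t ht
        _ = ‖c‖₊ := by rw [coe_nnnorm]; ring
    · simp
  exact h.exists_eq_forall_mem_Icc_hasDerivWithinAt₀

/-- `M` bounds `B`, `L` is a Lipschitz constant, and `L'` controls the Taylor remainder. The
condition `M * ρ ≤ 1 / 2` is the one required by the radial differential equation. -/
theorem exists_ball_bounds {B : E → E →L[ℝ] V →L[ℝ] V} {U : Set E} (hU : IsOpen U) {x₀ : E}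
    (hx : x₀ ∈ U) (hB : ContDiffOn ℝ ∞ B U) :
    ∃ ρ > 0, ∃ M L L' : ℝ, Metric.ball x₀ ρ ⊆ U ∧ ρ ≤ 1 ∧ 0 ≤ M ∧ M * ρ ≤ 1 / 2 ∧ 0 ≤ L ∧ 0 ≤ L' ∧
      (∀ y ∈ Metric.ball x₀ ρ, ‖B y‖ ≤ M) ∧
      (∀ y ∈ Metric.ball x₀ ρ, ∀ z ∈ Metric.ball x₀ ρ, ‖B z - B y‖ ≤ L * ‖z - y‖) ∧
      ∀ y ∈ Metric.ball x₀ ρ, ∀ z ∈ Metric.ball x₀ ρ,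
        ‖B z - B y - fderiv ℝ B y (z - y)‖ ≤ L' * ‖z - y‖ ^ 2 := by
  have hUx := hU.mem_nhds hx
  have h0 : ∀ᶠ y in nhds x₀, ‖B y‖ < ‖B x₀‖ + 1 :=
    (ContinuousAt.norm (E := E →L[ℝ] V →L[ℝ] V)
      (hB.continuousOn.continuousAt hUx)).eventually_lt_const (lt_add_one ‖B x₀‖)
  obtain ⟨K, s, hs, hK⟩ := ((hB.contDiffAt hUx).of_le (m := 1) (by simp)).exists_lipschitzOnWith
  obtain ⟨K', s', hs', hK'⟩ := (((hB.fderiv_of_isOpen hU (m := ∞) (by simp)).contDiffAt hUx).of_le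
    (m := 1) (by simp)).exists_lipschitzOnWith
  obtain ⟨r, hr, hrb⟩ := Metric.mem_nhds_iff.1
    (Filter.inter_mem (Filter.inter_mem hUx h0) (Filter.inter_mem hs hs'))
  have hM : 0 < ‖B x₀‖ + 1 := by positivity
  refine ⟨min r (min 1 (1 / (2 * (‖B x₀‖ + 1)))), by positivity, ‖B x₀‖ + 1, K, K', ?_, ?_, hM.le, ?_,
    K.2, K'.2, ?_⟩
  · exact fun y hy => (hrb (Metric.ball_subset_ball (min_le_left _ _) hy)).1.1
  · exact (min_le_right _ _).trans (min_le_left _ _)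
  · calc (‖B x₀‖ + 1) * min r (min 1 (1 / (2 * (‖B x₀‖ + 1))))
        ≤ (‖B x₀‖ + 1) * (1 / (2 * (‖B x₀‖ + 1))) := by
          gcongr; exact (min_le_right _ _).trans (min_le_right _ _)
      _ = 1 / 2 := by field_simp
  · set ρ := min r (min 1 (1 / (2 * (‖B x₀‖ + 1))))
    have hb : ∀ y ∈ Metric.ball x₀ ρ, _ := fun y hy =>
      hrb (Metric.ball_subset_ball (min_le_left _ _) hy)
    refine ⟨fun y hy => (hb y hy).1.2.le, fun y hy z hz => ?_, fun y hy z hz => ?_⟩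
    · simpa [dist_eq_norm] using hK.dist_le_mul z (hb z hz).2.1 y (hb y hy).2.1
    · have hseg : segment ℝ y z ⊆ Metric.ball x₀ ρ := (convex_ball x₀ ρ).segment_subset hy hz
      have h := (convex_segment y z).norm_image_sub_le_of_norm_fderiv_le' (𝕜 := ℝ) (f := B)
        (φ := fderiv ℝ B y) (C := K' * ‖z - y‖) (fun w hw =>
          (hB.contDiffAt (hU.mem_nhds (hb w (hseg hw)).1.1)).differentiableAt (by simp))
        (fun w hw => ?_) (left_mem_segment ℝ y z) (right_mem_segment ℝ y z)
      · rw [pow_two, ← mul_assoc]; exact h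
      · have h1 := hK'.dist_le_mul w (hb w (hseg hw)).2.2 y (hb y hy).2.2
        rw [dist_eq_norm, dist_eq_norm] at h1
        refine h1.trans ?_
        gcongr
        obtain ⟨a, b, ha, hb', hab, rfl⟩ := hw
        have : a • y + b • z - y = b • (z - y) := by
          rw [← sub_eq_zero, show a = 1 - b by linarith]; module
        rw [this, norm_smul, Real.norm_of_nonneg hb']
        exact mul_le_of_le_one_left (norm_nonneg _) (by linarith)

/-- Bootstrapping: if `F` is `C^n`, the equation shows that its derivative is `C^n`. -/
theorem contDiffOn_of_flat [FiniteDimensional ℝ E] {B : E → E →L[ℝ] V →L[ℝ] V} {U : Set E} (hU : IsOpen U)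
    (hB : ContDiffOn ℝ ∞ B U) {F : E → V}
    (hF : ∀ y ∈ U, HasFDerivAt F ((B y).flip (F y)) y) : ContDiffOn ℝ ∞ F U := by
  have hd : DifferentiableOn ℝ F U := fun y hy => (hF y hy).differentiableAt.differentiableWithinAt
  refine contDiffOn_infty.2 fun n => ?_
  induction n with
  | zero => exact contDiffOn_zero.2 hd.continuousOn
  | succ n ih =>
    have h := (contDiffOn_succ_iff_fderiv_of_isOpen (n := (n : ℕ∞ω)) hU).2 ⟨hd, by simp, ?_⟩
    · exact_mod_cast h
    · have hB' : ContDiffOn ℝ n B U := hB.of_le (by exact_mod_cast le_top)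
      have hv : ContDiffOn ℝ n (fun y => (B y).flip (F y)) U :=
        contDiffOn_clm_apply.2 fun v => (hB'.clm_apply contDiffOn_const).clm_apply ih
      exact hv.congr fun y hy => (hF y hy).fderiv

/-- A flat linear connection on a trivial bundle has, near every point, flat sections with
prescribed value. -/
theorem exists_flat_section [FiniteDimensional ℝ E] [CompleteSpace V] {B : E → E →L[ℝ] V →L[ℝ] V} {U : Set E}
    (hU : IsOpen U) {x₀ : E} (hx : x₀ ∈ U) (hB : ContDiffOn ℝ ∞ B U)
    (hflat : ∀ y ∈ U, ∀ v w, fderiv ℝ B y w v + (B y v).comp (B y w) =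
      fderiv ℝ B y v w + (B y w).comp (B y v)) :
    ∃ ρ > 0, Metric.ball x₀ ρ ⊆ U ∧ ∀ c : V, ∃ F : E → V, ContDiffOn ℝ ∞ F (Metric.ball x₀ ρ) ∧
      F x₀ = c ∧ ∀ y ∈ Metric.ball x₀ ρ, HasFDerivAt F ((B y).flip (F y)) y := by
  obtain ⟨ρ, hρ, M, L, L', hρU, hρ1, hM, hMρ, hL, hL', bM, bL, bL'⟩ := exists_ball_bounds hU hx hB
  refine ⟨ρ, hρ, hρU, fun c => ?_⟩
  have hI : ∀ z : E, ‖z‖ < ρ → ∀ t ∈ Set.Icc (0 : ℝ) 1, x₀ + t • z ∈ Metric.ball x₀ ρ := by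
    intro z hz t ht
    rw [mem_ball_iff_norm, add_sub_cancel_left, norm_smul, Real.norm_of_nonneg ht.1]
    exact (mul_le_of_le_one_left (norm_nonneg _) ht.2).trans_lt hz
  have hdB : ∀ y ∈ Metric.ball x₀ ρ, HasFDerivAt B (fderiv ℝ B y) y := fun y hy =>
    ((hB.contDiffAt (hU.mem_nhds (hρU hy))).differentiableAt (by simp)).hasFDerivAt
  have hline : ∀ (z : E) (t : ℝ), HasDerivAt (fun t : ℝ => x₀ + t • z) z t := fun z t => by
    simpa using ((hasDerivAt_id t).smul_const z).const_add x₀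
  have hbz : ∀ z : E, ‖z‖ < ρ → ∀ t ∈ Set.Icc (0 : ℝ) 1, ‖B (x₀ + t • z) z‖ ≤ 1 / 2 :=
    fun z hz t ht => ((B _).le_opNorm z).trans ((mul_le_mul (bM _ (hI z hz t ht)) hz.le
      (norm_nonneg _) hM).trans hMρ)
  -- Parallel transport along the ray from `x₀` to `x₀ + z`; its value at time `1` will be the
  -- section at `x₀ + z`.
  have hode : ∀ z : E, ∃ φ : ℝ → V, ‖z‖ < ρ → φ 0 = c ∧ ∀ t ∈ Set.Icc (0 : ℝ) 1,
      HasDerivWithinAt φ (B (x₀ + t • z) z (φ t)) (Set.Icc 0 1) t := by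
    intro z
    by_cases hz : ‖z‖ < ρ
    · obtain ⟨φ, h⟩ := exists_linear_ode_solution (A := fun t => B (x₀ + t • z) z)
        (fun t ht => (((hdB _ (hI z hz t ht)).continuousAt.comp (f := fun t : ℝ => x₀ + t • z)
          (hline z t).continuousAt).clm_apply continuousAt_const).continuousWithinAt)
        (hbz z hz) c
      exact ⟨φ, fun _ => h⟩
    · exact ⟨0, fun h => absurd h hz⟩
  choose φ hφ using hode
  set N := 3 * ‖c‖ with hN
  have hN0 : 0 ≤ N := by positivity
  have bN : ∀ z, ‖z‖ < ρ → ∀ t ∈ Set.Icc (0 : ℝ) 1, ‖φ z t‖ ≤ N := by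
    intro z hz t ht
    have h := norm_le_two_mul_of_norm_deriv_le (f := fun t => φ z t - c) (norm_nonneg c)
      (fun t ht => ((hφ z hz).2 t ht).sub_const c) (by simp [(hφ z hz).1]) (fun t ht => by
        have h1 : ‖φ z t‖ ≤ ‖φ z t - c‖ + ‖c‖ := norm_le_norm_sub_add _ _
        have h2 := (B (x₀ + t • z) z).le_opNorm (φ z t)
        have h3 := hbz z hz t ht
        have h4 := norm_nonneg (φ z t)
        nlinarith) t ht
    have h1 : ‖φ z t‖ ≤ ‖φ z t - c‖ + ‖c‖ := norm_le_norm_sub_add _ _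
    linarith
  -- Lipschitz dependence of the radial solution on its direction.
  have bδ : ∀ y h, ‖y‖ < ρ → ‖y + h‖ < ρ → ∀ t ∈ Set.Icc (0 : ℝ) 1,
      ‖φ (y + h) t - φ y t‖ ≤ 2 * ((L + M) * N * ‖h‖) := by
    intro y h hy hyh
    refine norm_le_two_mul_of_norm_deriv_le (by positivity)
      (fun t ht => ((hφ _ hyh).2 t ht).sub ((hφ y hy).2 t ht)) (by simp [(hφ _ hyh).1, (hφ y hy).1])
      fun t ht => ?_
    have e : B (x₀ + t • (y + h)) (y + h) (φ (y + h) t) - B (x₀ + t • y) y (φ y t) =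
        B (x₀ + t • (y + h)) (y + h) (φ (y + h) t - φ y t) +
        ((B (x₀ + t • (y + h)) - B (x₀ + t • y)) y (φ y t) + B (x₀ + t • (y + h)) h (φ y t)) := by
      simp only [map_sub, map_add, add_apply, sub_apply]
      abel
    have hq := hI _ hyh t ht
    have hp := hI _ hy t ht
    have n1 := bL _ hp _ hq
    rw [show x₀ + t • (y + h) - (x₀ + t • y) = t • h by module, norm_smul,
      Real.norm_of_nonneg ht.1] at n1
    have n1' : ‖B (x₀ + t • (y + h)) - B (x₀ + t • y)‖ ≤ L * ‖h‖ := n1.trans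
      (mul_le_mul_of_nonneg_left (mul_le_of_le_one_left (norm_nonneg _) ht.2) hL)
    rw [e]
    refine (norm_add_le _ _).trans (add_le_add ?_ ((norm_add_le _ _).trans ?_))
    · refine ((B _ _).le_opNorm _).trans (mul_le_of_le_one_left (norm_nonneg _) ?_)
      linarith [hbz _ hyh t ht]
    · have n2 : ‖(B (x₀ + t • (y + h)) - B (x₀ + t • y)) y (φ y t)‖ ≤ L * ‖h‖ * 1 * N :=
        ((B _ - B _).le_opNorm₂ _ _).trans (by
          gcongr
          · exact hy.le.trans hρ1
          · exact bN y hy t ht)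
      have n3 : ‖B (x₀ + t • (y + h)) h (φ y t)‖ ≤ M * ‖h‖ * N :=
        ((B _).le_opNorm₂ _ _).trans (by
          gcongr
          · exact bM _ hq
          · exact bN y hy t ht)
      linarith
  set C := (L + M) * (2 * ((L + M) * N)) + (L' * N + L * N) with hC
  have hC0 : 0 ≤ C := by positivity
  -- The candidate for the variation of `φ y t` in the direction `h` is `t • B (x₀ + t • y) h (φ y
  -- t)`. Flatness makes it satisfy the linearized radial equation, so Gronwall bounds the error
  -- quadratically in `h`.
  have bE : ∀ y h, ‖y‖ < ρ → ‖y + h‖ < ρ →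
      ‖φ (y + h) 1 - φ y 1 - B (x₀ + y) h (φ y 1)‖ ≤ 2 * (C * ‖h‖ ^ 2) := by
    intro y h hy hyh
    have hder : ∀ t ∈ Set.Icc (0 : ℝ) 1, HasDerivWithinAt
        (fun t : ℝ => φ (y + h) t - φ y t - t • B (x₀ + t • y) h (φ y t))
        (B (x₀ + t • (y + h)) (y + h) (φ (y + h) t) - B (x₀ + t • y) y (φ y t) -
          (t • (fderiv ℝ B (x₀ + t • y) y h (φ y t) + B (x₀ + t • y) h (B (x₀ + t • y) y (φ y t))) +
            (1 : ℝ) • B (x₀ + t • y) h (φ y t))) (Set.Icc 0 1) t := by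
      intro t ht
      have h1 : HasDerivWithinAt (fun t : ℝ => B (x₀ + t • y)) (fderiv ℝ B (x₀ + t • y) y)
          (Set.Icc 0 1) t :=
        (HasFDerivAt.comp_hasDerivAt (E := E →L[ℝ] V →L[ℝ] V) t (hdB _ (hI y hy t ht))
          (hline y t)).hasDerivWithinAt
      have h2 := h1.clm_apply (hasDerivWithinAt_const t (Set.Icc 0 1) h)
      rw [map_zero, add_zero] at h2
      have h3 := h2.clm_apply ((hφ y hy).2 t ht)
      exact (((hφ _ hyh).2 t ht).sub ((hφ y hy).2 t ht)).sub
        ((hasDerivWithinAt_id t _).smul h3)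
    have key := norm_le_two_mul_of_norm_deriv_le (ε := C * ‖h‖ ^ 2) (by positivity) hder
      (by simp [(hφ _ hyh).1, (hφ y hy).1]) (fun t ht => ?_) 1 (by simp)
    · simpa using key
    · have hq := hI _ hyh t ht
      have hp := hI _ hy t ht
      have hqp : x₀ + t • (y + h) - (x₀ + t • y) = t • h := by module
      have n1 := bL _ hp _ hq
      have n2 := bL' _ hp _ hq
      have n3 := bδ y h hy hyh t ht
      have n4 := bN y hy t ht
      have n5 := bM _ hq
      have n6 := hbz y hy t ht
      have fl := congrArg (fun T : V →L[ℝ] V => T (φ y t)) (hflat _ (hρU hp) h y)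
      simp only [add_apply, ContinuousLinearMap.comp_apply] at fl
      rw [hqp] at n1 n2
      rw [norm_smul, Real.norm_of_nonneg ht.1] at n1 n2
      have hth : t * ‖h‖ ≤ ‖h‖ := mul_le_of_le_one_left (norm_nonneg _) ht.2
      have hth0 : 0 ≤ t * ‖h‖ := mul_nonneg ht.1 (norm_nonneg _)
      replace n1 := n1.trans (mul_le_mul_of_nonneg_left hth hL)
      replace n2 := n2.trans (mul_le_mul_of_nonneg_left (pow_le_pow_left₀ hth0 hth 2) hL')
      rw [fl]
      set p := x₀ + t • y
      set q := x₀ + t • (y + h)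
      set δ := φ (y + h) t - φ y t with hδ
      -- Apart from `B p y` applied to the error itself, every term is quadratic in `h`.
      have e : B q (y + h) (φ (y + h) t) - B p y (φ y t) -
          (t • (fderiv ℝ B p h y (φ y t) + B p y (B p h (φ y t))) + (1 : ℝ) • B p h (φ y t)) =
          B p y (δ - t • B p h (φ y t)) + (((B q - B p) y δ + B q h δ) +
          ((B q - B p - fderiv ℝ B p (t • h)) y (φ y t) + (B q - B p) h (φ y t))) := by
        simp only [hδ, map_sub, map_add, map_smul, add_apply, sub_apply, smul_apply, one_smul,
          smul_add]
        abel
      rw [e]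
      have hy1 : ‖y‖ ≤ 1 := hy.le.trans hρ1
      have m1 : ‖(B q - B p) y δ‖ ≤ L * ‖h‖ * 1 * (2 * ((L + M) * N * ‖h‖)) :=
        ((B q - B p).le_opNorm₂ _ _).trans (by gcongr)
      have m2 : ‖B q h δ‖ ≤ M * ‖h‖ * (2 * ((L + M) * N * ‖h‖)) :=
        ((B q).le_opNorm₂ _ _).trans (by gcongr)
      have m3 : ‖(B q - B p - fderiv ℝ B p (t • h)) y (φ y t)‖ ≤ L' * ‖h‖ ^ 2 * 1 * N :=
        ((B q - B p - fderiv ℝ B p (t • h)).le_opNorm₂ _ _).trans (by gcongr)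
      have m4 : ‖(B q - B p) h (φ y t)‖ ≤ L * ‖h‖ * ‖h‖ * N :=
        ((B q - B p).le_opNorm₂ _ _).trans (by gcongr)
      refine (norm_add_le _ _).trans (add_le_add ?_ ?_)
      · refine ((B p y).le_opNorm _).trans (mul_le_of_le_one_left (norm_nonneg _) ?_)
        linarith
      · refine (norm_add_le _ _).trans ((add_le_add (norm_add_le _ _) (norm_add_le _ _)).trans ?_)
        calc _ ≤ _ := add_le_add (add_le_add m1 m2) (add_le_add m3 m4)
          _ = C * ‖h‖ ^ 2 := by rw [hC]; ring
  have hF : ∀ y ∈ Metric.ball x₀ ρ,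
      HasFDerivAt (fun x => φ (x - x₀) 1) ((B y).flip (φ (y - x₀) 1)) y := by
    intro y hy
    rw [mem_ball_iff_norm] at hy
    rw [hasFDerivAt_iff_isLittleO_nhds_zero]
    refine Asymptotics.IsBigO.trans_isLittleO (g := fun h : E => ‖h‖ ^ 2) ?_
      (Asymptotics.isLittleO_norm_pow_id one_lt_two)
    refine Asymptotics.IsBigO.of_bound (2 * C) ?_
    have hev : ∀ᶠ h in nhds (0 : E), ‖y - x₀ + h‖ < ρ := by
      have : ContinuousAt (fun h : E => ‖y - x₀ + h‖) 0 := by fun_prop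
      exact this.eventually_lt_const (by simpa using hy)
    filter_upwards [hev] with h hh
    have := bE (y - x₀) h hy hh
    rw [add_sub_cancel, sub_add_eq_add_sub] at this
    rw [Real.norm_of_nonneg (by positivity), mul_assoc]
    exact this
  refine ⟨fun x => φ (x - x₀) 1, contDiffOn_of_flat Metric.isOpen_ball (hB.mono hρU) hF, ?_, hF⟩
  have h0 : ‖(0 : E)‖ < ρ := by simpa using hρ
  have := norm_le_two_mul_of_norm_deriv_le (f := fun t => φ 0 t - c) (ε := 0) le_rfl
    (fun t ht => ((hφ 0 h0).2 t ht).sub_const c) (by simp [(hφ 0 h0).1]) (by simp) 1 (by simp)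
  simp only [mul_zero, norm_le_zero_iff, sub_eq_zero] at this
  simpa using this

end Frobenius

end WebGeometry

end

open scoped ContDiff

noncomputable section

namespace WebGeometry

/-! ## Local solutions with prescribed jets -/

theorem jetProj_totalDeriv (d k : ℕ) (v : ℝ × ℝ) (j : JetFibre d (k + 2)) :
    jetProj d k.le_succ (totalDeriv d (le_refl (k + 2)) v j) =
      totalDeriv d (le_refl (k + 1)) v (jetProj d (k + 1).le_succ j) := rfl

theorem totalDeriv_comm (d k : ℕ) (v w : ℝ × ℝ) (j : JetFibre d (k + 2)) :
    totalDeriv d (le_refl (k + 1)) v (totalDeriv d (le_refl (k + 2)) w j) =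
      totalDeriv d (le_refl (k + 1)) w (totalDeriv d (le_refl (k + 2)) v j) := by
  funext p
  simp only [totalDeriv, LinearMap.coe_mk, AddHom.coe_mk, smul_add]
  module

/-- The total derivative as a continuous bilinear map. -/
def totalDerivL (d k : ℕ) : ℝ × ℝ →L[ℝ] JetFibre d (k + 1) →L[ℝ] JetFibre d k :=
  (ContinuousLinearMap.fst ℝ ℝ ℝ).smulRight
      (totalDeriv d (le_refl (k + 1)) (1, 0)).toContinuousLinearMap +
    (ContinuousLinearMap.snd ℝ ℝ ℝ).smulRight
      (totalDeriv d (le_refl (k + 1)) (0, 1)).toContinuousLinearMap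

theorem totalDerivL_apply (d k : ℕ) (v : ℝ × ℝ) (j : JetFibre d (k + 1)) :
    totalDerivL d k v j = totalDeriv d (le_refl (k + 1)) v j := by
  rw [totalDeriv_eq]
  rfl

/-- A field of jets that is compatible with differentiation consists of the jets of a map. -/
theorem jet_eq_of_fderiv_eq {d k : ℕ} {U : Set (ℝ × ℝ)} (hU : IsOpen U)
    {s : ℝ × ℝ → JetFibre d (k + 1)} (hs : ContDiffOn ℝ ∞ s U)
    (h : ∀ y ∈ U, ∀ v, fderiv ℝ (fun z => jetProj d k.le_succ (s z)) y v =
      totalDeriv d (le_refl (k + 1)) v (s y)) {y : ℝ × ℝ} (hy : y ∈ U) :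
    jet (k + 1) y (fun z => s z ⟨(0, 0), Nat.zero_le _⟩) = s y := by
  have hsm : ∀ p : JetIndex (k + 1), ContDiffOn ℝ ∞ (fun z => s z p) U := contDiffOn_pi.1 hs
  have hpr : ContDiffOn ℝ ∞ (fun z => jetProj d k.le_succ (s z)) U :=
    contDiffOn_pi.2 fun p => hsm _
  have hcomp : ∀ p q (hpq : p + q ≤ k), ∀ y ∈ U, ∀ v,
      fderiv ℝ (fun z => s z ⟨(p, q), hpq.trans k.le_succ⟩) y v =
      v.1 • s y ⟨(p + 1, q), by simp only; omega⟩ +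
        v.2 • s y ⟨(p, q + 1), by simp only; omega⟩ := by
    intro p q hpq y hy v
    have h1 := (hasFDerivAt_pi'.1 (differentiableAt_of_smooth hU hpr hy).hasFDerivAt
      ⟨(p, q), hpq⟩).fderiv
    have h2 := congrFun (h y hy v) ⟨(p, q), hpq⟩
    refine (congrArg (fun T : ℝ × ℝ →L[ℝ] (Fin d → ℝ) => T v) h1).trans h2
  have hX : ∀ p q (hpq : p + q ≤ k), Set.EqOn
      (partialX fun z => s z ⟨(p, q), hpq.trans k.le_succ⟩)
      (fun z => s z ⟨(p + 1, q), by simp only; omega⟩) U := fun p q hpq y hy => by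
    have := hcomp p q hpq y hy (1, 0)
    simpa [partialX] using this
  have hY : ∀ p q (hpq : p + q ≤ k), Set.EqOn
      (partialY fun z => s z ⟨(p, q), hpq.trans k.le_succ⟩)
      (fun z => s z ⟨(p, q + 1), by simp only; omega⟩) U := fun p q hpq y hy => by
    have := hcomp p q hpq y hy (0, 1)
    simpa [partialY] using this
  have key : ∀ p q (hpq : p + q ≤ k + 1), Set.EqOn
      (partialXY p q fun z => s z ⟨(0, 0), Nat.zero_le _⟩) (fun z => s z ⟨(p, q), hpq⟩) U := by
    intro p
    induction p with
    | zero =>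
      intro q
      induction q with
      | zero => exact fun _ y _ => rfl
      | succ q ih =>
        intro hq
        rw [partialXY_zero_succ]
        exact (partialY_congr hU (ih (by omega))).trans (hY 0 q (by omega))
    | succ p ih =>
      intro q hq
      rw [partialXY_succ_left]
      exact (partialX_congr hU (ih q (by omega))).trans (hX p q (by omega))
  exact funext fun p => key p.1.1 p.1.2 p.2 hy

section FrameConnection

variable {C : Type*} [NormedAddCommGroup C] [NormedSpace ℝ C] {d k : ℕ}

/-- The projection of a frame of a bundle of jets. -/
def frameProj (E : ℝ × ℝ → C →L[ℝ] JetFibre d (k + 1)) : ℝ × ℝ → C →L[ℝ] JetFibre d k :=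
  fun y => (jetProj d k.le_succ).toContinuousLinearMap.comp (E y)

/-- The connection form, in the frame `E`, of the connection defined by the projection of jets. -/
def frameConnection (E : ℝ × ℝ → C →L[ℝ] JetFibre d (k + 1)) (G : ℝ × ℝ → JetFibre d k →L[ℝ] C)
    (y : ℝ × ℝ) : ℝ × ℝ →L[ℝ] C →L[ℝ] C :=
  (ContinuousLinearMap.compL ℝ C (JetFibre d k) C (G y)).comp
    (((ContinuousLinearMap.compL ℝ C (JetFibre d (k + 1)) (JetFibre d k)).flip (E y)).comp
      (totalDerivL d k) - fderiv ℝ (frameProj E) y)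

theorem frameConnection_apply (E : ℝ × ℝ → C →L[ℝ] JetFibre d (k + 1))
    (G : ℝ × ℝ → JetFibre d k →L[ℝ] C) (y v : ℝ × ℝ) (c : C) :
    frameConnection E G y v c =
      G y (totalDeriv d (le_refl (k + 1)) v (E y c) - fderiv ℝ (frameProj E) y v c) := by
  rw [← totalDerivL_apply]
  rfl

variable {D : Set (ℝ × ℝ)} {E : ℝ × ℝ → C →L[ℝ] JetFibre d (k + 1)}
  {G : ℝ × ℝ → JetFibre d k →L[ℝ] C}

theorem contDiffOn_frameProj (hE : ContDiffOn ℝ ∞ E D) : ContDiffOn ℝ ∞ (frameProj E) D :=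
  contDiffOn_const.clm_comp hE

theorem contDiffOn_frameConnection [FiniteDimensional ℝ C] (hD : IsOpen D)
    (hE : ContDiffOn ℝ ∞ E D) (hG : ContDiffOn ℝ ∞ G D) :
    ContDiffOn ℝ ∞ (frameConnection E G) D := by
  refine contDiffOn_clm_apply.2 fun v => contDiffOn_clm_apply.2 fun c => ?_
  have h1 : ContDiffOn ℝ ∞ (fun y => totalDerivL d k v (E y c)) D :=
    contDiffOn_const.clm_apply (hE.clm_apply contDiffOn_const)
  have h2 : ContDiffOn ℝ ∞ (fun y => fderiv ℝ (frameProj E) y v c) D :=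
    (contDiffOn_fderiv_apply hD (contDiffOn_frameProj hE) v).clm_apply contDiffOn_const
  exact (hG.clm_apply (h1.sub h2)).congr fun y _ => by
    rw [frameConnection_apply, totalDerivL_apply]

namespace PlanarWeb

variable {W : PlanarWeb d D}

/-- The Spencer property puts the difference of the two derivatives in the lower prolongation, so it
lies in the image of the frame, and `G` loses nothing. Consequently coefficients `c` are parallel
when `dc = B c`. -/
theorem fderiv_frameProj_add (hE : ContDiffOn ℝ ∞ E D)
    (hm : ∀ (y : D) c, E y c ∈ W.prolongation (k + 1) y)
    (hsurj : ∀ y : D, ∀ j ∈ W.prolongation k y, ∃ c, frameProj E y c = j)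
    (hGE : ∀ y ∈ D, ∀ c, G y (frameProj E y c) = c) (y : D) (v : ℝ × ℝ) (c : C) :
    fderiv ℝ (frameProj E) y v c + frameProj E y (frameConnection E G y v c) =
      totalDeriv d (le_refl (k + 1)) v (E y c) := by
  have hP := contDiffOn_frameProj hE
  have hs : IsSmoothSection D (W.prolongation k) (fun y => frameProj E y c) :=
    ⟨hP.clm_apply contDiffOn_const, fun x => W.jetProj_mem_prolongation k.le_succ (hm x c)⟩
  have h1 := W.fderiv_sub_totalDeriv_mem (le_refl (k + 1)) hs v y (hm y c) rfl
  have h2 : fderiv ℝ (fun y => frameProj E y c) y v = fderiv ℝ (frameProj E) y v c := by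
    have := ((differentiableAt_of_smooth W.isOpen hP y.2).hasFDerivAt.clm_apply
      (hasFDerivAt_const c (y : ℝ × ℝ))).fderiv
    rw [this]
    simp
  rw [h2, ← neg_mem_iff, neg_sub] at h1
  obtain ⟨b, hb⟩ := hsurj y _ h1
  rw [frameConnection_apply, ← hb, hGE y y.2, hb]
  abel

/-- If all jets in the image of the last projection lift once more, the connection is flat. -/
theorem frameConnection_flat (hk : k + 3 = d) [FiniteDimensional ℝ C] (hE : ContDiffOn ℝ ∞ E D)
    (hG : ContDiffOn ℝ ∞ G D)
    (hm : ∀ (y : D) c, E y c ∈ W.prolongation (k + 1) y)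
    (hsurj : ∀ y : D, ∀ j ∈ W.prolongation k y, ∃ c, frameProj E y c = j)
    (hGE : ∀ y ∈ D, ∀ c, G y (frameProj E y c) = c)
    (hL : ∀ y : D, ∀ j ∈ W.prolongation (k + 1) y,
      ∃ j' ∈ W.prolongation (k + 2) y, jetProj d (k + 1).le_succ j' = j) :
    ∀ y ∈ D, ∀ v w, fderiv ℝ (frameConnection E G) y w v +
        (frameConnection E G y v).comp (frameConnection E G y w) =
      fderiv ℝ (frameConnection E G) y v w +
        (frameConnection E G y w).comp (frameConnection E G y v) := by
  have hD := W.isOpen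
  have hP := contDiffOn_frameProj hE
  have hB := contDiffOn_frameConnection hD hE hG
  set B := frameConnection E G with hBd
  intro y₀ hy₀
  have key : ∀ c₀ : C, ∃ j', ∃ F : ℝ × ℝ → JetFibre d k, ContDiffOn ℝ ∞ F D ∧ ∀ v w,
      frameProj E y₀ (-(fderiv ℝ B y₀ w v c₀ + B y₀ v (B y₀ w c₀))) =
        fderiv ℝ (fderiv ℝ F) y₀ w v - totalDeriv d (le_refl (k + 1)) v
          (totalDeriv d (le_refl (k + 2)) w j') := by
    intro c₀
    obtain ⟨j', hj', hjj⟩ := hL ⟨y₀, hy₀⟩ _ (hm ⟨y₀, hy₀⟩ c₀)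
    -- Affine coefficients that satisfy the parallel equation at `y₀`.
    let c : ℝ × ℝ → C := fun y => c₀ + B y₀ (y - y₀) c₀
    have hc0 : c y₀ = c₀ := by simp [c]
    have hc' : ∀ y, HasFDerivAt c ((B y₀).flip c₀) y := fun y => by
      have h := (((B y₀).flip c₀).hasFDerivAt (x := y - y₀)).comp y
        ((hasFDerivAt_id y).sub_const y₀)
      simpa [Function.comp_def, c] using h.const_add c₀
    have hc : ContDiffOn ℝ ∞ c D := by
      have h : ContDiff ℝ ∞ fun y => (B y₀).flip c₀ (y - y₀) :=
        ((B y₀).flip c₀).contDiff.comp (contDiff_id.sub contDiff_const)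
      exact (contDiff_const.add h).contDiffOn
    have hs : IsSmoothSection D (W.prolongation (k + 1)) (fun y => E y (c y)) :=
      ⟨hE.clm_apply hc, fun y => hm y _⟩
    let F : ℝ × ℝ → JetFibre d k := fun y => frameProj E y (c y)
    have hF : ContDiffOn ℝ ∞ F D := hP.clm_apply hc
    have hFd : ∀ y ∈ D, ∀ v, fderiv ℝ F y v =
        fderiv ℝ (frameProj E) y v (c y) + frameProj E y (B y₀ v c₀) := fun y hy v => by
      have h := ((differentiableAt_of_smooth hD hP hy).hasFDerivAt.clm_apply (hc' y)).fderiv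
      have h' : fderiv ℝ F y = _ := h
      rw [h']
      simp [add_comm]
    -- Both sides differ by an element of `𝔄_{k+1}` with projection zero, since `c` is parallel at
    -- `y₀`; the last projection is injective.
    have hsd : ∀ w, fderiv ℝ (fun y => E y (c y)) y₀ w =
        totalDeriv d (le_refl (k + 2)) w j' := by
      intro w
      have h1 := W.fderiv_sub_totalDeriv_mem (le_refl (k + 2)) hs w ⟨y₀, hy₀⟩ hj'
        (by rw [hjj]; simp only [hc0])
      refine sub_eq_zero.1 ((W.bijOn_jetProj hk ⟨y₀, hy₀⟩).2.1 h1 (Submodule.zero_mem _) ?_)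
      have h2 : jetProj d k.le_succ (fderiv ℝ (fun y => E y (c y)) y₀ w) = fderiv ℝ F y₀ w := by
        have := ((jetProj d k.le_succ).toContinuousLinearMap.hasFDerivAt.comp y₀
          (differentiableAt_of_smooth hD hs.1 hy₀).hasFDerivAt).fderiv
        have h' : fderiv ℝ F y₀ = _ := this
        rw [h']
        rfl
      rw [map_sub, map_zero, h2, jetProj_totalDeriv, hjj, hFd y₀ hy₀, hc0,
        fderiv_frameProj_add hE hm hsurj hGE ⟨y₀, hy₀⟩, sub_self]
    refine ⟨j', F, hF, fun v w => ?_⟩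
    -- Two expressions for the covariant derivative along `v`. Differentiating them along `w` at
    -- `y₀` gives on the right minus the curvature term, the bracket being zero there, and on the
    -- left something symmetric in `v` and `w`.
    have hEq : Set.EqOn (fun y => fderiv ℝ F y v - totalDerivL d k v (E y (c y)))
        (fun y => frameProj E y (B y₀ v c₀ - B y v (c y))) D := fun y hy => by
      beta_reduce
      rw [hFd y hy, totalDerivL_apply, ← fderiv_frameProj_add hE hm hsurj hGE ⟨y, hy⟩, map_sub]
      abel
    have h1 := congrArg (fun T : ℝ × ℝ →L[ℝ] JetFibre d k => T w) (fderiv_congr_on hD hEq hy₀)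
    have d1 := (differentiableAt_of_smooth hD (contDiffOn_fderiv_apply hD hF v) hy₀).hasFDerivAt
    have d2 := (totalDerivL d k v).hasFDerivAt.comp y₀
      (differentiableAt_of_smooth hD hs.1 hy₀).hasFDerivAt
    have d3 := (((differentiableAt_of_smooth hD hB hy₀).hasFDerivAt.clm_apply
      (hasFDerivAt_const v y₀)).clm_apply (hc' y₀)).const_sub (B y₀ v c₀)
    have d4 := (differentiableAt_of_smooth hD hP hy₀).hasFDerivAt.clm_apply d3
    have e1 : fderiv ℝ (fun y => fderiv ℝ F y v - totalDerivL d k v (E y (c y))) y₀ = _ :=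
      (d1.sub d2).fderiv
    have e2 : fderiv ℝ (fun y => frameProj E y (B y₀ v c₀ - B y v (c y))) y₀ = _ := d4.fderiv
    beta_reduce at h1
    rw [e1, e2, sub_apply, ContinuousLinearMap.comp_apply, hsd, totalDerivL_apply,
      fderiv_fderiv_apply hD hF hy₀] at h1
    rw [h1]
    simp [hc0, add_comm]
  intro v w
  refine ContinuousLinearMap.ext fun c₀ => ?_
  obtain ⟨j', F, hF, h⟩ := key c₀
  have h1 := (h v w).trans (by rw [totalDeriv_comm, fderiv_fderiv_comm hD hF hy₀])
  have h2 := congrArg (G y₀) (h1.trans (h w v).symm)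
  rw [hGE y₀ hy₀, hGE y₀ hy₀] at h2
  exact neg_inj.1 h2

end PlanarWeb

end FrameConnection

namespace PlanarWeb

variable {d k : ℕ} {D : Set (ℝ × ℝ)} (W : PlanarWeb d D)

/-- Sections over `U` need not extend to `D`; the description by equations makes the fibres agree.
-/
theorem prolongation_restrict {U : Set (ℝ × ℝ)} (hU : IsOpen U) (hUD : U ⊆ D) (k : ℕ) (x : U) :
    (W.restrict U hU hUD).prolongation k x = W.prolongation k ⟨x, hUD x.2⟩ := by
  ext j
  obtain ⟨g, hg, rfl⟩ := exists_jet_eq (x : ℝ × ℝ) j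
  rw [mem_prolongation_iff_of_jet _ hg, mem_prolongation_iff_of_jet _ hg]
  rfl

theorem isSolution_restrict_of_jet_mem {U : Set (ℝ × ℝ)} (hU : IsOpen U) (hUD : U ⊆ D)
    {lam : ℝ × ℝ → Fin d → ℝ} (hlam : ContDiffOn ℝ ∞ lam U)
    (h : ∀ y (hy : y ∈ U), jet (k + 1) y lam ∈ W.prolongation (k + 1) ⟨y, hUD hy⟩) :
    (W.restrict U hU hUD).IsSolution lam := by
  have key := fun y (hy : y ∈ U) =>
    (W.jet_mem_prolongation_iff hU hUD hlam ⟨y, hUD hy⟩ hy).1 (h y hy)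
  refine ⟨⟨hlam, fun y hy => (W.sum_form_eq_zero_iff lam y).2 ⟨?_, ?_⟩⟩, fun i y hy => ?_⟩
  · exact key y hy (.inl 0) 0 0 (by simp [eqnOrder])
  · exact key y hy (.inl 1) 0 0 (by simp [eqnOrder])
  · exact key y hy (.inr i) 0 0 (by simp [eqnOrder])

/-- If all jets of order `d - 2` lift, there are local solutions with prescribed jets. -/
theorem exists_local_solution (hk : k + 3 = d)
    (hL : ∀ y : D, ∀ j ∈ W.prolongation (k + 1) y,
      ∃ j' ∈ W.prolongation (k + 2) y, jetProj d (k + 1).le_succ j' = j) (x : D) :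
    ∃ ρ > 0, ∃ hb : Metric.ball (x : ℝ × ℝ) ρ ⊆ D, ∀ j ∈ W.prolongation k x, ∃ lam,
      (W.restrict _ Metric.isOpen_ball hb).IsSolution lam ∧ jet k x lam = j := by
  obtain ⟨U, hU, hxU, hUD, E, G, hE, hG, hm, hsurj, hGE⟩ := W.exists_frame hk x
  let W' := W.restrict U hU hUD
  have hm' : ∀ (y : U) c, E y c ∈ W'.prolongation (k + 1) y := fun y c => by
    rw [W.prolongation_restrict hU hUD]
    exact hm y y.2 c
  have hsurj' : ∀ y : U, ∀ j ∈ W'.prolongation k y, ∃ c, frameProj E y c = j := by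
    intro y j hj
    obtain ⟨j', hj', rfl⟩ := (W'.bijOn_jetProj hk y).2.2 hj
    rw [SetLike.mem_coe, W.prolongation_restrict hU hUD] at hj'
    obtain ⟨c, rfl⟩ := hsurj y y.2 j' hj'
    exact ⟨c, rfl⟩
  have hB := contDiffOn_frameConnection hU hE hG
  obtain ⟨ρ, hρ, hρU, H⟩ := exists_flat_section hU hxU hB
    (frameConnection_flat (W := W') hk hE hG hm' hsurj' hGE fun y j hj => by
      rw [W.prolongation_restrict hU hUD] at hj ⊢
      exact hL _ j hj)
  refine ⟨ρ, hρ, hρU.trans hUD, fun j hj => ?_⟩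
  obtain ⟨c₀, hc₀⟩ := hsurj' ⟨x, hxU⟩ j (by rwa [W.prolongation_restrict hU hUD])
  obtain ⟨c, hc, hcx, hc'⟩ := H c₀
  have hs : ContDiffOn ℝ ∞ (fun y => E y (c y)) (Metric.ball (x : ℝ × ℝ) ρ) :=
    (hE.mono hρU).clm_apply hc
  -- Parallelism says exactly that this field of jets is compatible with differentiation, so it
  -- consists of the jets of its zeroth component.
  have hjet : ∀ y ∈ Metric.ball (x : ℝ × ℝ) ρ, jet (k + 1) y _ = E y (c y) := fun y hy =>
    jet_eq_of_fderiv_eq Metric.isOpen_ball hs (fun y hy v => by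
      have h := ((differentiableAt_of_smooth hU (contDiffOn_frameProj hE)
        (hρU hy)).hasFDerivAt.clm_apply (hc' y hy)).fderiv
      have h' : fderiv ℝ (fun z => jetProj d k.le_succ (E z (c z))) y = _ := h
      rw [h', ← fderiv_frameProj_add (W := W') hE hm' hsurj' hGE ⟨y, hρU hy⟩]
      simp [add_comm]) hy
  refine ⟨_, W.isSolution_restrict_of_jet_mem Metric.isOpen_ball _ (contDiffOn_pi.1 hs _)
    fun y hy => by rw [hjet y hy]; exact hm y (hρU hy) _, ?_⟩
  rw [← hc₀, ← hcx, ← jetProj_jet k.le_succ, hjet x (Metric.mem_ball_self hρ)]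
  rfl

end PlanarWeb

end WebGeometry

end

open scoped ContDiff

noncomputable section

namespace WebGeometry

/-! ## Continuation over simply connected domains -/

/-- Locally constant transition functions over a simply connected base can be trivialized along a
given value. -/
theorem exists_compatible_family {B ι α : Type*} [TopologicalSpace B] [SimplyConnectedSpace B]
    [LocallyPathConnectedSpace B] (S : ι → Set B) (hS : ∀ i, IsOpen (S i))
    (hconn : ∀ i, IsPreconnected (S i)) (idx : B → ι) (hidx : ∀ x, x ∈ S (idx x))
    (g : ι → ι → B → α → α) (hself : ∀ i, ∀ x ∈ S i, ∀ v, g i i x v = v)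
    (hconst : ∀ i j, ∀ x ∈ S i ∩ S j, ∀ y ∈ S i ∩ S j, ∀ v, g i j x v = g i j y v)
    (hcomp : ∀ i j l, ∀ x ∈ S i ∩ S j ∩ S l, ∀ v, g j l x (g i j x v) = g i l x v)
    (b₀ : B) (v₀ : α) :
    ∃ σ : B → α, σ b₀ = v₀ ∧ ∀ i, ∃ v, ∀ x ∈ S i, g (idx x) i x (σ x) = v := by
  -- With discrete fibres the glued bundle is a covering space.
  let : TopologicalSpace α := ⊥
  have : DiscreteTopology α := ⟨rfl⟩
  let Z : FiberBundleCore ι B α :=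
    { baseSet := S
      isOpen_baseSet := hS
      indexAt := idx
      mem_baseSet_at := hidx
      coordChange := g
      coordChange_self := hself
      continuousOn_coordChange := fun i j => by
        rintro ⟨x, v⟩ ⟨hx, -⟩
        have h : Continuous fun p : B × α => g i j x p.2 :=
          continuous_of_discreteTopology.comp continuous_snd
        exact h.continuousOn.congr (fun p hp => hconst i j p.1 hp.1 x hx p.2) (x, v) ⟨hx, trivial⟩
      coordChange_comp := hcomp }
  have hcov : IsCoveringMap Z.proj := FiberBundle.isCoveringMap (F := α) (E := Z.Fiber)
  -- Lifting the identity of a simply connected base produces a global section; over each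
  -- preconnected chart it is continuous with discrete values, hence constant.
  obtain ⟨s, ⟨hs0, hs⟩, -⟩ := hcov.existsUnique_continuousMap_lifts (ContinuousMap.id B) b₀
    (⟨b₀, v₀⟩ : Z.TotalSpace) rfl
  have hs' : ∀ x, (s x).1 = x := fun x => congrFun hs x
  have hcast : ∀ x, ∃ w : α, s x = (⟨x, w⟩ : Z.TotalSpace) := fun x => by
    have := hs' x
    rcases h : s x with ⟨y, w⟩
    rw [h] at this
    obtain rfl : y = x := this
    exact ⟨w, rfl⟩
  choose σ hσ using hcast
  refine ⟨σ, ?_, fun i => ?_⟩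
  · have h := (hσ b₀).symm.trans hs0
    injection h
  · have hc : ContinuousOn (fun x => g (idx x) i x (σ x)) (S i) := by
      have h1 : ContinuousOn (fun x => (Z.localTriv i (s x)).2) (S i) :=
        continuous_snd.comp_continuousOn ((Z.localTriv i).continuousOn.comp s.continuous.continuousOn
          fun x hx => by
            rw [Z.mem_localTriv_source, hs' x]
            exact hx)
      exact h1.congr fun x _ => by beta_reduce; rw [hσ x]; rfl
    rcases (S i).eq_empty_or_nonempty with he | ⟨y, hy⟩
    · exact ⟨v₀, fun x hx => by simp [he] at hx⟩
    · exact ⟨_, fun x hx => (hconn i).constant hc hx hy⟩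

namespace PlanarWeb

variable {d k : ℕ} {D : Set (ℝ × ℝ)} {W : PlanarWeb d D}

theorem IsSolution.eqOn (hk : k + 3 = d) (hD : IsPreconnected D) {f g : ℝ × ℝ → Fin d → ℝ}
    (hf : W.IsSolution f) (hg : W.IsSolution g) {x : ℝ × ℝ} (hx : x ∈ D)
    (h : jet k x f = jet k x g) : Set.EqOn f g D := fun y hy => by
  have h1 := (hf.comb 1 (-1) hg).eq_zero hk hD hx (by
    rw [jet_comb W.isOpen 1 (-1) hf.1.1 hg.1.1 hx, h]
    simp) y hy
  simpa [← sub_eq_add_neg, sub_eq_zero] using h1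

theorem isSolution_of_local {lam : ℝ × ℝ → Fin d → ℝ}
    (h : ∀ x ∈ D, ∃ (U : Set (ℝ × ℝ)) (hU : IsOpen U) (hUD : U ⊆ D) (f : ℝ × ℝ → Fin d → ℝ),
      x ∈ U ∧ (W.restrict U hU hUD).IsSolution f ∧ Set.EqOn lam f U) : W.IsSolution lam := by
  have h' : ∀ x ∈ D, ∃ (U : Set (ℝ × ℝ)) (hU : IsOpen U) (hUD : U ⊆ D), x ∈ U ∧
      (W.restrict U hU hUD).IsSolution lam := fun x hx => by
    obtain ⟨U, hU, hUD, f, hxU, hf, he⟩ := h x hx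
    exact ⟨U, hU, hUD, hxU, hf.congr he⟩
  refine ⟨⟨fun x hx => ?_, fun x hx => ?_⟩, fun i x hx => ?_⟩ <;>
    obtain ⟨U, hU, hUD, hxU, hs⟩ := h' x hx
  · exact (hs.1.1.contDiffAt (hU.mem_nhds hxU)).contDiffWithinAt
  · exact hs.1.2 x hxU
  · exact hs.2 i x hxU

/-- On a simply connected domain, local solutions extend to global solutions. -/
theorem exists_global_solution (hk : k + 3 = d) [SimplyConnectedSpace D]
    (h : ∀ x : D, ∃ ρ > 0, ∃ hb : Metric.ball (x : ℝ × ℝ) ρ ⊆ D, ∀ j ∈ W.prolongation k x, ∃ lam,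
      (W.restrict _ Metric.isOpen_ball hb).IsSolution lam ∧ jet k x lam = j)
    (x₀ : D) {j₀ : JetFibre d k} (hj₀ : j₀ ∈ W.prolongation k x₀) :
    ∃ lam, W.IsSolution lam ∧ jet k x₀ lam = j₀ := by
  choose ρ hρ hb H using h
  let U : D → Set (ℝ × ℝ) := fun i => Metric.ball (i : ℝ × ℝ) (ρ i)
  have hUo : ∀ i, IsOpen (U i) := fun i => Metric.isOpen_ball
  have hUp : ∀ i, IsPreconnected (U i) := fun i => (convex_ball _ _).isPreconnected
  have hcen : ∀ i : D, (i : ℝ × ℝ) ∈ U i := fun i => Metric.mem_ball_self (hρ i)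
  let e : ∀ i : D, W.prolongation k i ≃ₗ[ℝ] (Fin ((d - 1) * (d - 2) / 2) → ℝ) := fun i =>
    (Module.finBasisOfFinrankEq ℝ _ (W.finrank_top_prolongation hk i)).equivFun
  have hsol : ∀ (i : D) (v : Fin ((d - 1) * (d - 2) / 2) → ℝ), ∃ lam,
      (W.restrict (U i) (hUo i) (hb i)).IsSolution lam ∧ jet k i lam = (e i).symm v :=
    fun i v => H i _ ((e i).symm v).2
  choose sol hsol hjet using hsol
  have huniq : ∀ (i : D) {f g : ℝ × ℝ → Fin d → ℝ},
      (W.restrict (U i) (hUo i) (hb i)).IsSolution f →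
      (W.restrict (U i) (hUo i) (hb i)).IsSolution g → ∀ {x}, x ∈ U i → jet k x f = jet k x g →
      ∀ {y}, y ∈ U i → jet k y f = jet k y g := fun i f g hf hg x hx he y hy =>
    jet_congr (hUo i) (hf.eqOn hk (hUp i) hg hx he) hy
  have hinj : ∀ (i : D) {x}, x ∈ U i → ∀ v w, jet k x (sol i v) = jet k x (sol i w) → v = w := by
    intro i x hx v w hvw
    have := huniq i (hsol i v) (hsol i w) hx hvw (hcen i)
    rw [hjet, hjet] at this
    exact (e i).symm.injective (Subtype.ext this)
  -- On each ball the rank is maximal, judged at the centre; `rank_eq_iff` transfers the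
  -- realizability of jets to all of its points.
  have hsurj : ∀ (i x : D), (x : ℝ × ℝ) ∈ U i → ∀ j ∈ W.prolongation k x,
      ∃ w, jet k x (sol i w) = j := by
    intro i x hx j hj
    have hr := ((W.restrict (U i) (hUo i) (hb i)).rank_eq_iff hk (hUp i) ⟨i, hcen i⟩).2
      fun j hj => by
        rw [W.prolongation_restrict] at hj
        exact H i j hj
    obtain ⟨lam, hlam, rfl⟩ := ((W.restrict (U i) (hUo i) (hb i)).rank_eq_iff hk (hUp i)
      ⟨x, hx⟩).1 hr j (by rwa [W.prolongation_restrict])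
    have hm := hlam.jet_mem k ⟨i, hcen i⟩
    rw [W.prolongation_restrict] at hm
    refine ⟨e i ⟨jet k i lam, hm⟩, huniq i (hsol i _) hlam (hcen i) ?_ hx⟩
    rw [hjet, LinearEquiv.symm_apply_apply]
  -- Transition functions: `w` labels the solution on `U j` with the same jet at `x` as the solution
  -- `v` on `U i`. Off the overlap the value is irrelevant.
  have hg : ∀ (i j x : D) (v : Fin ((d - 1) * (d - 2) / 2) → ℝ), ∃ w, (x : ℝ × ℝ) ∈ U i ∩ U j →
      jet k x (sol j w) = jet k x (sol i v) := by
    intro i j x v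
    by_cases hx : (x : ℝ × ℝ) ∈ U i ∩ U j
    · have hm := (hsol i v).jet_mem k ⟨x, hx.1⟩
      rw [W.prolongation_restrict] at hm
      obtain ⟨w, hw⟩ := hsurj j x hx.2 _ hm
      exact ⟨w, fun _ => hw⟩
    · exact ⟨v, fun h => absurd h hx⟩
  choose g hg using hg
  have := W.isOpen.locallyPathConnectedSpace
  obtain ⟨σ, hσ0, hσ⟩ := exists_compatible_family (fun i : D => Subtype.val ⁻¹' U i)
    (fun i => (hUo i).preimage continuous_subtype_val)
    (fun i => by
      rw [← Topology.IsInducing.subtypeVal.isPreconnected_image, Subtype.image_preimage_coe,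
        Set.inter_eq_right.2 (hb i)]
      exact hUp i)
    id hcen g
    (fun i x hx v => hinj i hx _ _ (hg i i x v ⟨hx, hx⟩))
    (fun i j x hx y hy v => by
      -- Overlaps of balls are convex, so two solutions that agree to order `d - 3` at one point
      -- agree on the whole overlap, and the label is constant.
      have hUV : IsOpen (U i ∩ U j) := (hUo i).inter (hUo j)
      have s1 := (hsol j (g i j x v)).mono hUV Set.inter_subset_right
      have s2 := (hsol i v).mono hUV Set.inter_subset_left
      have he := IsSolution.eqOn (W := W.restrict (U i ∩ U j) hUV
        (Set.inter_subset_left.trans (hb i))) hk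
        (((convex_ball _ _).inter (convex_ball _ _)).isPreconnected) s1 s2 hx (hg i j x v hx)
      refine hinj j hy.2 _ _ ?_
      rw [hg i j y v hy]
      exact jet_congr hUV he hy)
    (fun i j l x hx v => hinj l hx.2 _ _ (by
      rw [hg j l x _ ⟨hx.1.2, hx.2⟩, hg i j x _ hx.1, hg i l x _ ⟨hx.1.1, hx.2⟩]))
    x₀ (e x₀ ⟨j₀, hj₀⟩)
  choose v hv using hσ
  -- The global solution takes at `x` the value of the local solution centred at `x` with label `σ
  -- x`. On each ball this is a single local solution.
  have hval : ∀ i : D, Set.EqOn (fun x => open Classical in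
      if hx : x ∈ D then sol ⟨x, hx⟩ (σ ⟨x, hx⟩) x else 0) (sol i (v i)) (U i) := by
    intro i x hx
    have hxD := hb i hx
    have h1 := hg ⟨x, hxD⟩ i ⟨x, hxD⟩ (σ ⟨x, hxD⟩) ⟨hcen _, hx⟩
    have h2 := hv i ⟨x, hxD⟩ hx
    simp only [id] at h2
    rw [h2] at h1
    beta_reduce
    rw [dif_pos hxD]
    exact (congrFun h1 ⟨(0, 0), Nat.zero_le _⟩).symm
  refine ⟨_, isSolution_of_local fun x hx => ⟨U ⟨x, hx⟩, hUo _, hb _, sol ⟨x, hx⟩ (v ⟨x, hx⟩), hcen _,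
    hsol _ _, hval _⟩, ?_⟩
  rw [jet_congr (hUo x₀) (hval x₀) (hcen x₀)]
  have h1 := hg x₀ x₀ x₀ (σ x₀) ⟨hcen _, hcen _⟩
  have h2 := hv x₀ x₀ (hcen x₀)
  simp only [id] at h2
  rw [h2] at h1
  rw [h1, hjet, hσ0, LinearEquiv.symm_apply_apply]

end PlanarWeb

end WebGeometry

end

/-! ### Maximum rank and vanishing of the obstruction -/

open scoped ContDiff

noncomputable section

namespace WebGeometry

namespace PlanarWeb

variable {k : ℕ} {D : Set (ℝ × ℝ)} {N W : PlanarWeb (k + 3) D}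

theorem IsNormalized.exists_local_solution (hN : N.IsNormalized)
    (h : ∀ x, N.obstructionMap x = 0) (x : D) :
    ∃ ρ > 0, ∃ hb : Metric.ball (x : ℝ × ℝ) ρ ⊆ D, ∀ j ∈ N.prolongation k x, ∃ lam,
      (N.restrict _ Metric.isOpen_ball hb).IsSolution lam ∧ jet k x lam = j :=
  N.exists_local_solution rfl (fun y _ hj => hN.map_jetProj_of_obstructionMap y (h y) hj) x

theorem IsNormalized.exists_rank_eq (hN : N.IsNormalized)
    (h : ∀ x, N.obstructionMap x = 0) {x : ℝ × ℝ} (hx : x ∈ D) :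
    ∃ (U : Set (ℝ × ℝ)) (hU : IsOpen U) (hUD : U ⊆ D), x ∈ U ∧ IsConnected U ∧
      (N.restrict U hU hUD).rank = (k + 2) * (k + 1) / 2 := by
  obtain ⟨ρ, hρ, hb, hs⟩ := hN.exists_local_solution h ⟨x, hx⟩
  have hxb : x ∈ Metric.ball x ρ := Metric.mem_ball_self hρ
  have hc : IsConnected (Metric.ball x ρ) := ⟨⟨x, hxb⟩, (convex_ball _ _).isPreconnected⟩
  refine ⟨_, Metric.isOpen_ball, hb, hxb, hc, ?_⟩
  refine ((N.restrict _ Metric.isOpen_ball hb).rank_eq_iff (k := k) rfl hc.isPreconnected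
    ⟨x, hxb⟩).2 fun j hj => ?_
  rw [prolongation_restrict] at hj
  exact hs j hj

/-- Maximum rank realizes every `(d-3)`-jet by a local solution. As the last projection is
injective, this solution also has the given `(d-2)`-jet, and the obstruction of a solution is zero.
-/
theorem IsNormalized.obstructionMap_eq_zero_of_rank_restrict (hN : N.IsNormalized) {x : D}
    {U : Set (ℝ × ℝ)} (hU : IsOpen U) (hUD : U ⊆ D) (hx : (x : ℝ × ℝ) ∈ U) (hc : IsConnected U)
    (h : (N.restrict U hU hUD).rank = (k + 2) * (k + 1) / 2) : N.obstructionMap x = 0 := by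
  have hs := ((N.restrict U hU hUD).rank_eq_iff (k := k) rfl hc.isPreconnected ⟨x, hx⟩).1 h
  ext ⟨j, hj⟩
  obtain ⟨lam, hlam, hl⟩ := hs (jetProj _ k.le_succ j) (by
    rw [prolongation_restrict]
    exact N.jetProj_mem_prolongation _ hj)
  have hm : jet (k + 1) x lam ∈ N.prolongation (k + 1) x := by
    have := hlam.jet_mem (k + 1) ⟨x, hx⟩
    rwa [prolongation_restrict] at this
  obtain rfl : jet (k + 1) x lam = j := (N.bijOn_jetProj rfl x).2.1 hm hj hl
  have hNU : (N.restrict U hU hUD).IsNormalized :=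
    fun y hy => hN y (hUD hy)
  exact (obstructionMap_jet x hU hUD hlam.1.1 hx hj).trans (hNU.obstruction_eq_zero hlam hx)

theorem IsNormalized.rank_eq_iff (hN : N.IsNormalized) (hD : IsConnected D)
    [SimplyConnectedSpace D] :
    N.rank = (k + 2) * (k + 1) / 2 ↔ ∀ x, N.obstructionMap x = 0 := by
  refine ⟨fun h x => hN.obstructionMap_eq_zero_of_rank_restrict N.isOpen subset_rfl x.2 hD h,
    fun h => ?_⟩
  obtain ⟨x, hx⟩ := hD.nonempty
  exact (N.rank_eq_iff (k := k) rfl hD.isPreconnected ⟨x, hx⟩).2 fun j hj =>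
    N.exists_global_solution rfl (hN.exists_local_solution h) ⟨x, hx⟩ hj

end PlanarWeb

end WebGeometry

end

theorem mainTheorem4 {d : ℕ} {D : Set (ℝ × ℝ)} (hD : IsConnected D)
    (W : WebGeometry.PlanarWeb d D) :
    -- the tower of prolongations
    (∀ k, k ≤ d - 2 → WebGeometry.IsVectorSubbundle D (W.prolongation k)
      (∑ j ∈ Finset.range (k + 1), (d - 2 - j))) ∧
    (∀ k, k + 1 ≤ d - 2 → ∀ x : D,
      (W.prolongation (k + 1) x).map (WebGeometry.jetProj d k.le_succ) = W.prolongation k x ∧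
      Module.finrank ℝ (W.prolongation (k + 1) x ⊓
        LinearMap.ker (WebGeometry.jetProj d k.le_succ) : Submodule ℝ _) = d - (k + 1) - 2) ∧
    -- the last projection is an isomorphism and defines a linear connection
    WebGeometry.IsVectorSubbundle D (W.prolongation (d - 3)) ((d - 1) * (d - 2) / 2) ∧
    (∀ x : D, Set.BijOn
      (WebGeometry.jetProj d (show d - 3 ≤ d - 2 by omega))
      (W.prolongation (d - 2) x) (W.prolongation (d - 3) x)) ∧
    (∃ nabla : ℝ × ℝ → (ℝ × ℝ → WebGeometry.JetFibre d (d - 3)) →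
        ℝ × ℝ → WebGeometry.JetFibre d (d - 3),
      WebGeometry.IsLinearConnection D (W.prolongation (d - 3)) nabla ∧
      ∀ v s, WebGeometry.IsSmoothSection D (W.prolongation (d - 3)) s →
        ∀ x : D, ∀ j ∈ W.prolongation (d - 2) x,
          WebGeometry.jetProj d (show d - 3 ≤ d - 2 by omega) j = s x →
          nabla v s x = fderiv ℝ s x v -
            WebGeometry.totalDeriv d (show d - 3 + 1 ≤ d - 2 by have := W.three_le; omega) v j) ∧
    -- the rank is at most `(d-1)(d-2)/2`
    (FiniteDimensional ℝ W.Sol ∧ W.rank ≤ (d - 1) * (d - 2) / 2) ∧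
    -- the web has a normalization
    (∃ N : WebGeometry.PlanarWeb d D, N.IsNormalized ∧ N.SameFoliations W) ∧
    -- for every normalization, the obstruction is a linear function on the bundle `𝔄_{d-2}`,
    -- and it vanishes if and only if the web is of maximum rank
    (∀ N : WebGeometry.PlanarWeb d D, N.IsNormalized → N.SameFoliations W →
      ∃ κ : (x : D) → (N.prolongation (d - 2) x →ₗ[ℝ] ℝ),
        (∀ (x : D) (lam : ℝ × ℝ → Fin d → ℝ), N.IsSection lam →
          ∀ h : WebGeometry.jet (d - 2) x lam ∈ N.prolongation (d - 2) x,
            κ x ⟨WebGeometry.jet (d - 2) x lam, h⟩ = N.obstruction lam x) ∧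
        ((∀ x ∈ D, ∃ (U : Set (ℝ × ℝ)) (hU : IsOpen U) (h : U ⊆ D), x ∈ U ∧ IsConnected U ∧
          (W.restrict U hU h).rank = (d - 1) * (d - 2) / 2) ↔ ∀ x, κ x = 0) ∧
        (SimplyConnectedSpace D → (W.rank = (d - 1) * (d - 2) / 2 ↔ ∀ x, κ x = 0))) := by
  -- With `d = m + 3` the orders `d - 2` and `d - 3` reduce definitionally to `m + 1` and `m`.
  obtain ⟨m, rfl⟩ : ∃ m, d = m + 3 := ⟨d - 3, by have := W.three_le; omega⟩
  obtain ⟨x₀, hx₀⟩ := hD.nonempty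
  refine ⟨fun k hk => W.isVectorSubbundle_prolongation hk, fun k hk x =>
    ⟨W.map_jetProj_prolongation hk x, W.finrank_prolongation_inf_ker hk x⟩, ?_,
    fun x => W.bijOn_jetProj rfl x, ⟨W.nabla m, W.isLinearConnection_nabla rfl, ?_⟩,
    ⟨W.finiteDimensional_sol (k := m) rfl hD.isPreconnected ⟨x₀, hx₀⟩,
      W.rank_le (k := m) rfl hD.isPreconnected ⟨x₀, hx₀⟩⟩,
    W.exists_isNormalized, fun N hN hNW => ⟨N.obstructionMap, ?_, ?_, fun hS => ?_⟩⟩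
  · rw [← WebGeometry.PlanarWeb.sum_rank (k := m) rfl]
    exact W.isVectorSubbundle_prolongation (k := m) (by omega)
  · exact fun v s _ x j hj hjs => W.nabla_eq rfl v x hj hjs
  · exact fun x lam hlam h =>
      N.obstructionMap_jet x N.isOpen subset_rfl hlam.1 x.2 h
  · constructor
    · intro h x
      obtain ⟨U, hU, hUD, hx, hc, hr⟩ := h x x.2
      -- The rank is a property of the foliations, so it may be computed with the normalized forms.
      rw [← (hNW.restrict U hU hUD).rank_eq (k := m) rfl hc] at hr
      exact hN.obstructionMap_eq_zero_of_rank_restrict hU hUD hx hc hr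
    · intro h x hx
      obtain ⟨U, hU, hUD, hxU, hc, hr⟩ := hN.exists_rank_eq h hx
      refine ⟨U, hU, hUD, hxU, hc, ?_⟩
      rwa [← (hNW.restrict U hU hUD).rank_eq (k := m) rfl hc]
  · rw [← hNW.rank_eq (k := m) rfl hD]
    exact hN.rank_eq_iff hD
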